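/- **Setting.** Let $X,Y$ be (real or complex) Hilbert spaces and $F:D(F)\subset X\to Y$ Fréchet differentiable with derivative $F'$. Let $x^\dagger\in D(F)$, $y=F(x^\dagger)$, and let $y^\delta\in Y$ satisfy $\|y^\delta-y\|\le\delta$ with $\delta>0$. For $g_\alpha$ ($\alpha>0$), real functions continuous on $[0,1/2]$, put $r_\alpha(\lambda)=1-\lambda g_\alpha(\lambda)$; $f(T)$ denotes the functional calculus of the bounded self-adjoint operator $T$. For $x_0\in X$ and a sequence $(\alpha_k)_{k\ge0}$ let $x_0^\delta=x_0$ and $$x_{k+1}^\delta=x_0-g_{\alpha_k}\big(F'(x_k^\delta)^*F'(x_k^\delta)\big)F'(x_k^\delta)^*\big(F(x_k^\delta)-y^\delta-F'(x_k^\delta)(x_k^\delta-x_0)\big).$$ Let $r>1$, $\tau>1$, $c_0,c_1,c_2,c_3,c_4,c_7,c_8>0$, $c_5>1$, and fix $\gamma_1>c_3r^{1/2}/(\tau-1)$. Write $B=B_\rho(x^\dagger)$ for the open ball, $\rho>0$. **Assumptions.** 1. For all $\alpha>0$, $\lambda\in[0,1/2]$: $0<r_\alpha(\lambda)\le1$,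 $r_\alpha(\lambda)\lambda\le c_0\alpha$, $0\le g_\alpha(\lambda)\le c_1\alpha^{-1}$, $r_\alpha(\lambda)\lambda^{1/2}\le c_3\alpha^{1/2}$, $g_\alpha(\lambda)\lambda^{1/2}\le c_4\alpha^{-1/2}$; and for $0<\alpha\le\beta$, $\lambda\in[0,1/2]$: $r_\alpha(\lambda)\le r_\beta(\lambda)$ and $r_\beta(\lambda)-r_\alpha(\lambda)\le c_2\sqrt{\lambda/\alpha}\,r_\beta(\lambda)$. 2. $\alpha_k>0$, $1\le\alpha_k/\alpha_{k+1}\le r$, $\alpha_k\to0$, and $r_{\alpha_k}(\lambda)\le c_5r_{\alpha_{k+1}}(\lambda)$ for all $k$ and $\lambda\in[0,1/2]$. 3. $B\subset D(F)$, $\rho>2(1+c_4\gamma_1)\|x_0-x^\dagger\|$, and for some $0<\beta_0\le1/2$ with $r_{\alpha_0}\ge3/4$ on $[0,\beta_0]$ we have $\|F'(x)\|\le\min\{c_3\alpha_0^{1/2},\beta_0^{1/2}\}$ for $x\in B$. 4. There is $K_0>0$ such that for all $x,z\in B$ there is a bounded linear operator $R(x,z)$ on $X$ with $F'(x)=F'(z)R(x,z)$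 and $\|I-R(x,z)\|\le K_0\|x-z\|$. 5. There are $K_1,K_2>0$ with $\|[F'(x)-F'(z)]w\|\le K_1\|x-z\|\|F'(z)w\|+K_2\|F'(z)(x-z)\|\|w\|$ for all $x,z\in B$, $w\in X$. 6. For all $x,z\in B$ and $\alpha>0$, with $\Delta=r_\alpha(F'(x)^*F'(x))-r_\alpha(F'(z)^*F'(z))$: $\|\Delta\|\le c_7K_0\|x-z\|$ and $\|F'(x)\Delta\|\le c_8(K_0+K_1)\alpha^{1/2}\|x-z\|+c_8K_2\big(\|F'(x)(x-z)\|+\|F'(z)(x-z)\|\big)$. The qualification $\bar\nu\in[1,\infty]$ of $\{g_\alpha\}$ is the largest number such that for each real $0\le\nu\le\bar\nu$ there is $d_\nu>0$ with $r_\alpha(\lambda)\lambda^\nu\le d_\nu\alpha^\nu$ for all $\alpha>0$, $\lambda\in[0,1/2]$. **Theorem.** There is a constant $\eta_1>0$, depending only on $r,\tau,\gamma_1$ and $c_0,\dots,c_5,c_7,c_8$, such that, if assumptions 1–6 hold and $(K_0+K_1+K_2)\|x_0-x^\dagger\|\le\eta_1$, then there is a first integer $k_\delta\ge0$ with $\|F(x_{k_\delta}^\delta)-y^\delta\|\le\tau\delta$,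 the iterates $x_k^\delta$, $0\le k\le k_\delta$, lie in $B$ (so they are well defined), and: (i) if $\{g_\alpha\}$ has qualification $\bar\nu$ and $x_0-x^\dagger=(F'(x^\dagger)^*F'(x^\dagger))^\nu\omega$ for some $\omega\in X$ and $0<\nu\le\bar\nu-1/2$, then $$\|x_{k_\delta}^\delta-x^\dagger\|\le C_\nu\|\omega\|^{1/(1+2\nu)}\delta^{2\nu/(1+2\nu)},$$ where $C_\nu$ depends only on $r,\tau,\gamma_1,\nu$, $c_0,\dots,c_5,c_7,c_8$ and on a constant $d_{\nu+1/2}$ as in the definition of the qualification; (ii) if $x_0-x^\dagger=\big(-\log(F'(x^\dagger)^*F'(x^\dagger))\big)^{-\mu}\omega$ for some $\omega\in X$ and $\mu>0$, and if $\delta\le M\|\omega\|$ for some number $M$, then $$\|x_{k_\delta}^\delta-x^\dagger\|\le C_\mu\|\omega\|\Big(1+\Big|\ln\frac{\delta}{\|\omega\|}\Big|\Big)^{-\mu},$$ where $C_\mu$ depends only on $r,\tau,\gamma_1,\mu,M$ and $c_0,\dots,c_5,c_7,c_8$. (Here $(-\log\lambda)^{-\mu}$ is taken to be $0$ at $\lambda=0$.)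 -/

import Mathlib

open Filter Topology Set

noncomputable section

/-- The filter on real polynomials describing uniform approximation of `f` on the set `s`. -/
def polyApprox (f : ℝ → ℝ) (s : Set ℝ) : Filter (Polynomial ℝ) :=
  ⨅ ε ∈ Ioi (0 : ℝ), 𝓟 {p : Polynomial ℝ | ∀ t ∈ s, |p.eval t - f t| ≤ ε}

/-- The continuous functional calculus `f(T)` of a bounded positive self-adjoint operator `T` on a
real or complex Hilbert space, for `f` continuous on `[0, ‖T‖]` (an interval that contains the
spectrum of `T`): the limit in operator norm of `p(T)` as the real polynomials `p` tend to `f`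
uniformly on `[0, ‖T‖]`. -/
def opFun {𝕜 X : Type*} [RCLike 𝕜] [NormedAddCommGroup X] [InnerProductSpace 𝕜 X]
    (f : ℝ → ℝ) (T : X →L[𝕜] X) : X →L[𝕜] X :=
  limUnder (polyApprox f (Icc 0 ‖T‖))
    (fun p : Polynomial ℝ => Polynomial.aeval T (p.map (algebraMap ℝ 𝕜)))

/-- `A* A`. -/
def normalOp {𝕜 X Y : Type*} [RCLike 𝕜] [NormedAddCommGroup X] [InnerProductSpace 𝕜 X]
    [CompleteSpace X] [NormedAddCommGroup Y] [InnerProductSpace 𝕜 Y] [CompleteSpace Y]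
    (A : X →L[𝕜] Y) : X →L[𝕜] X :=
  (ContinuousLinearMap.adjoint A).comp A

/-- The residual function `r_α(t) = 1 - t g_α(t)`. -/
def residualFn (g : ℝ → ℝ → ℝ) (a t : ℝ) : ℝ := 1 - t * g a t

/-- The conditions on the family `g_α`: continuity on `[0, 1/2]`, the bounds
`0 < r_α ≤ 1`, `r_α(t) t ≤ c₀ α`, `0 ≤ g_α ≤ c₁ / α`, constants `c₃`, `c₄` for the two estimates
with the weight `√t`, monotonicity of `r_α` in `α`, and the relative bound on `r_β - r_α`. -/
structure FilterConditions (g : ℝ → ℝ → ℝ) (c₀ c₁ c₂ c₃ c₄ : ℝ) : Prop where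
  continuousOn : ∀ a : ℝ, 0 < a → ContinuousOn (g a) (Icc 0 (1 / 2))
  residual_pos : ∀ a : ℝ, 0 < a → ∀ t ∈ Icc (0 : ℝ) (1 / 2), 0 < residualFn g a t
  residual_le_one : ∀ a : ℝ, 0 < a → ∀ t ∈ Icc (0 : ℝ) (1 / 2), residualFn g a t ≤ 1
  residual_mul_le : ∀ a : ℝ, 0 < a → ∀ t ∈ Icc (0 : ℝ) (1 / 2), residualFn g a t * t ≤ c₀ * a
  nonneg : ∀ a : ℝ, 0 < a → ∀ t ∈ Icc (0 : ℝ) (1 / 2), 0 ≤ g a t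
  le_inv : ∀ a : ℝ, 0 < a → ∀ t ∈ Icc (0 : ℝ) (1 / 2), g a t ≤ c₁ * a⁻¹
  residual_mul_sqrt_le : ∀ a : ℝ, 0 < a → ∀ t ∈ Icc (0 : ℝ) (1 / 2),
    residualFn g a t * √t ≤ c₃ * √a
  mul_sqrt_le : ∀ a : ℝ, 0 < a → ∀ t ∈ Icc (0 : ℝ) (1 / 2), g a t * √t ≤ c₄ * (√a)⁻¹
  residual_mono : ∀ a b : ℝ, 0 < a → a ≤ b → ∀ t ∈ Icc (0 : ℝ) (1 / 2),
    residualFn g a t ≤ residualFn g b t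
  residual_sub_le : ∀ a b : ℝ, 0 < a → a ≤ b → ∀ t ∈ Icc (0 : ℝ) (1 / 2),
    residualFn g b t - residualFn g a t ≤ c₂ * √(t / a) * residualFn g b t

/-- `d` is an admissible constant for the exponent `ν`: `r_α(t) t^ν ≤ d α^ν`. -/
def QualificationBound (g : ℝ → ℝ → ℝ) (ν d : ℝ) : Prop :=
  ∀ a : ℝ, 0 < a → ∀ t ∈ Icc (0 : ℝ) (1 / 2), residualFn g a t * t ^ ν ≤ d * a ^ ν

/-- `νbar` (possibly `⊤`) is the qualification of the linear regularization method given by `g`: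
the largest number such that every exponent `0 ≤ ν ≤ νbar` admits a positive constant. -/
def IsQualification (g : ℝ → ℝ → ℝ) (νbar : EReal) : Prop :=
  IsGreatest {s : EReal | ∀ ν : ℝ, 0 ≤ ν → (ν : EReal) ≤ s →
    ∃ d : ℝ, 0 < d ∧ QualificationBound g ν d} νbar

/-- The conditions on the sequence `α_k`, including its interplay with `r_α`. -/
structure SequenceConditions (g : ℝ → ℝ → ℝ) (α : ℕ → ℝ) (r c₅ : ℝ) : Prop where
  pos : ∀ k, 0 < α k
  one_le_ratio : ∀ k, 1 ≤ α k / α (k + 1)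
  ratio_le : ∀ k, α k / α (k + 1) ≤ r
  tendsto_zero : Tendsto α atTop (𝓝 0)
  residual_le : ∀ k, ∀ t ∈ Icc (0 : ℝ) (1 / 2),
    residualFn g (α k) t ≤ c₅ * residualFn g (α (k + 1)) t

section Operators

variable {𝕜 X Y : Type*} [RCLike 𝕜] [NormedAddCommGroup X] [InnerProductSpace 𝕜 X]
  [CompleteSpace X] [NormedAddCommGroup Y] [InnerProductSpace 𝕜 Y] [CompleteSpace Y]

/-- `F` is Fréchet differentiable on its domain `D`, which contains `B_ρ(x†)`, with derivative
`F'`, and `F'` obeys the scaling condition on the ball; `α₀` is the first regularization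
parameter. -/
structure OperatorConditions (D : Set X) (F : X → Y) (F' : X → X →L[𝕜] Y) (xdag : X)
    (ρ : ℝ) (g : ℝ → ℝ → ℝ) (c₃ α₀ : ℝ) : Prop where
  hasFDerivWithinAt : ∀ x ∈ D, HasFDerivWithinAt F (F' x) D x
  ball_subset : Metric.ball xdag ρ ⊆ D
  scaling : ∃ β₀ : ℝ, 0 < β₀ ∧ β₀ ≤ 1 / 2 ∧ (∀ t ∈ Icc 0 β₀, 3 / 4 ≤ residualFn g α₀ t) ∧
    ∀ x ∈ Metric.ball xdag ρ, ‖F' x‖ ≤ min (c₃ * √α₀) (√β₀)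

/-- `F'(x) = F'(z) R(x, z)` with `‖I - R(x, z)‖ ≤ K₀ ‖x - z‖` on the ball. -/
def RangeInvariance (F' : X → X →L[𝕜] Y) (xdag : X) (ρ K₀ : ℝ) : Prop :=
  ∀ x ∈ Metric.ball xdag ρ, ∀ z ∈ Metric.ball xdag ρ, ∃ R : X →L[𝕜] X,
    F' x = (F' z).comp R ∧ ‖ContinuousLinearMap.id 𝕜 X - R‖ ≤ K₀ * ‖x - z‖

/-- The two-term condition on differences of the derivative. -/
def TwoTermCondition (F' : X → X →L[𝕜] Y) (xdag : X) (ρ K₁ K₂ : ℝ) : Prop :=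
  ∀ x ∈ Metric.ball xdag ρ, ∀ z ∈ Metric.ball xdag ρ, ∀ w : X,
    ‖(F' x - F' z) w‖ ≤ K₁ * ‖x - z‖ * ‖F' z w‖ + K₂ * ‖F' z (x - z)‖ * ‖w‖

/-- The two structured commutator estimates for `r_α(F'(x)* F'(x)) - r_α(F'(z)* F'(z))`. -/
structure CommutatorEstimates (F' : X → X →L[𝕜] Y) (xdag : X) (ρ : ℝ) (g : ℝ → ℝ → ℝ)
    (K₀ K₁ K₂ c₇ c₈ : ℝ) : Prop where
  first : ∀ x ∈ Metric.ball xdag ρ, ∀ z ∈ Metric.ball xdag ρ, ∀ a : ℝ, 0 < a →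
    ‖opFun (residualFn g a) (normalOp (F' x)) - opFun (residualFn g a) (normalOp (F' z))‖
      ≤ c₇ * K₀ * ‖x - z‖
  second : ∀ x ∈ Metric.ball xdag ρ, ∀ z ∈ Metric.ball xdag ρ, ∀ a : ℝ, 0 < a →
    ‖(F' x).comp
        (opFun (residualFn g a) (normalOp (F' x)) - opFun (residualFn g a) (normalOp (F' z)))‖
      ≤ c₈ * (K₀ + K₁) * √a * ‖x - z‖ + c₈ * K₂ * (‖F' x (x - z)‖ + ‖F' z (x - z)‖)

/-- The Newton type iteration with data `yδ`, started at `x₀`. -/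
def newtonIter (F : X → Y) (F' : X → X →L[𝕜] Y) (g : ℝ → ℝ → ℝ) (α : ℕ → ℝ) (x₀ : X) (yδ : Y) :
    ℕ → X
  | 0 => x₀
  | k + 1 =>
    let x := newtonIter F F' g α x₀ yδ k
    x₀ - opFun (g (α k)) (normalOp (F' x))
      (ContinuousLinearMap.adjoint (F' x) (F x - yδ - F' x (x - x₀)))

/-- `k` is the index selected by the discrepancy principle for the sequence `x`. -/
def IsDiscrepancyIndex (F : X → Y) (x : ℕ → X) (yδ : Y) (τ δ : ℝ) (k : ℕ) : Prop :=
  ‖F (x k) - yδ‖ ≤ τ * δ ∧ ∀ j < k, τ * δ < ‖F (x j) - yδ‖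

end Operators

end

/-!
The error of the iterates is traced back to the linear method at the exact solution. Write
`T = F'(x†)`, `A = T* T`, `e₀ = x₀ - x†`, `κ = (K₀ + K₁ + K₂) ‖e₀‖`, and `A_k` for the normal
operator at the iterate `x_k`. One step of the iteration reads
`x_{k+1} - x† = r_{α_k}(A_k) e₀ - (correction)`, where the correction applies
`g_{α_k}(A_k) F'(x_k)*` to the noise and to the Taylor remainder of `F`. The two-term condition
bounds the remainder by a multiple of `κ ‖T (x_k - x†)‖`, and the commutator estimates allow one
to replace `A_k` by `A`, or by the normal operator at another iterate, at the price of terms with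
a factor `κ`.

* Up to the first `n` with `γ₁ ‖e₀‖ √α_n ≤ δ`, the iterates remain near `x†`, and the discrepancy
  principle stops no later than at `n` (`apriori_bounds`, `exists_stopping`).
* The error is bounded by the level of the linear method, `√α_k ‖r(A) e₀‖ + ‖T r(A) e₀‖`, plus
  the noise (`error_le_linLevel`); before stopping, the noise is bounded by that level
  (`noise_le_linLevel`).
* At the stopping index `l` the image error `‖T (x_l - x†)‖` is of order `δ`. It need not dominate
  `‖T r(A) e₀‖`, because exchanging `A_l` for `A` costs a term of order `κ √α_l ‖x_l - x†‖`.
  Instead, `x_l` is compared with the later iterates `x_k`: increments and image errors beyond `l`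
  are of order `‖T (x_l - x†)‖ + δ` over `√α_k` (`step_back`, `step_forward`), where only
  differences of iterates enter the commutator estimates. Hence
  `‖x_l - x†‖ ≲ level_k / √α_k + δ / √α_k` for all `k ≥ l` (`error_at_stopping`).

Both rates follow from `error_le_of_monotone`: a source condition bounds the level of the linear
method at parameter `a` by `√a Φ(a)` with `Φ` monotone, and then
`‖x_l - x†‖ ≲ Φ(s) + δ / √s` for every `s > 0`, where `s` is chosen to balance the two terms. Range
invariance of the derivative is not used beyond the commutator estimates.

The functional calculus has to work over real scalars as well. Its basis is the bound
`‖p(A)‖ ≤ max |p|` over `[0, ‖A‖]` for real polynomials (`norm_realAeval_le`): if `|p| < ‖p(A)‖` on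
that interval, then `‖p(A)‖² - p²` has no zeros there, so it is a product of linear and quadratic
factors each of which is bounded below at `A`; but `‖p(A)‖² - p(A)²` is never bounded below.
-/

noncomputable section

set_option linter.unusedSectionVars false

/-! ### Polynomials of a positive operator -/

open Polynomial in
/-- Evaluation of real polynomials at an operator on a real or complex Hilbert space. -/
def realAeval {𝕜 X : Type*} [RCLike 𝕜] [NormedAddCommGroup X] [InnerProductSpace 𝕜 X]
    (T : X →L[𝕜] X) : ℝ[X] →+* (X →L[𝕜] X) :=
  (Polynomial.aeval (R := 𝕜) T : Polynomial 𝕜 →ₐ[𝕜] (X →L[𝕜] X)).toRingHom.comp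
    (Polynomial.mapRingHom (algebraMap ℝ 𝕜))

section Calculus

variable {𝕜 X Y : Type*} [RCLike 𝕜] [NormedAddCommGroup X] [InnerProductSpace 𝕜 X]
  [CompleteSpace X] [NormedAddCommGroup Y] [InnerProductSpace 𝕜 Y] [CompleteSpace Y]

theorem realAeval_apply (T : X →L[𝕜] X) (p : Polynomial ℝ) :
    realAeval T p = Polynomial.aeval T (p.map (algebraMap ℝ 𝕜)) := rfl

theorem realAeval_C (T : X →L[𝕜] X) (a : ℝ) (x : X) :
    realAeval T (Polynomial.C a) x = (a : 𝕜) • x := by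
  simp [realAeval_apply, Algebra.algebraMap_eq_smul_one]

theorem realAeval_X (T : X →L[𝕜] X) : realAeval T Polynomial.X = T := by
  simp [realAeval_apply]

theorem realAeval_isSelfAdjoint {T : X →L[𝕜] X} (hT : IsSelfAdjoint T) (p : Polynomial ℝ) :
    IsSelfAdjoint (realAeval T p) := by
  induction p using Polynomial.induction_on' with
  | add p q hp hq => rw [map_add]; exact hp.add hq
  | monomial n a =>
    rw [realAeval_apply, Polynomial.map_monomial, Polynomial.aeval_monomial,
      ← Algebra.smul_def]
    refine IsSelfAdjoint.smul ?_ (hT.pow n)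
    simp [IsSelfAdjoint]

theorem normalOp_isSelfAdjoint (A : X →L[𝕜] Y) : IsSelfAdjoint (normalOp A) :=
  A.isPositive_adjoint_comp_self.isSelfAdjoint

theorem normalOp_inner_nonneg (A : X →L[𝕜] Y) (x : X) :
    0 ≤ RCLike.re (inner 𝕜 (normalOp A x) x) := by
  rw [normalOp, ContinuousLinearMap.comp_apply, ContinuousLinearMap.adjoint_inner_left,
    inner_self_eq_norm_sq]
  positivity

theorem norm_normalOp (A : X →L[𝕜] Y) : ‖normalOp A‖ = ‖A‖ ^ 2 := by
  rw [sq]; exact ContinuousLinearMap.norm_adjoint_comp_self A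

/-- A lower bound of the quadratic form gives a lower bound of the operator. -/
theorem bounded_below_of_inner {S : X →L[𝕜] X} {m : ℝ}
    (h : ∀ x, m * ‖x‖ ^ 2 ≤ RCLike.re (inner 𝕜 (S x) x)) (x : X) : m * ‖x‖ ≤ ‖S x‖ := by
  rcases eq_or_ne x 0 with rfl | hx
  · simp
  have hx' : 0 < ‖x‖ := norm_pos_iff.2 hx
  have h1 : RCLike.re (inner 𝕜 (S x) x) ≤ ‖S x‖ * ‖x‖ :=
    (RCLike.re_le_norm _).trans (norm_inner_le_norm _ _)
  have := (h x).trans h1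
  nlinarith

/-- A real polynomial without zeros on `[0, ‖A* A‖]` is bounded below at `A* A`: this holds for
each of its irreducible factors, which are linear or quadratic. -/
theorem realAeval_bounded_below (A : X →L[𝕜] Y) (q : Polynomial ℝ)
    (hq : ∀ t ∈ Icc 0 ‖normalOp A‖, q.eval t ≠ 0) :
    ∃ m : ℝ, 0 < m ∧ ∀ x, m * ‖x‖ ≤ ‖realAeval (normalOp A) q x‖ := by
  induction q using WfDvdMonoid.induction_on_irreducible with
  | zero => exact absurd (by simp) (hq 0 ⟨le_rfl, norm_nonneg _⟩)
  | unit u hu =>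
    obtain ⟨a, ha, rfl⟩ := Polynomial.isUnit_iff.1 hu
    refine ⟨|a|, abs_pos.2 ha.ne_zero, fun x => ?_⟩
    rw [realAeval_C, norm_smul, RCLike.norm_ofReal]
  | mul a p ha hp ih =>
    obtain ⟨m, hm, hm'⟩ := ih fun t ht h0 => hq t ht (by simp [h0])
    have hpq : ∀ t ∈ Icc 0 ‖normalOp A‖, p.eval t ≠ 0 :=
      fun t ht h0 => hq t ht (by simp [h0])
    suffices h : ∃ m : ℝ, 0 < m ∧ ∀ x, m * ‖x‖ ≤ ‖realAeval (normalOp A) p x‖ by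
      obtain ⟨k, hk, hk'⟩ := h
      refine ⟨k * m, by positivity, fun x => ?_⟩
      rw [map_mul, mul_apply_eq_comp, mul_assoc]
      exact (mul_le_mul_of_nonneg_left (hm' x) hk.le).trans (hk' _)
    have hd := hp.degree_le_two
    have hd0 : p.natDegree ≠ 0 := fun h => hp.not_isUnit
      (Polynomial.isUnit_iff_degree_eq_zero.2
        (by rw [Polynomial.degree_eq_natDegree hp.ne_zero, h]; rfl))
    have hd' : p.natDegree ≤ 2 := Polynomial.natDegree_le_of_degree_le hd
    have hlow : ∀ z : ℝ, z ∉ Icc 0 ‖normalOp A‖ → ∃ m : ℝ, 0 < m ∧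
        ∀ x, m * ‖x‖ ≤ ‖normalOp A x - (z : 𝕜) • x‖ := by
      intro z hz
      rcases lt_or_ge z 0 with h | h
      · refine ⟨-z, by linarith, fun x => ?_⟩
        have := bounded_below_of_inner (S := normalOp A - (z : 𝕜) • ContinuousLinearMap.id 𝕜 X)
          (m := -z) (fun x => ?_) x
        · simpa using this
        · have h1 := normalOp_inner_nonneg A x
          simp only [_root_.sub_apply, _root_.smul_apply,
            ContinuousLinearMap.id_apply, inner_sub_left, inner_smul_left, map_sub,
            RCLike.conj_ofReal, RCLike.re_ofReal_mul, inner_self_eq_norm_sq]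
          linarith
      · have h2 : ‖normalOp A‖ < z := by
          by_contra h3; exact hz ⟨h, not_lt.1 h3⟩
        refine ⟨z - ‖normalOp A‖, by linarith, fun x => ?_⟩
        have h3 := norm_sub_norm_le ((z : 𝕜) • x) (normalOp A x)
        rw [norm_sub_rev, norm_smul, RCLike.norm_ofReal, abs_of_nonneg h] at h3
        have h4 := (normalOp A).le_opNorm x
        linarith
    interval_cases hn : p.natDegree
    · exact absurd rfl hd0
    · obtain ⟨u, hu, v, rfl⟩ := Polynomial.natDegree_eq_one.1 hn
      have hz : -v / u ∉ Icc 0 ‖normalOp A‖ := fun h => hpq _ h (by simp; field_simp; ring)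
      obtain ⟨m, hm, hm'⟩ := hlow _ hz
      refine ⟨|u| * m, mul_pos (abs_pos.2 hu) hm, fun x => ?_⟩
      have : realAeval (normalOp A) (Polynomial.C u * Polynomial.X + Polynomial.C v) x
          = (u : 𝕜) • (normalOp A x - ((-v / u : ℝ) : 𝕜) • x) := by
        have hu' : (u : 𝕜) ≠ 0 := by exact_mod_cast hu
        rw [map_add, map_mul, realAeval_X, _root_.add_apply,
          mul_apply_eq_comp, realAeval_C, realAeval_C, smul_sub, smul_smul]
        push_cast
        rw [mul_div_cancel₀ _ hu', neg_smul, sub_neg_eq_add]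
      rw [this, norm_smul, RCLike.norm_ofReal, mul_assoc]
      exact mul_le_mul_of_nonneg_left (hm' x) (abs_nonneg _)
    · have hroot : ∀ t : ℝ, p.eval t ≠ 0 := by
        intro t ht
        have h1 := Polynomial.degree_eq_one_of_irreducible_of_root hp ht
        rw [Polynomial.degree_eq_natDegree hp.ne_zero, hn] at h1
        norm_num at h1
      obtain ⟨u, v, w, hu, rfl⟩ : ∃ u v w : ℝ, u ≠ 0 ∧ p = Polynomial.C u * Polynomial.X ^ 2 +
          Polynomial.C v * Polynomial.X + Polynomial.C w := by
        refine ⟨p.coeff 2, p.coeff 1, p.coeff 0, ?_, ?_⟩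
        swap
        · conv_lhs => rw [p.as_sum_range_C_mul_X_pow' (n := 3) (by omega)]
          simp only [Finset.sum_range_succ, Finset.sum_range_zero, pow_zero, pow_one, mul_one]
          ring
        rw [← hn]; exact Polynomial.leadingCoeff_ne_zero.2 hp.ne_zero
      -- Completing the square: `u t² + v t + w = u ((t - z)² + e)`.
      set z : ℝ := -v / (2 * u) with hz
      set e : ℝ := w / u - z ^ 2 with he
      have hform : ∀ t : ℝ, u * t ^ 2 + v * t + w = u * ((t - z) ^ 2 + e) := by
        intro t; rw [he, hz]; field_simp; ring
      have hepos : 0 < e := by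
        by_contra h
        apply hroot (z + √(-e))
        have h1 := hform (z + √(-e))
        simp only [Polynomial.eval_add, Polynomial.eval_mul, Polynomial.eval_pow,
          Polynomial.eval_C, Polynomial.eval_X]
        rw [h1, add_sub_cancel_left, Real.sq_sqrt (by linarith)]; ring
      have hpoly : Polynomial.C u * Polynomial.X ^ 2 + Polynomial.C v * Polynomial.X +
          Polynomial.C w = Polynomial.C u *
            ((Polynomial.X - Polynomial.C z) * (Polynomial.X - Polynomial.C z) +
              Polynomial.C e) := by
        apply Polynomial.funext
        intro t
        simp only [Polynomial.eval_add, Polynomial.eval_mul, Polynomial.eval_pow,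
          Polynomial.eval_C, Polynomial.eval_X, Polynomial.eval_sub]
        rw [hform t]; ring
      refine ⟨|u| * e, mul_pos (abs_pos.2 hu) hepos, fun x => ?_⟩
      rw [hpoly, map_mul, mul_apply_eq_comp, realAeval_C, norm_smul,
        RCLike.norm_ofReal, mul_assoc]
      refine mul_le_mul_of_nonneg_left ?_ (abs_nonneg _)
      refine bounded_below_of_inner (fun y => ?_) x
      have hsa := realAeval_isSelfAdjoint (normalOp_isSelfAdjoint A)
        (Polynomial.X - Polynomial.C z)
      rw [map_add, map_mul, _root_.add_apply, mul_apply_eq_comp,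
        realAeval_C, inner_add_left, map_add, hsa.isSymmetric.apply_clm, inner_smul_left,
        RCLike.conj_ofReal, RCLike.re_ofReal_mul, inner_self_eq_norm_sq, inner_self_eq_norm_sq]
      nlinarith [sq_nonneg ‖(realAeval (normalOp A) (Polynomial.X - Polynomial.C z)) y‖]

/-- The norm of a polynomial of `A* A` is at most its maximum on `[0, ‖A* A‖]`. -/
theorem norm_realAeval_le (A : X →L[𝕜] Y) (p : Polynomial ℝ) {c : ℝ}
    (hc : ∀ t ∈ Icc 0 ‖normalOp A‖, |p.eval t| ≤ c) : ‖realAeval (normalOp A) p‖ ≤ c := by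
  by_contra hcon
  push Not at hcon
  set S := realAeval (normalOp A) p with hS
  have hc0 : 0 ≤ c := (abs_nonneg _).trans (hc 0 ⟨le_rfl, norm_nonneg _⟩)
  have hM : 0 < ‖S‖ := hc0.trans_lt hcon
  obtain ⟨m, hm, hm'⟩ := realAeval_bounded_below A (Polynomial.C (‖S‖ ^ 2) - p * p) (by
    intro t ht h0
    simp only [Polynomial.eval_sub, Polynomial.eval_mul, Polynomial.eval_C] at h0
    have h1 := hc t ht
    have h2 : p.eval t * p.eval t = |p.eval t| ^ 2 := by rw [sq_abs]; ring
    have h3 : |p.eval t| < ‖S‖ := h1.trans_lt hcon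
    nlinarith [abs_nonneg (p.eval t)])
  have hsa : IsSelfAdjoint S := realAeval_isSelfAdjoint (normalOp_isSelfAdjoint A) p
  have key : ∀ x, ‖S x‖ ^ 2 * ‖S‖ ^ 2 ≤ (‖S‖ ^ 4 - m ^ 2) * ‖x‖ ^ 2 := by
    intro x
    have h1 := hm' x
    rw [map_sub, map_mul, _root_.sub_apply, mul_apply_eq_comp,
      realAeval_C, ← hS] at h1
    have h2 : ‖((‖S‖ ^ 2 : ℝ) : 𝕜) • x - S (S x)‖ ^ 2
        = ‖S‖ ^ 4 * ‖x‖ ^ 2 - 2 * (‖S‖ ^ 2 * ‖S x‖ ^ 2) + ‖S (S x)‖ ^ 2 := by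
      rw [@norm_sub_sq 𝕜, inner_smul_left, RCLike.conj_ofReal, RCLike.re_ofReal_mul,
        ← hsa.isSymmetric.apply_clm, inner_self_eq_norm_sq, norm_smul, RCLike.norm_ofReal,
        abs_of_nonneg (by positivity)]
      ring
    have h3 : ‖S (S x)‖ ^ 2 ≤ ‖S‖ ^ 2 * ‖S x‖ ^ 2 := by
      rw [← mul_pow]; exact pow_le_pow_left₀ (norm_nonneg _) (S.le_opNorm _) 2
    have h4 : (m * ‖x‖) ^ 2 ≤ ‖((‖S‖ ^ 2 : ℝ) : 𝕜) • x - S (S x)‖ ^ 2 :=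
      pow_le_pow_left₀ (by positivity) h1 2
    nlinarith
  have hb : ‖S‖ ≤ √((‖S‖ ^ 4 - m ^ 2) / ‖S‖ ^ 2) := by
    refine S.opNorm_le_bound (Real.sqrt_nonneg _) fun x => ?_
    rw [← Real.sqrt_sq (norm_nonneg x), ← Real.sqrt_mul' _ (sq_nonneg _)]
    apply Real.le_sqrt_of_sq_le
    rw [div_mul_eq_mul_div, le_div_iff₀ (by positivity)]
    exact key x
  have hb2 : ‖S‖ ^ 2 ≤ (‖S‖ ^ 4 - m ^ 2) / ‖S‖ ^ 2 := by
    refine (Real.le_sqrt' hM).1 hb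
  rw [le_div_iff₀ (by positivity)] at hb2
  nlinarith [sq_pos_of_pos hm]

/-! ### The functional calculus as a limit of polynomials -/

theorem polyApprox_hasBasis (f : ℝ → ℝ) (s : Set ℝ) :
    (polyApprox f s).HasBasis (fun ε : ℝ => 0 < ε)
      (fun ε => {p : Polynomial ℝ | ∀ t ∈ s, |p.eval t - f t| ≤ ε}) := by
  refine hasBasis_biInf_principal ?_ ⟨1, mem_Ioi.2 one_pos⟩
  intro a ha b hb
  refine ⟨min a b, mem_Ioi.2 (lt_min ha hb), ?_, ?_⟩
  · exact fun p hp t ht => (hp t ht).trans (min_le_left _ _)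
  · exact fun p hp t ht => (hp t ht).trans (min_le_right _ _)

/-- The limit defining `f(A* A)` exists, and polynomials uniformly `ε`-close to `f` on
`[0, ‖A* A‖]` give operators `ε`-close to it. -/
theorem norm_realAeval_sub_opFun_le (A : X →L[𝕜] Y) {f : ℝ → ℝ}
    (hf : ContinuousOn f (Icc 0 ‖normalOp A‖)) {p : Polynomial ℝ} {ε : ℝ}
    (hp : ∀ t ∈ Icc 0 ‖normalOp A‖, |p.eval t - f t| ≤ ε) :
    ‖realAeval (normalOp A) p - opFun f (normalOp A)‖ ≤ ε := by
  set s := Icc 0 ‖normalOp A‖ with hs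
  have hb := polyApprox_hasBasis f s
  have hne : (polyApprox f s).NeBot := by
    rw [hb.neBot_iff]
    intro ε hε
    obtain ⟨q, hq⟩ := exists_polynomial_near_of_continuousOn 0 _ f hf ε hε
    exact ⟨q, fun t ht => (hq t ht).le⟩
  have hclose : ∀ {q₁ q₂ : Polynomial ℝ} {a b : ℝ}, (∀ t ∈ s, |q₁.eval t - f t| ≤ a) →
      (∀ t ∈ s, |q₂.eval t - f t| ≤ b) →
      ‖realAeval (normalOp A) q₁ - realAeval (normalOp A) q₂‖ ≤ a + b := by
    intro q₁ q₂ a b h₁ h₂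
    rw [← map_sub]
    refine norm_realAeval_le A _ fun t ht => ?_
    rw [Polynomial.eval_sub]
    have := abs_sub_le (q₁.eval t) (f t) (q₂.eval t)
    have h3 := h₂ t ht
    rw [abs_sub_comm] at h3
    linarith [h₁ t ht]
  have hcauchy : Cauchy (map (realAeval (normalOp A)) (polyApprox f s)) := by
    rw [Metric.cauchy_iff]
    refine ⟨inferInstance, fun ε hε => ⟨_, image_mem_map (hb.mem_of_mem
      (show (0 : ℝ) < ε / 4 by positivity)), ?_⟩⟩
    rintro _ ⟨q₁, h₁, rfl⟩ _ ⟨q₂, h₂, rfl⟩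
    rw [dist_eq_norm]
    have := hclose h₁ h₂
    linarith
  obtain ⟨L, hL⟩ := cauchy_iff_exists_le_nhds.1 hcauchy
  have hlim : Tendsto (realAeval (normalOp A)) (polyApprox f s) (𝓝 (opFun f (normalOp A))) :=
    tendsto_nhds_limUnder ⟨L, hL⟩
  refine le_of_forall_pos_le_add fun e he => ?_
  refine le_of_tendsto (tendsto_const_nhds.sub hlim).norm ?_
  filter_upwards [hb.mem_of_mem he] with q hq
  exact hclose hp hq

theorem exists_polynomial_seq (A : X →L[𝕜] Y) {f : ℝ → ℝ}
    (hf : ContinuousOn f (Icc 0 ‖normalOp A‖)) :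
    ∃ p : ℕ → Polynomial ℝ, ∀ n, ∀ t ∈ Icc 0 ‖normalOp A‖,
      |(p n).eval t - f t| ≤ 1 / ((n : ℝ) + 1) := by
  choose p hp using fun n : ℕ => exists_polynomial_near_of_continuousOn 0 _ f hf
    (1 / ((n : ℝ) + 1)) (by positivity)
  exact ⟨p, fun n t ht => (hp n t ht).le⟩

theorem tendsto_realAeval (A : X →L[𝕜] Y) {f : ℝ → ℝ}
    (hf : ContinuousOn f (Icc 0 ‖normalOp A‖)) {p : ℕ → Polynomial ℝ} {c : ℝ}
    (hp : ∀ n, ∀ t ∈ Icc 0 ‖normalOp A‖, |(p n).eval t - f t| ≤ c * (1 / ((n : ℝ) + 1))) :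
    Tendsto (fun n => realAeval (normalOp A) (p n)) atTop (𝓝 (opFun f (normalOp A))) := by
  rw [tendsto_iff_norm_sub_tendsto_zero]
  refine squeeze_zero (fun _ => norm_nonneg _)
    (fun n => norm_realAeval_sub_opFun_le A hf (hp n)) ?_
  simpa using (tendsto_one_div_add_atTop_nhds_zero_nat (𝕜 := ℝ)).const_mul c

theorem opFun_polynomial (A : X →L[𝕜] Y) (p : Polynomial ℝ) :
    opFun (fun t => p.eval t) (normalOp A) = realAeval (normalOp A) p := by
  have h := norm_realAeval_sub_opFun_le A (f := fun t => p.eval t) (p := p) (ε := 0)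
    p.continuous.continuousOn (by simp)
  exact (sub_eq_zero.1 (norm_le_zero_iff.1 h)).symm

theorem opFun_congr {T : X →L[𝕜] X} {f h : ℝ → ℝ} (hfh : ∀ t ∈ Icc 0 ‖T‖, f t = h t) :
    opFun f T = opFun h T := by
  have : polyApprox f (Icc 0 ‖T‖) = polyApprox h (Icc 0 ‖T‖) := by
    unfold polyApprox
    have h1 (ε : ℝ) : {p : Polynomial ℝ | ∀ t ∈ Icc 0 ‖T‖, |p.eval t - f t| ≤ ε}
        = {p : Polynomial ℝ | ∀ t ∈ Icc 0 ‖T‖, |p.eval t - h t| ≤ ε} :=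
      Set.ext fun p => forall₂_congr fun t ht => by rw [hfh t ht]
    simp only [h1]
  rw [opFun, opFun, this]

theorem opFun_const (A : X →L[𝕜] Y) (a : ℝ) (x : X) :
    opFun (fun _ => a) (normalOp A) x = (a : 𝕜) • x := by
  rw [← realAeval_C (normalOp A) a x, ← opFun_polynomial]
  simp

theorem opFun_id (A : X →L[𝕜] Y) : opFun (fun t => t) (normalOp A) = normalOp A := by
  have := opFun_polynomial A Polynomial.X
  rw [realAeval_X] at this
  simpa using this

theorem opFun_sub (A : X →L[𝕜] Y) {f h : ℝ → ℝ} (hf : ContinuousOn f (Icc 0 ‖normalOp A‖))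
    (hh : ContinuousOn h (Icc 0 ‖normalOp A‖)) :
    opFun (fun t => f t - h t) (normalOp A) = opFun f (normalOp A) - opFun h (normalOp A) := by
  obtain ⟨p, hp⟩ := exists_polynomial_seq A hf
  obtain ⟨q, hq⟩ := exists_polynomial_seq A hh
  have h1 := tendsto_realAeval A (c := 1) hf (by simpa using hp)
  have h2 := tendsto_realAeval A (c := 1) hh (by simpa using hq)
  have h3 := tendsto_realAeval A (c := 2) (p := fun n => p n - q n) (hf.sub hh) (by
    intro n t ht
    have ha := hp n t ht
    have hb := hq n t ht
    rw [abs_le] at *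
    rw [Polynomial.eval_sub]
    constructor <;> simp only [Pi.sub_apply] <;> linarith)
  simp only [map_sub] at h3
  exact tendsto_nhds_unique h3 (h1.sub h2)

theorem opFun_mul (A : X →L[𝕜] Y) {f h : ℝ → ℝ} (hf : ContinuousOn f (Icc 0 ‖normalOp A‖))
    (hh : ContinuousOn h (Icc 0 ‖normalOp A‖)) (x : X) :
    opFun (fun t => f t * h t) (normalOp A) x
      = opFun f (normalOp A) (opFun h (normalOp A) x) := by
  obtain ⟨p, hp⟩ := exists_polynomial_seq A hf
  obtain ⟨q, hq⟩ := exists_polynomial_seq A hh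
  obtain ⟨a, ha⟩ := isCompact_Icc.exists_bound_of_continuousOn hf
  obtain ⟨b, hb⟩ := isCompact_Icc.exists_bound_of_continuousOn hh
  have h1 := tendsto_realAeval A (c := 1) hf (by simpa using hp)
  have h2 := tendsto_realAeval A (c := 1) hh (by simpa using hq)
  have h3 := tendsto_realAeval A (c := a + (b + 1)) (p := fun n => p n * q n) (hf.mul hh) (by
    intro n t ht
    have ha' := ha t ht
    have hb' := hb t ht
    have hp' := hp n t ht
    have hq' := hq n t ht
    set e : ℝ := 1 / ((n : ℝ) + 1) with he
    have he0 : 0 ≤ e := by positivity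
    have he1 : e ≤ 1 := by
      rw [he, div_le_one (by positivity)]; linarith [(Nat.cast_nonneg n : (0 : ℝ) ≤ n)]
    rw [Real.norm_eq_abs] at ha' hb'
    have hq'' : |(q n).eval t| ≤ b + 1 := by
      have := abs_sub_abs_le_abs_sub ((q n).eval t) (h t)
      linarith
    rw [Polynomial.eval_mul, show (p n).eval t * (q n).eval t - (f * h) t
      = f t * ((q n).eval t - h t) + ((p n).eval t - f t) * (q n).eval t by
        simp only [Pi.mul_apply]; ring]
    refine (abs_add_le _ _).trans ?_
    rw [abs_mul, abs_mul, add_mul]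
    have i1 := mul_le_mul ha' hq' (abs_nonneg _) ((abs_nonneg _).trans ha')
    have i2 := mul_le_mul hp' hq'' (abs_nonneg _) he0
    linarith)
  simp only [map_mul] at h3
  rw [show (fun t => f t * h t) = f * h from rfl, tendsto_nhds_unique h3 (h1.mul h2),
    mul_apply_eq_comp]

theorem opFun_inner (A : X →L[𝕜] Y) {f : ℝ → ℝ} (hf : ContinuousOn f (Icc 0 ‖normalOp A‖))
    (x y : X) : inner 𝕜 (opFun f (normalOp A) x) y = inner 𝕜 x (opFun f (normalOp A) y) := by
  obtain ⟨p, hp⟩ := exists_polynomial_seq A hf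
  have h1 := tendsto_realAeval A (c := 1) hf (by simpa using hp)
  have hx := ((ContinuousLinearMap.apply 𝕜 X x).continuous.tendsto _).comp h1
  have hy := ((ContinuousLinearMap.apply 𝕜 X y).continuous.tendsto _).comp h1
  refine tendsto_nhds_unique (hx.inner (𝕜 := 𝕜) (tendsto_const_nhds (x := y))) ?_
  refine ((tendsto_const_nhds (x := x)).inner hy).congr fun n => ?_
  exact ((realAeval_isSelfAdjoint (normalOp_isSelfAdjoint A) (p n)).isSymmetric x y).symm

/-! ### Operator inequalities from pointwise inequalities -/

theorem norm_sq_opFun (A : X →L[𝕜] Y) {f : ℝ → ℝ} (hf : ContinuousOn f (Icc 0 ‖normalOp A‖))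
    (x : X) : ‖opFun f (normalOp A) x‖ ^ 2
      = RCLike.re (inner 𝕜 (opFun (fun t => f t * f t) (normalOp A) x) x) := by
  rw [opFun_mul A hf hf, opFun_inner A hf, inner_self_eq_norm_sq]

theorem opFun_inner_nonneg (A : X →L[𝕜] Y) {f : ℝ → ℝ}
    (hf : ContinuousOn f (Icc 0 ‖normalOp A‖)) (h0 : ∀ t ∈ Icc 0 ‖normalOp A‖, 0 ≤ f t)
    (x : X) : 0 ≤ RCLike.re (inner 𝕜 (opFun f (normalOp A) x) x) := by
  have h1 : opFun f (normalOp A) = opFun (fun t => √(f t) * √(f t)) (normalOp A) :=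
    opFun_congr fun t ht => (Real.mul_self_sqrt (h0 t ht)).symm
  rw [h1, ← norm_sq_opFun A hf.sqrt]
  positivity

/-- Pointwise domination `|f| ≤ c |h|` on `[0, ‖A* A‖]` carries over to the operators applied to
each vector. -/
theorem norm_opFun_le (A : X →L[𝕜] Y) {f h : ℝ → ℝ} (hf : ContinuousOn f (Icc 0 ‖normalOp A‖))
    (hh : ContinuousOn h (Icc 0 ‖normalOp A‖)) {c : ℝ} (hc : 0 ≤ c)
    (hle : ∀ t ∈ Icc 0 ‖normalOp A‖, |f t| ≤ c * |h t|) (x : X) :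
    ‖opFun f (normalOp A) x‖ ≤ c * ‖opFun h (normalOp A) x‖ := by
  have h1 := opFun_inner_nonneg A (f := fun t => c ^ 2 * (h t * h t) - f t * f t)
    ((continuousOn_const.mul (hh.mul hh)).sub (hf.mul hf)) (fun t ht => by
      have := pow_le_pow_left₀ (abs_nonneg _) (hle t ht) 2
      rw [mul_pow, sq_abs, sq_abs] at this
      linarith) x
  rw [opFun_sub A (f := fun t => c ^ 2 * (h t * h t)) (h := fun t => f t * f t)
    (continuousOn_const.mul (hh.mul hh)) (hf.mul hf), _root_.sub_apply,
    inner_sub_left, map_sub, ← norm_sq_opFun A hf,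
    opFun_mul A (f := fun _ => c ^ 2) (h := fun t => h t * h t) continuousOn_const (hh.mul hh),
    opFun_const,
    inner_smul_left, RCLike.conj_ofReal, RCLike.re_ofReal_mul] at h1
  have h2 := norm_sq_opFun A hh x
  refine abs_le_of_sq_le_sq' ?_ (by positivity) |>.2
  rw [mul_pow, h2]
  exact sub_nonneg.1 h1

theorem norm_apply_eq_opFun_sqrt (A : X →L[𝕜] Y) (x : X) :
    ‖A x‖ = ‖opFun (fun t => √t) (normalOp A) x‖ := by
  have h1 := norm_sq_opFun A (f := fun t => √t) Real.continuous_sqrt.continuousOn x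
  rw [opFun_congr (h := fun t => t) fun t ht => Real.mul_self_sqrt ht.1, opFun_id, normalOp,
    ContinuousLinearMap.comp_apply, ContinuousLinearMap.adjoint_inner_left,
    inner_self_eq_norm_sq] at h1
  exact (sq_eq_sq₀ (norm_nonneg _) (norm_nonneg _)).1 h1.symm

theorem ContinuousOn.sqrt_mul_self {f : ℝ → ℝ} {s : Set ℝ} (hf : ContinuousOn f s) :
    ContinuousOn (fun t => √t * f t) s :=
  Real.continuous_sqrt.continuousOn.mul hf

theorem norm_apply_opFun (A : X →L[𝕜] Y) {f : ℝ → ℝ}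
    (hf : ContinuousOn f (Icc 0 ‖normalOp A‖)) (x : X) :
    ‖A (opFun f (normalOp A) x)‖ = ‖opFun (fun t => √t * f t) (normalOp A) x‖ := by
  rw [opFun_mul A Real.continuous_sqrt.continuousOn hf, norm_apply_eq_opFun_sqrt]

theorem norm_opFun_le_const (A : X →L[𝕜] Y) {f : ℝ → ℝ}
    (hf : ContinuousOn f (Icc 0 ‖normalOp A‖)) {c : ℝ}
    (hle : ∀ t ∈ Icc 0 ‖normalOp A‖, |f t| ≤ c) (x : X) :
    ‖opFun f (normalOp A) x‖ ≤ c * ‖x‖ := by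
  have hc : 0 ≤ c := (abs_nonneg _).trans (hle 0 ⟨le_rfl, norm_nonneg _⟩)
  have := norm_opFun_le A hf (h := fun _ => 1) continuousOn_const hc (by simpa using hle) x
  simpa [opFun_const] using this

theorem norm_opFun_adjoint_le (A : X →L[𝕜] Y) {f : ℝ → ℝ}
    (hf : ContinuousOn f (Icc 0 ‖normalOp A‖)) {c : ℝ}
    (hle : ∀ t ∈ Icc 0 ‖normalOp A‖, |f t| * √t ≤ c) (v : Y) :
    ‖opFun f (normalOp A) (ContinuousLinearMap.adjoint A v)‖ ≤ c * ‖v‖ := by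
  have hc : 0 ≤ c := (by positivity : (0 : ℝ) ≤ |f 0| * √0).trans
    (hle 0 ⟨le_rfl, norm_nonneg _⟩)
  set w := opFun f (normalOp A) (ContinuousLinearMap.adjoint A v) with hw
  rcases eq_or_ne w 0 with h0 | h0
  · rw [h0, norm_zero]; positivity
  have h1 : ‖w‖ ^ 2 = RCLike.re (inner 𝕜 v (A (opFun f (normalOp A) w))) := by
    rw [← ContinuousLinearMap.adjoint_inner_left A, ← opFun_inner A hf, ← hw,
      inner_self_eq_norm_sq]
  have h2 : ‖A (opFun f (normalOp A) w)‖ ≤ c * ‖w‖ := by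
    rw [norm_apply_opFun A hf]
    refine norm_opFun_le_const A hf.sqrt_mul_self (fun t ht => ?_) w
    rw [abs_mul, abs_of_nonneg (Real.sqrt_nonneg _), mul_comm]
    exact hle t ht
  have h3 : RCLike.re (inner 𝕜 v (A (opFun f (normalOp A) w))) ≤ ‖v‖ * (c * ‖w‖) :=
    ((RCLike.re_le_norm _).trans (norm_inner_le_norm _ _)).trans
      (mul_le_mul_of_nonneg_left h2 (norm_nonneg _))
  have h4 : 0 < ‖w‖ := norm_pos_iff.2 h0
  nlinarith

/-- For `0 ≤ f` and `t f(t) ≤ 1`, the operator `S = A f(A* A) A*` satisfies `S² ≤ S`, so both `S`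
and `1 - S` are contractions. -/
theorem norm_apply_opFun_adjoint_le (A : X →L[𝕜] Y) {f : ℝ → ℝ}
    (hf : ContinuousOn f (Icc 0 ‖normalOp A‖)) (h0 : ∀ t ∈ Icc 0 ‖normalOp A‖, 0 ≤ f t)
    (h1 : ∀ t ∈ Icc 0 ‖normalOp A‖, t * f t ≤ 1) (v : Y) :
    ‖A (opFun f (normalOp A) (ContinuousLinearMap.adjoint A v))‖ ≤ ‖v‖ ∧
    ‖v - A (opFun f (normalOp A) (ContinuousLinearMap.adjoint A v))‖ ≤ ‖v‖ := by
  set w := ContinuousLinearMap.adjoint A v with hw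
  set S := A (opFun f (normalOp A) w) with hS
  have e1 : RCLike.re (inner 𝕜 S v) = RCLike.re (inner 𝕜 (opFun f (normalOp A) w) w) := by
    rw [hS, hw, ContinuousLinearMap.adjoint_inner_right]
  have cs := hf.sqrt_mul_self
  have e2 : ‖S‖ ^ 2 ≤ RCLike.re (inner 𝕜 S v) := by
    have h2 := opFun_inner_nonneg A (f := fun t => f t - (√t * f t) * (√t * f t))
      (hf.sub (cs.mul cs)) (fun t ht => by
        have h3 : (√t * f t) * (√t * f t) = (t * f t) * f t := by
          rw [show (√t * f t) * (√t * f t) = (√t * √t) * f t * f t by ring,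
            Real.mul_self_sqrt ht.1]
        have h4 := mul_le_mul_of_nonneg_right (h1 t ht) (h0 t ht)
        simp only [h3]; linarith) w
    rw [opFun_sub A (h := fun t => √t * f t * (√t * f t)) hf (cs.mul cs), _root_.sub_apply,
      inner_sub_left, map_sub,
      ← norm_sq_opFun A cs, ← norm_apply_opFun A hf, ← e1] at h2
    linarith
  have e3 : RCLike.re (inner 𝕜 S v) ≤ ‖S‖ * ‖v‖ :=
    (RCLike.re_le_norm _).trans (norm_inner_le_norm _ _)
  constructor
  · rcases (norm_nonneg S).eq_or_lt with h | h
    · rw [← h]; exact norm_nonneg _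
    · nlinarith
  · refine abs_le_of_sq_le_sq' ?_ (norm_nonneg _) |>.2
    rw [norm_sub_rev, @norm_sub_sq 𝕜]
    nlinarith [sq_nonneg ‖S‖]

end Calculus

/-! ### The setting -/

/-- The data of the iteration together with all hypotheses except the smallness of
`(K₀ + K₁ + K₂) ‖x₀ - x†‖`. -/
structure NewtonProblem (𝕜 X Y : Type*) [RCLike 𝕜] [NormedAddCommGroup X] [InnerProductSpace 𝕜 X]
    [CompleteSpace X] [NormedAddCommGroup Y] [InnerProductSpace 𝕜 Y] [CompleteSpace Y]
    (r τ γ₁ c₀ c₁ c₂ c₃ c₄ c₅ c₇ c₈ : ℝ) where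
  (g : ℝ → ℝ → ℝ) (α : ℕ → ℝ) (D : Set X) (F : X → Y) (F' : X → X →L[𝕜] Y)
  (xdag x₀ : X) (ρ K₀ K₁ K₂ δ : ℝ) (yδ : Y)
  hr : 1 < r
  hτ : 1 < τ
  hc₀ : 0 < c₀
  hc₂ : 0 < c₂
  hc₃ : 0 < c₃
  hc₄ : 0 < c₄
  hc₅ : 1 < c₅
  hc₇ : 0 < c₇
  hc₈ : 0 < c₈
  hγ₁ : c₃ * √r / (τ - 1) < γ₁
  filter : FilterConditions g c₀ c₁ c₂ c₃ c₄
  sequence : SequenceConditions g α r c₅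
  operator : OperatorConditions D F F' xdag ρ g c₃ (α 0)
  radius : 2 * (1 + c₄ * γ₁) * ‖x₀ - xdag‖ < ρ
  hK₀ : 0 < K₀
  hK₁ : 0 < K₁
  hK₂ : 0 < K₂
  twoTerm : TwoTermCondition F' xdag ρ K₁ K₂
  commutator : CommutatorEstimates F' xdag ρ g K₀ K₁ K₂ c₇ c₈
  hδ : 0 < δ
  noise : ‖yδ - F xdag‖ ≤ δ

namespace NewtonProblem

variable {𝕜 X Y : Type*} [RCLike 𝕜] [NormedAddCommGroup X] [InnerProductSpace 𝕜 X]
  [CompleteSpace X] [NormedAddCommGroup Y] [InnerProductSpace 𝕜 Y] [CompleteSpace Y]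
  {r τ γ₁ c₀ c₁ c₂ c₃ c₄ c₅ c₇ c₈ : ℝ}
  (P : NewtonProblem 𝕜 X Y r τ γ₁ c₀ c₁ c₂ c₃ c₄ c₅ c₇ c₈)

/-- The initial error `x₀ - x†`. -/
def e₀ : X := P.x₀ - P.xdag

/-- The quantity `(K₀ + K₁ + K₂) ‖x₀ - x†‖` that is assumed to be small. -/
def κ : ℝ := (P.K₀ + P.K₁ + P.K₂) * ‖P.e₀‖

/-- The factor `2 (1 + c₄ γ₁)`: iterates stay within `errFactor * ‖x₀ - x†‖` of `x†`. -/
def errFactor (c₄ γ₁ : ℝ) : ℝ :=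
  2 * (1 + c₄ * γ₁)

/-- Points at which the error is at most `errFactor * ‖x₀ - x†‖`. -/
def Near (x : X) : Prop := ‖x - P.xdag‖ ≤ errFactor c₄ γ₁ * ‖P.e₀‖

/-- The linearized image of the error, `‖F'(x†)(x - x†)‖`. -/
def imageErr (x : X) : ℝ := ‖P.F' P.xdag (x - P.xdag)‖

/-- The operator `r_a(F'(x)* F'(x))`. -/
def res (a : ℝ) (x : X) : X →L[𝕜] X := opFun (residualFn P.g a) (normalOp (P.F' x))

/-! ### Elementary consequences of the hypotheses -/

theorem γ₁_pos (P : NewtonProblem 𝕜 X Y r τ γ₁ c₀ c₁ c₂ c₃ c₄ c₅ c₇ c₈) : 0 < γ₁ :=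
  (div_nonneg (mul_nonneg P.hc₃.le (Real.sqrt_nonneg _)) (by linarith [P.hτ])).trans_lt P.hγ₁

theorem errFactor_two_le (P : NewtonProblem 𝕜 X Y r τ γ₁ c₀ c₁ c₂ c₃ c₄ c₅ c₇ c₈) :
    2 ≤ errFactor c₄ γ₁ := by
  unfold errFactor; nlinarith [mul_pos P.hc₄ P.γ₁_pos]

theorem κ_nonneg : 0 ≤ P.κ :=
  mul_nonneg (by linarith [P.hK₀, P.hK₁, P.hK₂]) (norm_nonneg _)

theorem imageErr_nonneg (x : X) : 0 ≤ P.imageErr x := norm_nonneg _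

variable {P}

theorem Near.mem_ball {x : X} (hx : P.Near x) : x ∈ Metric.ball P.xdag P.ρ := by
  rw [Metric.mem_ball, dist_eq_norm]; exact hx.trans_lt P.radius

variable (P)

theorem near_xdag : P.Near P.xdag := by
  unfold Near; rw [sub_self, norm_zero]
  exact mul_nonneg (by linarith [P.errFactor_two_le]) (norm_nonneg _)

theorem near_x₀ : P.Near P.x₀ := by
  have := P.errFactor_two_le
  show ‖P.e₀‖ ≤ _
  nlinarith [norm_nonneg P.e₀]

theorem imageErr_xdag : P.imageErr P.xdag = 0 := by simp [imageErr]

variable {P}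

theorem Near.K_mul_le {x : X} (hx : P.Near x) :
    (P.K₀ + P.K₁ + P.K₂) * ‖x - P.xdag‖ ≤ errFactor c₄ γ₁ * P.κ := by
  have := mul_le_mul_of_nonneg_left hx
    (show 0 ≤ P.K₀ + P.K₁ + P.K₂ by linarith [P.hK₀, P.hK₁, P.hK₂])
  unfold κ; linarith

theorem Near.K₁_add_K₂_mul_le {x : X} (hx : P.Near x) :
    (P.K₁ + P.K₂) * ‖x - P.xdag‖ ≤ errFactor c₄ γ₁ * P.κ := by
  have := hx.K_mul_le
  nlinarith [mul_nonneg P.hK₀.le (norm_nonneg (x - P.xdag))]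

theorem Near.K₁_mul_le {x : X} (hx : P.Near x) :
    P.K₁ * ‖x - P.xdag‖ ≤ errFactor c₄ γ₁ * P.κ := by
  have := hx.K₁_add_K₂_mul_le
  nlinarith [mul_nonneg P.hK₂.le (norm_nonneg (x - P.xdag))]

theorem Near.K₂_mul_le {x : X} (hx : P.Near x) :
    P.K₂ * ‖x - P.xdag‖ ≤ errFactor c₄ γ₁ * P.κ := by
  have := hx.K₁_add_K₂_mul_le
  nlinarith [mul_nonneg P.hK₁.le (norm_nonneg (x - P.xdag))]

theorem Near.K₁_mul_sub_le {x z : X} (hx : P.Near x) (hz : P.Near z) :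
    P.K₁ * ‖x - z‖ ≤ 2 * (errFactor c₄ γ₁ * P.κ) := by
  have h1 : ‖x - z‖ ≤ ‖x - P.xdag‖ + ‖z - P.xdag‖ := by
    rw [show x - z = (x - P.xdag) - (z - P.xdag) by abel]; exact norm_sub_le _ _
  have := mul_le_mul_of_nonneg_left h1 P.hK₁.le
  have := hx.K₁_mul_le
  have := hz.K₁_mul_le
  linarith

variable (P)

theorem K₀_le_κ : P.K₀ * ‖P.e₀‖ ≤ P.κ := by
  unfold κ; nlinarith [norm_nonneg P.e₀, P.hK₁, P.hK₂, mul_nonneg P.hK₁.le (norm_nonneg P.e₀),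
    mul_nonneg P.hK₂.le (norm_nonneg P.e₀)]

theorem K₂_le_κ : P.K₂ * ‖P.e₀‖ ≤ P.κ := by
  unfold κ; nlinarith [norm_nonneg P.e₀, mul_nonneg P.hK₁.le (norm_nonneg P.e₀),
    mul_nonneg P.hK₀.le (norm_nonneg P.e₀)]

theorem K₀_add_K₁_le_κ : (P.K₀ + P.K₁) * ‖P.e₀‖ ≤ P.κ := by
  unfold κ; nlinarith [norm_nonneg P.e₀, mul_nonneg P.hK₂.le (norm_nonneg P.e₀)]

variable {P}

/-! ### Comparison of derivatives and the nonlinearity -/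

theorem Near.norm_deriv_sub_le {x z : X} (hx : P.Near x) (hz : P.Near z) (w : X) :
    ‖(P.F' x - P.F' z) w‖ ≤ P.K₁ * ‖x - z‖ * ‖P.F' z w‖ + P.K₂ * ‖P.F' z (x - z)‖ * ‖w‖ :=
  P.twoTerm x hx.mem_ball z hz.mem_ball w

theorem Near.norm_deriv_le {x z : X} (hx : P.Near x) (hz : P.Near z)
    (hs : 8 * (errFactor c₄ γ₁ * P.κ) ≤ 1) (w : X) :
    ‖P.F' x w‖ ≤ 2 * ‖P.F' z w‖ + P.K₂ * ‖P.F' z (x - z)‖ * ‖w‖ := by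
  have h1 := hx.norm_deriv_sub_le hz w
  have h2 := norm_le_insert' (P.F' x w) (P.F' z w)
  rw [← _root_.sub_apply] at h2
  have h3 := mul_le_mul_of_nonneg_right (hx.K₁_mul_sub_le hz) (norm_nonneg (P.F' z w))
  nlinarith [norm_nonneg (P.F' z w)]

theorem Near.norm_deriv_err_le {x : X} (hx : P.Near x) (hs : 8 * (errFactor c₄ γ₁ * P.κ) ≤ 1) :
    ‖P.F' x (x - P.xdag)‖ ≤ 2 * P.imageErr x := by
  have h1 := hx.norm_deriv_sub_le P.near_xdag (x - P.xdag)
  have h2 := norm_le_insert' (P.F' x (x - P.xdag)) (P.F' P.xdag (x - P.xdag))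
  rw [← _root_.sub_apply] at h2
  have h3 := mul_le_mul_of_nonneg_right hx.K₁_add_K₂_mul_le (P.imageErr_nonneg x)
  unfold imageErr at *
  nlinarith [norm_nonneg (P.F' P.xdag (x - P.xdag))]

theorem Near.imageErr_le {x : X} (hx : P.Near x) (hs : 8 * (errFactor c₄ γ₁ * P.κ) ≤ 1) :
    P.imageErr x ≤ 2 * ‖P.F' x (x - P.xdag)‖ := by
  have h1 := P.near_xdag.norm_deriv_sub_le hx (x - P.xdag)
  have h2 := norm_le_insert' (P.F' P.xdag (x - P.xdag)) (P.F' x (x - P.xdag))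
  rw [← _root_.sub_apply] at h2
  rw [norm_sub_rev P.xdag x, ← neg_sub x P.xdag, map_neg, norm_neg] at h1
  have h3 := mul_le_mul_of_nonneg_right hx.K₁_add_K₂_mul_le (norm_nonneg (P.F' x (x - P.xdag)))
  unfold imageErr
  nlinarith [norm_nonneg (P.F' x (x - P.xdag))]

/-- Mean value inequality along `ζ ↦ x† + ζ (x - x†)`. Letting `ζ` range over the closed unit
ball of `𝕜` treats real and complex scalars alike. -/
theorem Near.mean_value {x : X} (hx : P.Near x) (L : X →L[𝕜] Y) {C : ℝ}
    (hC : ∀ ζ : 𝕜, ‖ζ‖ ≤ 1 → P.Near (P.xdag + ζ • (x - P.xdag)) →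
      ‖(P.F' (P.xdag + ζ • (x - P.xdag)) - L) (x - P.xdag)‖ ≤ C) :
    ‖P.F x - P.F P.xdag - L (x - P.xdag)‖ ≤ C := by
  set e := x - P.xdag with he
  have hnear : ∀ ζ : 𝕜, ‖ζ‖ ≤ 1 → P.Near (P.xdag + ζ • e) := by
    intro ζ hζ
    unfold Near
    rw [add_sub_cancel_left, norm_smul]
    exact (mul_le_of_le_one_left (norm_nonneg _) hζ).trans hx
  have hder : ∀ ζ ∈ Metric.closedBall (0 : 𝕜) 1,
      HasDerivWithinAt (fun ζ : 𝕜 => P.F (P.xdag + ζ • e) - ζ • L e)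
        ((P.F' (P.xdag + ζ • e) - L) e) (Metric.closedBall (0 : 𝕜) 1) ζ := by
    intro ζ hζ
    have hb := (hnear ζ (mem_closedBall_zero_iff.1 hζ)).mem_ball
    have h1 : HasFDerivAt P.F (P.F' (P.xdag + ζ • e)) (P.xdag + ζ • e) :=
      ((P.operator.hasFDerivWithinAt _ (P.operator.ball_subset hb)).mono
        P.operator.ball_subset).hasFDerivAt (Metric.isOpen_ball.mem_nhds hb)
    have h2 : HasDerivAt (fun ζ : 𝕜 => P.xdag + ζ • e) e ζ := by
      simpa using ((hasDerivAt_id ζ).smul_const e).const_add P.xdag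
    have h3 : HasDerivAt (fun ζ : 𝕜 => ζ • L e) (L e) ζ := by
      simpa using (hasDerivAt_id ζ).smul_const (L e)
    exact ((h1.comp_hasDerivAt ζ h2).sub h3).hasDerivWithinAt
  have := (convex_closedBall (0 : 𝕜) 1).norm_image_sub_le_of_norm_hasDerivWithin_le hder
    (C := C) (fun ζ hζ => hC ζ (mem_closedBall_zero_iff.1 hζ)
      (hnear ζ (mem_closedBall_zero_iff.1 hζ)))
    (x := 0) (y := 1) (by simp) (by simp)
  rw [he] at this ⊢
  simp only [one_smul, zero_smul, add_zero, sub_zero, norm_one, mul_one,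
    add_sub_cancel] at this
  rwa [show P.F x - P.F P.xdag - L (x - P.xdag) = P.F x - L (x - P.xdag) - P.F P.xdag by abel]

theorem Near.remainder_xdag_le {x : X} (hx : P.Near x) :
    ‖P.F x - P.F P.xdag - P.F' P.xdag (x - P.xdag)‖ ≤ errFactor c₄ γ₁ * P.κ * P.imageErr x := by
  refine hx.mean_value _ fun ζ hζ hn => ?_
  have h1 := hn.norm_deriv_sub_le P.near_xdag (x - P.xdag)
  rw [add_sub_cancel_left, map_smul, norm_smul, norm_smul] at h1
  have h3 := mul_le_mul_of_nonneg_right hx.K₁_add_K₂_mul_le (P.imageErr_nonneg x)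
  have h4 : (P.K₁ + P.K₂) * ‖x - P.xdag‖ * P.imageErr x * ‖ζ‖
      ≤ (P.K₁ + P.K₂) * ‖x - P.xdag‖ * P.imageErr x :=
    mul_le_of_le_one_right (mul_nonneg (mul_nonneg (by linarith [P.hK₁, P.hK₂])
      (norm_nonneg _)) (P.imageErr_nonneg x)) hζ
  unfold imageErr at *
  linarith

theorem Near.remainder_le {x : X} (hx : P.Near x) (hs : 8 * (errFactor c₄ γ₁ * P.κ) ≤ 1) :
    ‖P.F x - P.F P.xdag - P.F' x (x - P.xdag)‖ ≤ 4 * (errFactor c₄ γ₁ * P.κ) * P.imageErr x := by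
  have h5 := hx.norm_deriv_err_le hs
  have h6 : 0 ≤ errFactor c₄ γ₁ * P.κ := mul_nonneg (by linarith [P.errFactor_two_le]) P.κ_nonneg
  refine (hx.mean_value _ (C := 2 * (errFactor c₄ γ₁ * P.κ) * ‖P.F' x (x - P.xdag)‖)
    fun ζ hζ hn => ?_).trans (by nlinarith)
  have h1 := hn.norm_deriv_sub_le hx (x - P.xdag)
  rw [show P.xdag + ζ • (x - P.xdag) - x = (ζ - 1) • (x - P.xdag) by
    rw [sub_smul, one_smul]; abel, map_smul, norm_smul, norm_smul] at h1
  have h2 : ‖ζ - 1‖ ≤ 2 := by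
    have := norm_sub_le ζ 1
    rw [norm_one] at this; linarith
  have h3 := mul_le_mul_of_nonneg_right hx.K₁_add_K₂_mul_le (norm_nonneg (P.F' x (x - P.xdag)))
  have h4 : (P.K₁ + P.K₂) * ‖x - P.xdag‖ * ‖P.F' x (x - P.xdag)‖ * ‖ζ - 1‖
      ≤ (P.K₁ + P.K₂) * ‖x - P.xdag‖ * ‖P.F' x (x - P.xdag)‖ * 2 :=
    mul_le_mul_of_nonneg_left h2 (mul_nonneg (mul_nonneg (by linarith [P.hK₁, P.hK₂])
      (norm_nonneg _)) (norm_nonneg _))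
  linarith

theorem Near.norm_deriv_sub_apply_le {x z : X} (hx : P.Near x) (hz : P.Near z)
    (hs : 8 * (errFactor c₄ γ₁ * P.κ) ≤ 1) :
    ‖P.F' x (x - z)‖ ≤ 3 * (P.imageErr x + P.imageErr z) := by
  have h1 := hx.norm_deriv_err_le hs
  have h2 := hx.norm_deriv_le P.near_xdag hs (z - P.xdag)
  have h3 := mul_le_mul_of_nonneg_right hz.K₂_mul_le (P.imageErr_nonneg x)
  have h4 : ‖P.F' x (x - z)‖ ≤ ‖P.F' x (x - P.xdag)‖ + ‖P.F' x (z - P.xdag)‖ := by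
    rw [show x - z = (x - P.xdag) - (z - P.xdag) by abel, map_sub]; exact norm_sub_le _ _
  have h5 := P.imageErr_nonneg z
  have h6 := P.imageErr_nonneg x
  unfold imageErr at *
  nlinarith

/-! ### Estimates from the functional calculus -/

theorem Near.norm_deriv_le_sqrt {x : X} (hx : P.Near x) : ‖P.F' x‖ ≤ c₃ * √(P.α 0) := by
  obtain ⟨β, -, -, -, h⟩ := P.operator.scaling
  exact (h x hx.mem_ball).trans (min_le_left _ _)

theorem Near.spectrum_bounds {x : X} (hx : P.Near x) :
    ∀ t ∈ Icc 0 ‖normalOp (P.F' x)‖,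
      t ∈ Icc (0 : ℝ) (1 / 2) ∧ 3 / 4 ≤ residualFn P.g (P.α 0) t := by
  obtain ⟨β, hβ, hβ2, hres, h⟩ := P.operator.scaling
  intro t ht
  have h1 := (h x hx.mem_ball).trans (min_le_right _ _)
  have h2 : ‖normalOp (P.F' x)‖ ≤ β := by
    rw [norm_normalOp, ← Real.sq_sqrt hβ.le]
    exact pow_le_pow_left₀ (norm_nonneg _) h1 2
  exact ⟨⟨ht.1, (ht.2.trans h2).trans hβ2⟩, hres t ⟨ht.1, ht.2.trans h2⟩⟩

theorem Near.icc_subset {x : X} (hx : P.Near x) :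
    Icc 0 ‖normalOp (P.F' x)‖ ⊆ Icc (0 : ℝ) (1 / 2) := fun t ht => (hx.spectrum_bounds t ht).1

theorem Near.continuousOn_g {x : X} (hx : P.Near x) {a : ℝ} (ha : 0 < a) :
    ContinuousOn (P.g a) (Icc 0 ‖normalOp (P.F' x)‖) :=
  (P.filter.continuousOn a ha).mono hx.icc_subset

theorem Near.continuousOn_residual {x : X} (hx : P.Near x) {a : ℝ} (ha : 0 < a) :
    ContinuousOn (residualFn P.g a) (Icc 0 ‖normalOp (P.F' x)‖) :=
  continuousOn_const.sub (continuousOn_id.mul (hx.continuousOn_g ha))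

theorem abs_residual {a : ℝ} (ha : 0 < a) {t : ℝ} (ht : t ∈ Icc (0 : ℝ) (1 / 2)) :
    |residualFn P.g a t| = residualFn P.g a t :=
  abs_of_pos (P.filter.residual_pos a ha t ht)

/-- Estimates for `r_a(F'(x)* F'(x))` follow from pointwise ones for `r_a`. -/
theorem Near.norm_res_le_of_le {x : X} (hx : P.Near x) {a b c : ℝ} (ha : 0 < a) (hb : 0 < b)
    (hc : 0 ≤ c) (h : ∀ t ∈ Icc 0 ‖normalOp (P.F' x)‖,
      residualFn P.g a t ≤ c * residualFn P.g b t) (v : X) :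
    ‖P.res a x v‖ ≤ c * ‖P.res b x v‖ ∧
      ‖P.F' x (P.res a x v)‖ ≤ c * ‖P.F' x (P.res b x v)‖ := by
  have ca := hx.continuousOn_residual ha
  have cb := hx.continuousOn_residual hb
  constructor
  · refine norm_opFun_le _ ca cb hc (fun t ht => ?_) v
    rw [abs_residual ha (hx.icc_subset ht), abs_residual hb (hx.icc_subset ht)]
    exact h t ht
  · rw [res, res, norm_apply_opFun _ ca, norm_apply_opFun _ cb]
    refine norm_opFun_le _ ca.sqrt_mul_self
      cb.sqrt_mul_self hc (fun t ht => ?_) v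
    rw [abs_mul, abs_mul, abs_residual ha (hx.icc_subset ht),
      abs_residual hb (hx.icc_subset ht), abs_of_nonneg (Real.sqrt_nonneg t)]
    have := mul_le_mul_of_nonneg_left (h t ht) (Real.sqrt_nonneg t)
    linarith

theorem Near.norm_res_le {x : X} (hx : P.Near x) {a : ℝ} (ha : 0 < a) (v : X) :
    ‖P.res a x v‖ ≤ ‖v‖ := by
  have := norm_opFun_le_const (P.F' x) (hx.continuousOn_residual ha) (c := 1) (fun t ht => by
    rw [abs_residual ha (hx.icc_subset ht)]
    exact P.filter.residual_le_one a ha t (hx.icc_subset ht)) v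
  rwa [one_mul] at this

theorem Near.norm_deriv_res_le {x : X} (hx : P.Near x) {a : ℝ} (ha : 0 < a) (v : X) :
    ‖P.F' x (P.res a x v)‖ ≤ c₃ * √a * ‖v‖ := by
  have ca := hx.continuousOn_residual ha
  rw [res, norm_apply_opFun _ ca]
  refine norm_opFun_le_const _ ca.sqrt_mul_self (fun t ht => ?_) v
  rw [abs_mul, abs_residual ha (hx.icc_subset ht), abs_of_nonneg (Real.sqrt_nonneg t), mul_comm]
  exact P.filter.residual_mul_sqrt_le a ha t (hx.icc_subset ht)

theorem Near.norm_deriv_res_le_deriv {x : X} (hx : P.Near x) {a : ℝ} (ha : 0 < a) (v : X) :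
    ‖P.F' x (P.res a x v)‖ ≤ ‖P.F' x v‖ := by
  have ca := hx.continuousOn_residual ha
  rw [res, norm_apply_opFun _ ca, norm_apply_eq_opFun_sqrt (P.F' x)]
  rw [← one_mul ‖opFun (fun t => √t) (normalOp (P.F' x)) v‖]
  refine (norm_opFun_le _ ca.sqrt_mul_self
    Real.continuous_sqrt.continuousOn zero_le_one (fun t ht => ?_) v).trans le_rfl
  rw [abs_mul, abs_residual ha (hx.icc_subset ht), one_mul]
  exact mul_le_of_le_one_right (abs_nonneg _)
    (P.filter.residual_le_one a ha t (hx.icc_subset ht))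

theorem Near.norm_res_mono {x : X} (hx : P.Near x) {a b : ℝ} (ha : 0 < a) (hab : a ≤ b) (v : X) :
    ‖P.F' x (P.res a x v)‖ ≤ ‖P.F' x (P.res b x v)‖ := by
  have := (hx.norm_res_le_of_le ha (ha.trans_le hab) zero_le_one (fun t ht => by
    rw [one_mul]; exact P.filter.residual_mono a b ha hab t (hx.icc_subset ht)) v).2
  rwa [one_mul] at this

theorem Near.norm_res_succ {x : X} (hx : P.Near x) (k : ℕ) (v : X) :
    ‖P.res (P.α k) x v‖ ≤ c₅ * ‖P.res (P.α (k + 1)) x v‖ ∧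
      ‖P.F' x (P.res (P.α k) x v)‖ ≤ c₅ * ‖P.F' x (P.res (P.α (k + 1)) x v)‖ :=
  hx.norm_res_le_of_le (P.sequence.pos k) (P.sequence.pos (k + 1)) (by linarith [P.hc₅])
    (fun t ht => P.sequence.residual_le k t (hx.icc_subset ht)) v

theorem Near.norm_res_sub_le {x : X} (hx : P.Near x) {a b : ℝ} (ha : 0 < a) (hab : a ≤ b)
    (v : X) :
    √a * ‖P.res b x v - P.res a x v‖ ≤ c₂ * ‖P.F' x (P.res b x v)‖ := by
  have ca := hx.continuousOn_residual ha
  have cb := hx.continuousOn_residual (ha.trans_le hab)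
  have hsa : 0 < √a := Real.sqrt_pos.2 ha
  rw [res, res, ← _root_.sub_apply, ← opFun_sub _ cb ca, norm_apply_opFun _ cb]
  have := norm_opFun_le _ (cb.sub ca) cb.sqrt_mul_self
    (c := c₂ / √a) (div_nonneg P.hc₂.le hsa.le) (fun t ht => ?_) v
  · rw [div_mul_eq_mul_div, le_div_iff₀ hsa] at this
    calc _ ≤ _ := by rw [mul_comm]; exact this
      _ = _ := rfl
  · have ht' := hx.icc_subset ht
    have h1 := P.filter.residual_sub_le a b ha hab t ht'
    have h2 := P.filter.residual_mono a b ha hab t ht'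
    rw [Real.sqrt_div ht'.1] at h1
    simp only [Pi.sub_apply]
    rw [abs_of_nonneg (by linarith), abs_mul, abs_residual (ha.trans_le hab) ht',
      abs_of_nonneg (Real.sqrt_nonneg t)]
    calc _ ≤ _ := h1
      _ = _ := by ring

theorem Near.norm_sub_res_le {x : X} (hx : P.Near x) {a : ℝ} (ha : 0 < a) (v : X) :
    √a * ‖v - P.res a x v‖ ≤ 2 * c₄ * ‖P.F' x (P.res (P.α 0) x v)‖ := by
  have ca := hx.continuousOn_residual ha
  have cb := hx.continuousOn_residual (P.sequence.pos 0)
  have hsa : 0 < √a := Real.sqrt_pos.2 ha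
  have hv : v - P.res a x v
      = opFun (fun t => 1 - residualFn P.g a t) (normalOp (P.F' x)) v := by
    rw [opFun_sub _ (f := fun _ => (1 : ℝ)) continuousOn_const ca, _root_.sub_apply, opFun_const]
    simp [res]
  rw [hv, res, norm_apply_opFun _ cb]
  have := norm_opFun_le _ (f := fun t => 1 - residualFn P.g a t)
    (h := fun t => √t * residualFn P.g (P.α 0) t) (continuousOn_const.sub ca)
    cb.sqrt_mul_self
    (c := 2 * c₄ / √a) (div_nonneg (by linarith [P.hc₄]) hsa.le) (fun t ht => ?_) v
  · rw [div_mul_eq_mul_div, le_div_iff₀ hsa] at this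
    rw [mul_comm]; exact this
  · obtain ⟨ht', h34⟩ := hx.spectrum_bounds t ht
    have h1 := P.filter.mul_sqrt_le a ha t ht'
    have h2 := P.filter.nonneg a ha t ht'
    have hs := Real.sqrt_nonneg t
    rw [show (1 : ℝ) - residualFn P.g a t = √t * (P.g a t * √t) by
      rw [mul_comm (P.g a t), ← mul_assoc, Real.mul_self_sqrt ht'.1, residualFn]; ring,
      abs_of_nonneg (by positivity), abs_of_nonneg (mul_nonneg hs (by linarith)), div_eq_mul_inv]
    have h3 : 0 < c₄ * (√a)⁻¹ := mul_pos P.hc₄ (inv_pos.2 hsa)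
    have h4 := mul_le_mul_of_nonneg_left h1 hs
    have h5 := mul_le_mul_of_nonneg_left h34 (mul_nonneg h3.le hs)
    nlinarith [mul_nonneg h3.le hs]

theorem Near.norm_le_res_zero {x : X} (hx : P.Near x) (v : X) :
    ‖v‖ ≤ 4 / 3 * ‖P.res (P.α 0) x v‖ ∧
      ‖P.F' x v‖ ≤ 4 / 3 * ‖P.F' x (P.res (P.α 0) x v)‖ := by
  have cb := hx.continuousOn_residual (P.sequence.pos 0)
  constructor
  · have := norm_opFun_le (P.F' x) (f := fun _ => (1 : ℝ)) (c := 4 / 3) continuousOn_const cb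
      (by norm_num) (fun t ht => ?_) v
    · simpa [opFun_const, res] using this
    · have h := (hx.spectrum_bounds t ht).2
      rw [abs_one, abs_of_nonneg (by linarith)]; linarith
  · rw [res, norm_apply_opFun _ cb, norm_apply_eq_opFun_sqrt]
    refine norm_opFun_le _ Real.continuous_sqrt.continuousOn
      cb.sqrt_mul_self (by norm_num) (fun t ht => ?_) v
    have h := (hx.spectrum_bounds t ht).2
    rw [abs_mul, abs_of_nonneg (Real.sqrt_nonneg t), abs_of_nonneg (by linarith : (0:ℝ) ≤
      residualFn P.g (P.α 0) t)]
    nlinarith [Real.sqrt_nonneg t]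

theorem Near.norm_res_sub_res_le {x z : X} (hx : P.Near x) (hz : P.Near z) {a : ℝ} (ha : 0 < a) :
    ‖P.res a x P.e₀ - P.res a z P.e₀‖ ≤ c₇ * P.κ * ‖x - z‖ := by
  have h1 := P.commutator.first x hx.mem_ball z hz.mem_ball a ha
  have h2 := ContinuousLinearMap.le_of_opNorm_le _ h1 P.e₀
  have h3 := mul_le_mul_of_nonneg_left P.K₀_le_κ (mul_nonneg P.hc₇.le (norm_nonneg (x - z)))
  rw [_root_.sub_apply] at h2
  unfold res
  linarith

theorem Near.norm_deriv_res_sub_res_le {x z : X} (hx : P.Near x) (hz : P.Near z) {a : ℝ}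
    (ha : 0 < a) (hs : 8 * (errFactor c₄ γ₁ * P.κ) ≤ 1) :
    ‖P.F' x (P.res a x P.e₀ - P.res a z P.e₀)‖
      ≤ P.κ * (c₈ * √a * ‖x - z‖ + 6 * c₈ * (P.imageErr x + P.imageErr z)) := by
  have h1 := P.commutator.second x hx.mem_ball z hz.mem_ball a ha
  have h2 := ContinuousLinearMap.le_of_opNorm_le _ h1 P.e₀
  have h3 := mul_le_mul_of_nonneg_left P.K₀_add_K₁_le_κ
    (mul_nonneg (mul_nonneg P.hc₈.le (Real.sqrt_nonneg a)) (norm_nonneg (x - z)))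
  have h4 := hx.norm_deriv_sub_apply_le hz hs
  have h5 := hz.norm_deriv_sub_apply_le hx hs
  rw [← norm_neg, ← map_neg, neg_sub] at h5
  have h6 : c₈ * P.K₂ * (‖P.F' x (x - z)‖ + ‖P.F' z (x - z)‖) * ‖P.e₀‖
      ≤ c₈ * (6 * (P.imageErr x + P.imageErr z)) * P.κ := by
    have h7 : ‖P.F' x (x - z)‖ + ‖P.F' z (x - z)‖ ≤ 6 * (P.imageErr x + P.imageErr z) := by
      linarith
    calc _ = c₈ * (‖P.F' x (x - z)‖ + ‖P.F' z (x - z)‖) * (P.K₂ * ‖P.e₀‖) := by ring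
      _ ≤ _ := mul_le_mul (mul_le_mul_of_nonneg_left h7 P.hc₈.le) P.K₂_le_κ
        (mul_nonneg P.hK₂.le (norm_nonneg _))
        (mul_nonneg P.hc₈.le (by linarith [P.imageErr_nonneg x, P.imageErr_nonneg z]))
  rw [ContinuousLinearMap.comp_apply, _root_.sub_apply] at h2
  unfold res
  linarith

/-- The image residual `‖F'(x) r_a(F'(x)* F'(x)) (x₀ - x†)‖` changes little with `x`. -/
theorem Near.norm_deriv_res_le_of_near {x z : X} (hx : P.Near x) (hz : P.Near z) {a : ℝ}
    (ha : 0 < a) (hs : 8 * (errFactor c₄ γ₁ * P.κ) ≤ 1) :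
    ‖P.F' x (P.res a x P.e₀)‖ ≤ 2 * ‖P.F' z (P.res a z P.e₀)‖
      + P.κ * (c₈ * √a * ‖x - z‖ + (6 * c₈ + 3) * (P.imageErr x + P.imageErr z)) := by
  have h1 := hx.norm_deriv_res_sub_res_le hz ha hs
  have h2 := hx.norm_deriv_le hz hs (P.res a z P.e₀)
  have h3 := hz.norm_deriv_sub_apply_le hx hs
  rw [← norm_neg, ← map_neg, neg_sub] at h3
  have h4 := hz.norm_res_le ha P.e₀
  have h5 : P.K₂ * ‖P.F' z (x - z)‖ * ‖P.res a z P.e₀‖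
      ≤ P.κ * (3 * (P.imageErr x + P.imageErr z)) := by
    have h6 := mul_le_mul h3 h4 (norm_nonneg _)
      (by linarith [P.imageErr_nonneg x, P.imageErr_nonneg z])
    have h7 := mul_le_mul_of_nonneg_left h6 P.hK₂.le
    have h8 := mul_le_mul_of_nonneg_left P.K₂_le_κ
      (show 0 ≤ 3 * (P.imageErr z + P.imageErr x) by
        linarith [P.imageErr_nonneg x, P.imageErr_nonneg z])
    linarith
  have h9 : ‖P.F' x (P.res a x P.e₀)‖ ≤ ‖P.F' x (P.res a x P.e₀ - P.res a z P.e₀)‖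
      + ‖P.F' x (P.res a z P.e₀)‖ := by
    rw [map_sub]; exact norm_le_norm_sub_add _ _
  linarith

variable (P)

/-! ### One step of the iteration -/

/-- The iterates. -/
def iter (k : ℕ) : X := newtonIter P.F P.F' P.g P.α P.x₀ P.yδ k

/-- The image residual `‖F'(x_k) r_{α_k}(F'(x_k)* F'(x_k)) (x₀ - x†)‖` at the `k`-th iterate. -/
def imageRes (k : ℕ) : ℝ := ‖P.F' (P.iter k) (P.res (P.α k) (P.iter k) P.e₀)‖

theorem sqrt_α_pos (k : ℕ) : 0 < √(P.α k) := Real.sqrt_pos.2 (P.sequence.pos k)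

theorem α_succ_le (k : ℕ) : P.α (k + 1) ≤ P.α k := by
  have := P.sequence.one_le_ratio k
  rwa [one_le_div (P.sequence.pos _)] at this

theorem α_antitone : Antitone P.α := antitone_nat_of_succ_le P.α_succ_le

theorem α_le_succ (k : ℕ) : P.α k ≤ r * P.α (k + 1) :=
  (div_le_iff₀ (P.sequence.pos _)).1 (P.sequence.ratio_le k)

theorem sqrt_α_antitone : Antitone fun k => √(P.α k) :=
  fun _ _ h => Real.sqrt_le_sqrt (P.α_antitone h)

theorem sqrt_α_le_succ (k : ℕ) : √(P.α k) ≤ √r * √(P.α (k + 1)) := by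
  rw [← Real.sqrt_mul (by linarith [P.hr])]
  exact Real.sqrt_le_sqrt (P.α_le_succ k)

theorem one_le_sqrt_r (P : NewtonProblem 𝕜 X Y r τ γ₁ c₀ c₁ c₂ c₃ c₄ c₅ c₇ c₈) : 1 ≤ √r :=
  Real.one_le_sqrt.2 P.hr.le

/-- The linearized data misfit `F(x) - y^δ - F'(x)(x - x†)`. -/
def misfit (x : X) : Y := P.F x - P.yδ - P.F' x (x - P.xdag)

/-- The correction `g_{α_k}(F'(x_k)* F'(x_k)) F'(x_k)*` applied to the linearized misfit. -/
def correction (k : ℕ) : X := opFun (P.g (P.α k)) (normalOp (P.F' (P.iter k)))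
  (ContinuousLinearMap.adjoint (P.F' (P.iter k)) (P.misfit (P.iter k)))

theorem iter_succ_sub (k : ℕ) (hk : P.Near (P.iter k)) :
    P.iter (k + 1) - P.xdag = P.res (P.α k) (P.iter k) P.e₀ - P.correction k := by
  have cg := hk.continuousOn_g (P.sequence.pos k)
  have cg' : ContinuousOn (fun t => P.g (P.α k) t * t) (Icc 0 ‖normalOp (P.F' (P.iter k))‖) :=
    cg.mul continuousOn_id
  have h1 : P.F (P.iter k) - P.yδ - P.F' (P.iter k) (P.iter k - P.x₀)
      = P.misfit (P.iter k) + P.F' (P.iter k) P.e₀ := by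
    rw [misfit, show P.iter k - P.x₀ = (P.iter k - P.xdag) - P.e₀ by rw [e₀]; abel, map_sub]
    abel
  have h2 : P.res (P.α k) (P.iter k) P.e₀ = P.e₀ - opFun (P.g (P.α k))
      (normalOp (P.F' (P.iter k)))
      (ContinuousLinearMap.adjoint (P.F' (P.iter k)) (P.F' (P.iter k) P.e₀)) := by
    have h3 : opFun (residualFn P.g (P.α k)) (normalOp (P.F' (P.iter k)))
        = opFun (fun t => (fun _ => (1 : ℝ)) t - (fun t => P.g (P.α k) t * t) t)
          (normalOp (P.F' (P.iter k))) :=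
      opFun_congr fun t _ => by simp only [residualFn]; ring
    rw [res, h3, opFun_sub _ continuousOn_const cg', _root_.sub_apply,
      opFun_const, opFun_mul _ (h := fun t => t) cg continuousOn_id, opFun_id]
    simp [normalOp]
  have h4 : P.iter (k + 1) = P.x₀ - opFun (P.g (P.α k)) (normalOp (P.F' (P.iter k)))
      (ContinuousLinearMap.adjoint (P.F' (P.iter k))
        (P.F (P.iter k) - P.yδ - P.F' (P.iter k) (P.iter k - P.x₀))) := rfl
  rw [h4, h1, h2, map_add, map_add, correction, e₀]
  abel

variable {P}

theorem Near.norm_misfit_le {x : X} (hx : P.Near x) (hs : 8 * (errFactor c₄ γ₁ * P.κ) ≤ 1) :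
    ‖P.misfit x‖ ≤ P.δ + 4 * (errFactor c₄ γ₁ * P.κ) * P.imageErr x := by
  have h1 := hx.remainder_le hs
  have h2 : P.misfit x = (P.F x - P.F P.xdag - P.F' x (x - P.xdag)) - (P.yδ - P.F P.xdag) := by
    rw [misfit]; abel
  rw [h2]
  exact (norm_sub_le _ _).trans (by linarith [P.noise])

theorem norm_correction_le {k : ℕ} (hk : P.Near (P.iter k))
    (hs : 8 * (errFactor c₄ γ₁ * P.κ) ≤ 1) :
    √(P.α k) * ‖P.correction k‖
      ≤ c₄ * (P.δ + 4 * (errFactor c₄ γ₁ * P.κ) * P.imageErr (P.iter k)) := by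
  have h1 := norm_opFun_adjoint_le _ (hk.continuousOn_g (P.sequence.pos k))
    (c := c₄ * (√(P.α k))⁻¹) (fun t ht => by
      rw [abs_of_nonneg (P.filter.nonneg _ (P.sequence.pos k) t (hk.icc_subset ht))]
      exact P.filter.mul_sqrt_le _ (P.sequence.pos k) t (hk.icc_subset ht)) (P.misfit (P.iter k))
  have h2 := mul_le_mul_of_nonneg_left (hk.norm_misfit_le hs) P.hc₄.le
  have h3 := mul_le_mul_of_nonneg_left h1 (P.sqrt_α_pos k).le
  rw [show √(P.α k) * (c₄ * (√(P.α k))⁻¹ * ‖P.misfit (P.iter k)‖)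
    = c₄ * ‖P.misfit (P.iter k)‖ * (√(P.α k) * (√(P.α k))⁻¹) by ring,
    mul_inv_cancel₀ (P.sqrt_α_pos k).ne', mul_one] at h3
  exact h3.trans h2

theorem Near.contraction {k : ℕ} (hk : P.Near (P.iter k)) (v : Y) :
    ‖P.F' (P.iter k) (opFun (P.g (P.α k)) (normalOp (P.F' (P.iter k)))
      (ContinuousLinearMap.adjoint (P.F' (P.iter k)) v))‖ ≤ ‖v‖ ∧
    ‖v - P.F' (P.iter k) (opFun (P.g (P.α k)) (normalOp (P.F' (P.iter k)))
      (ContinuousLinearMap.adjoint (P.F' (P.iter k)) v))‖ ≤ ‖v‖ := by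
  refine norm_apply_opFun_adjoint_le _ (hk.continuousOn_g (P.sequence.pos k))
    (fun t ht => P.filter.nonneg _ (P.sequence.pos k) t (hk.icc_subset ht)) (fun t ht => ?_) v
  have := P.filter.residual_pos _ (P.sequence.pos k) t (hk.icc_subset ht)
  unfold residualFn at this
  linarith

theorem norm_deriv_correction_le {k : ℕ} (hk : P.Near (P.iter k))
    (hs : 8 * (errFactor c₄ γ₁ * P.κ) ≤ 1) :
    ‖P.F' (P.iter k) (P.correction k)‖
      ≤ P.δ + 4 * (errFactor c₄ γ₁ * P.κ) * P.imageErr (P.iter k) :=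
  (hk.contraction _).1.trans (hk.norm_misfit_le hs)

theorem norm_deriv_succ_le {k : ℕ} (hk : P.Near (P.iter k))
    (hs : 8 * (errFactor c₄ γ₁ * P.κ) ≤ 1) :
    ‖P.F' (P.iter k) (P.iter (k + 1) - P.xdag)‖
      ≤ P.imageRes k + (P.δ + 4 * (errFactor c₄ γ₁ * P.κ) * P.imageErr (P.iter k)) := by
  rw [P.iter_succ_sub k hk, map_sub]
  exact (norm_sub_le _ _).trans (add_le_add le_rfl (norm_deriv_correction_le hk hs))

theorem imageRes_le_deriv {k : ℕ} (hk : P.Near (P.iter k))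
    (hs : 8 * (errFactor c₄ γ₁ * P.κ) ≤ 1) :
    P.imageRes k ≤ ‖P.F' (P.iter k) (P.iter (k + 1) - P.xdag)‖
      + (P.δ + 4 * (errFactor c₄ γ₁ * P.κ) * P.imageErr (P.iter k)) := by
  have h1 : P.F' (P.iter k) (P.res (P.α k) (P.iter k) P.e₀)
      = P.F' (P.iter k) (P.iter (k + 1) - P.xdag) + P.F' (P.iter k) (P.correction k) := by
    rw [P.iter_succ_sub k hk, map_sub]; abel
  rw [imageRes, h1]
  exact (norm_add_le _ _).trans (add_le_add le_rfl (norm_deriv_correction_le hk hs))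

/-- The noise enters the linearized residual with factor exactly one. -/
theorem norm_linearized_residual_le {k : ℕ} (hk : P.Near (P.iter k))
    (hs : 8 * (errFactor c₄ γ₁ * P.κ) ≤ 1) :
    ‖P.F' (P.iter k) (P.iter (k + 1) - P.xdag) + (P.F P.xdag - P.yδ)‖
      ≤ P.imageRes k + P.δ + 4 * (errFactor c₄ γ₁ * P.κ) * P.imageErr (P.iter k) := by
  set x := P.iter k with hx
  set u := P.F x - P.F P.xdag - P.F' x (x - P.xdag) with hu
  set n := P.F P.xdag - P.yδ with hn
  have h1 : P.misfit x = n + u := by rw [misfit, hu, hn]; abel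
  have h2 := (hk.contraction n).2
  have h3 := (hk.contraction u).1
  have h4 := hk.remainder_le hs
  have h5 : ‖n‖ ≤ P.δ := by rw [hn, norm_sub_rev]; exact P.noise
  rw [P.iter_succ_sub k hk, correction, ← hx, h1, map_add, map_add, map_sub, map_add]
  have h6 : ∀ a b c d : Y, a - (b + c) + d = a + (d - b) - c := fun a b c d => by abel
  rw [h6]
  refine (norm_sub_le _ _).trans ?_
  have h7 := norm_add_le (P.F' x (P.res (P.α k) x P.e₀)) (n - P.F' x (opFun (P.g (P.α k))
    (normalOp (P.F' x)) (ContinuousLinearMap.adjoint (P.F' x) n)))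
  have h8 : P.imageRes k = ‖P.F' x (P.res (P.α k) x P.e₀)‖ := rfl
  linarith

theorem imageErr_succ_le {k : ℕ} (hk : P.Near (P.iter k)) (hk' : P.Near (P.iter (k + 1)))
    (hs : 8 * (errFactor c₄ γ₁ * P.κ) ≤ 1) :
    P.imageErr (P.iter (k + 1)) ≤ 2 * P.imageRes k + 2 * P.δ
      + 10 * (errFactor c₄ γ₁ * P.κ) * P.imageErr (P.iter k) := by
  have h1 := P.near_xdag.norm_deriv_le hk hs (P.iter (k + 1) - P.xdag)
  have h2 := norm_deriv_succ_le hk hs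
  have h3 := hk.norm_deriv_err_le hs
  rw [← neg_sub (P.iter k), map_neg, norm_neg] at h1
  have h4 := mul_le_mul_of_nonneg_right hk'.K₂_mul_le (P.imageErr_nonneg (P.iter k))
  have h5 := mul_le_mul_of_nonneg_right (mul_le_mul_of_nonneg_left h3 P.hK₂.le)
    (norm_nonneg (P.iter (k + 1) - P.xdag))
  have h6 : P.imageErr (P.iter (k + 1)) = ‖P.F' P.xdag (P.iter (k + 1) - P.xdag)‖ := rfl
  linarith

theorem norm_deriv_sub_succ_le {k : ℕ} (hk : P.Near (P.iter k)) (hk' : P.Near (P.iter (k + 1))) :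
    ‖(P.F' (P.iter k) - P.F' P.xdag) (P.iter (k + 1) - P.xdag)‖
      ≤ errFactor c₄ γ₁ * P.κ * (P.imageErr (P.iter k) + P.imageErr (P.iter (k + 1))) := by
  have h1 := hk.norm_deriv_sub_le P.near_xdag (P.iter (k + 1) - P.xdag)
  have h2 := mul_le_mul_of_nonneg_right hk.K₁_mul_le (P.imageErr_nonneg (P.iter (k + 1)))
  have h3 := mul_le_mul_of_nonneg_right hk'.K₂_mul_le (P.imageErr_nonneg (P.iter k))
  unfold imageErr at *
  linarith

theorem imageRes_le {k : ℕ} (hk : P.Near (P.iter k)) (hk' : P.Near (P.iter (k + 1)))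
    (hs : 8 * (errFactor c₄ γ₁ * P.κ) ≤ 1) :
    P.imageRes k ≤ 2 * P.imageErr (P.iter (k + 1)) + P.δ
      + 5 * (errFactor c₄ γ₁ * P.κ) * P.imageErr (P.iter k) := by
  have h1 := imageRes_le_deriv hk hs
  have h2 := norm_deriv_sub_succ_le hk hk'
  have h3 := norm_le_insert' (P.F' (P.iter k) (P.iter (k + 1) - P.xdag))
    (P.F' P.xdag (P.iter (k + 1) - P.xdag))
  rw [← _root_.sub_apply] at h3
  have h4 : P.imageErr (P.iter (k + 1)) = ‖P.F' P.xdag (P.iter (k + 1) - P.xdag)‖ := rfl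
  have h5 := P.imageErr_nonneg (P.iter (k + 1))
  nlinarith

theorem norm_residual_succ_le {k : ℕ} (hk : P.Near (P.iter k)) (hk' : P.Near (P.iter (k + 1)))
    (hs : 8 * (errFactor c₄ γ₁ * P.κ) ≤ 1) :
    ‖P.F (P.iter (k + 1)) - P.yδ‖ ≤ P.imageRes k + P.δ
      + 5 * (errFactor c₄ γ₁ * P.κ) * (P.imageErr (P.iter k) + P.imageErr (P.iter (k + 1))) := by
  have h1 := norm_linearized_residual_le hk hs
  have h2 := norm_deriv_sub_succ_le hk hk'
  have h3 := hk'.remainder_xdag_le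
  set e := P.iter (k + 1) - P.xdag with he
  have h4 : P.F (P.iter (k + 1)) - P.yδ
      = (P.F (P.iter (k + 1)) - P.F P.xdag - P.F' P.xdag e)
        + (P.F' (P.iter k) e + (P.F P.xdag - P.yδ)) - (P.F' (P.iter k) - P.F' P.xdag) e := by
    rw [_root_.sub_apply]; abel
  rw [h4]
  refine (norm_sub_le _ _).trans ?_
  have h5 := norm_add_le (P.F (P.iter (k + 1)) - P.F P.xdag - P.F' P.xdag e)
    (P.F' (P.iter k) e + (P.F P.xdag - P.yδ))
  have h6 : 0 ≤ errFactor c₄ γ₁ * P.κ := mul_nonneg (by linarith [P.errFactor_two_le]) P.κ_nonneg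
  have h7 := mul_nonneg h6 (P.imageErr_nonneg (P.iter (k + 1)))
  linarith

/-! ### The iterates stay near the solution until the discrepancy principle stops them -/

/-- The constant in the bound `‖F'(x†)(x_k - x†)‖ ≤ imageFactor * √α_k * ‖x₀ - x†‖`. -/
def imageFactor (r γ₁ c₃ : ℝ) : ℝ :=
  √r * (2 * c₃ + 2 * γ₁ + 1)

variable (P)

theorem iter_zero : P.iter 0 = P.x₀ := rfl

theorem c₃_le_imageFactor (P : NewtonProblem 𝕜 X Y r τ γ₁ c₀ c₁ c₂ c₃ c₄ c₅ c₇ c₈) :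
    c₃ ≤ imageFactor r γ₁ c₃ := by
  unfold imageFactor; nlinarith [P.one_le_sqrt_r, P.hc₃, P.γ₁_pos]

theorem imageErr_x₀_le : P.imageErr P.x₀ ≤ c₃ * √(P.α 0) * ‖P.e₀‖ :=
  ContinuousLinearMap.le_of_opNorm_le _ P.near_xdag.norm_deriv_le_sqrt P.e₀

theorem apriori_bounds (hs : 8 * (errFactor c₄ γ₁ * P.κ) ≤ 1)
    (h1 : 10 * imageFactor r γ₁ c₃ * (errFactor c₄ γ₁ * P.κ) ≤ 1)
    (h2 : 4 * c₄ * imageFactor r γ₁ c₃ * (errFactor c₄ γ₁ * P.κ) ≤ 1) :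
    ∀ k, (∀ j < k, P.δ < γ₁ * ‖P.e₀‖ * √(P.α j)) →
      P.Near (P.iter k) ∧ P.imageErr (P.iter k) ≤ imageFactor r γ₁ c₃ * √(P.α k) * ‖P.e₀‖ := by
  intro k
  induction k with
  | zero =>
    refine fun _ => ⟨P.near_x₀, P.imageErr_x₀_le.trans ?_⟩
    gcongr
    exact P.c₃_le_imageFactor
  | succ k ih =>
    intro hj
    obtain ⟨hk, ht⟩ := ih fun j hjk => hj j (hjk.trans k.lt_succ_self)
    have hd := hj k k.lt_succ_self
    have hspos := P.sqrt_α_pos k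
    have hE := norm_nonneg P.e₀
    have hθ : 0 ≤ errFactor c₄ γ₁ * P.κ := mul_nonneg (by linarith [P.errFactor_two_le]) P.κ_nonneg
    have hγ := P.γ₁_pos
    have hV : P.δ + 4 * (errFactor c₄ γ₁ * P.κ) * P.imageErr (P.iter k)
        ≤ √(P.α k) * ‖P.e₀‖ * (γ₁ + 4 * imageFactor r γ₁ c₃ * (errFactor c₄ γ₁ * P.κ)) := by
      have := mul_le_mul_of_nonneg_left ht hθ
      linarith
    have hnear : P.Near (P.iter (k + 1)) := by
      have e1 := norm_correction_le hk hs
      have e2 : ‖P.correction k‖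
          ≤ c₄ * (‖P.e₀‖ * (γ₁ + 4 * imageFactor r γ₁ c₃ * (errFactor c₄ γ₁ * P.κ))) := by
        have := mul_le_mul_of_nonneg_left hV P.hc₄.le
        refine le_of_mul_le_mul_left ?_ hspos
        linarith
      have e3 := hk.norm_res_le (P.sequence.pos k) P.e₀
      have e4 := mul_le_mul_of_nonneg_right h2 hE
      unfold Near
      rw [P.iter_succ_sub k hk]
      refine (norm_sub_le _ _).trans ?_
      have e5 : errFactor c₄ γ₁ = 2 * (1 + c₄ * γ₁) := rfl
      have e6 := mul_nonneg (mul_nonneg P.hc₄.le hγ.le) hE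
      generalize errFactor c₄ γ₁ * P.κ = θ at *
      rw [e5]
      linarith
    refine ⟨hnear, ?_⟩
    have f1 := imageErr_succ_le hk hnear hs
    have f2 := hk.norm_deriv_res_le (P.sequence.pos k) P.e₀
    have f3 : P.imageRes k ≤ c₃ * √(P.α k) * ‖P.e₀‖ := f2
    have f4 := mul_le_mul_of_nonneg_left ht hθ
    have f5 := mul_le_mul_of_nonneg_right h1 (mul_nonneg hspos.le hE)
    have f6 := mul_le_mul_of_nonneg_right (P.sqrt_α_le_succ k) hE
    have f7 := mul_le_mul_of_nonneg_left f6 (show 0 ≤ 2 * c₃ + 2 * γ₁ + 1 by linarith [P.hc₃])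
    rw [show imageFactor r γ₁ c₃ * √(P.α (k + 1)) * ‖P.e₀‖
      = (2 * c₃ + 2 * γ₁ + 1) * (√r * √(P.α (k + 1)) * ‖P.e₀‖) by rw [imageFactor]; ring]
    generalize errFactor c₄ γ₁ * P.κ = θ at *
    linarith

/-- The index at which `√α_k γ₁ ‖x₀ - x†‖ ≤ δ` first holds satisfies the stopping criterion. -/
theorem exists_stopping (hs : 8 * (errFactor c₄ γ₁ * P.κ) ≤ 1)
    (h1 : 10 * imageFactor r γ₁ c₃ * (errFactor c₄ γ₁ * P.κ) ≤ 1)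
    (h2 : 4 * c₄ * imageFactor r γ₁ c₃ * (errFactor c₄ γ₁ * P.κ) ≤ 1)
    (h3 : 5 * imageFactor r γ₁ c₃ * (√r + 1) * (errFactor c₄ γ₁ * P.κ) ≤ (τ - 1) * γ₁ - c₃ * √r) :
    ∃ n, (∀ k ≤ n, P.Near (P.iter k)) ∧ ‖P.F (P.iter n) - P.yδ‖ ≤ τ * P.δ ∧
      γ₁ * ‖P.e₀‖ * √(P.α n) ≤ P.δ := by
  have hex : ∃ n, γ₁ * ‖P.e₀‖ * √(P.α n) ≤ P.δ := by
    have : Tendsto (fun n => γ₁ * ‖P.e₀‖ * √(P.α n)) atTop (𝓝 0) := by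
      have := ((Real.continuous_sqrt.tendsto 0).comp P.sequence.tendsto_zero).const_mul
        (γ₁ * ‖P.e₀‖)
      simpa using this
    exact ((this.eventually (gt_mem_nhds P.hδ)).exists).imp fun n hn => hn.le
  classical
  have hn := Nat.find_spec hex
  have hmin : ∀ j < Nat.find hex, P.δ < γ₁ * ‖P.e₀‖ * √(P.α j) :=
    fun j hj => not_le.1 (Nat.find_min hex hj)
  have hall : ∀ k ≤ Nat.find hex, P.Near (P.iter k) ∧
      P.imageErr (P.iter k) ≤ imageFactor r γ₁ c₃ * √(P.α k) * ‖P.e₀‖ :=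
    fun k hk => P.apriori_bounds hs h1 h2 k fun j hj => hmin j (hj.trans_le hk)
  refine ⟨Nat.find hex, fun k hk => (hall k hk).1, ?_, hn⟩
  have hγ := P.γ₁_pos
  have hE := norm_nonneg P.e₀
  have hγ' : c₃ * √r < γ₁ * (τ - 1) := by
    have := P.hγ₁
    rwa [div_lt_iff₀ (by linarith [P.hτ])] at this
  have hθ : 0 ≤ errFactor c₄ γ₁ * P.κ := mul_nonneg (by linarith [P.errFactor_two_le]) P.κ_nonneg
  rcases hN : Nat.find hex with _ | k
  · rw [hN] at hn
    have e1 : ‖P.F P.x₀ - P.F P.xdag‖ ≤ c₃ * √(P.α 0) * ‖P.e₀‖ := by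
      have := P.near_x₀.mean_value 0 (C := c₃ * √(P.α 0) * ‖P.e₀‖) (fun ζ _ hζ => by
        rw [sub_zero]
        exact ContinuousLinearMap.le_of_opNorm_le _ hζ.norm_deriv_le_sqrt _)
      simpa using this
    have e2 : P.F (P.iter 0) - P.yδ = (P.F P.x₀ - P.F P.xdag) - (P.yδ - P.F P.xdag) := by
      rw [iter_zero]; abel
    rw [e2]
    refine (norm_sub_le _ _).trans ?_
    have e3 : c₃ * √(P.α 0) * ‖P.e₀‖ ≤ (τ - 1) * P.δ := by
      have e4 : c₃ ≤ γ₁ * (τ - 1) := by nlinarith [P.one_le_sqrt_r, P.hc₃]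
      have e5 := mul_le_mul_of_nonneg_right e4 (mul_nonneg (P.sqrt_α_pos 0).le hE)
      have e6 := mul_le_mul_of_nonneg_left hn (show 0 ≤ τ - 1 by linarith [P.hτ])
      linarith
    linarith [P.noise]
  · rw [hN] at hn
    obtain ⟨hk, ht⟩ := hall k (by omega)
    obtain ⟨hk', ht'⟩ := hall (k + 1) (by omega)
    have f1 := norm_residual_succ_le hk hk' hs
    have f2 : P.imageRes k ≤ c₃ * √(P.α k) * ‖P.e₀‖ :=
      hk.norm_deriv_res_le (P.sequence.pos k) P.e₀
    have hΛ : 0 ≤ imageFactor r γ₁ c₃ := P.hc₃.le.trans P.c₃_le_imageFactor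
    have f3 := mul_le_mul_of_nonneg_right (P.sqrt_α_le_succ k) hE
    set S := √(P.α (k + 1)) * ‖P.e₀‖ with hS
    have f4 : √(P.α k) * ‖P.e₀‖ ≤ √r * S := by rw [hS]; linarith
    have f5 := mul_le_mul_of_nonneg_left f4 P.hc₃.le
    have f6 := mul_le_mul_of_nonneg_left f4 hΛ
    have f7 : P.imageErr (P.iter k) + P.imageErr (P.iter (k + 1))
        ≤ imageFactor r γ₁ c₃ * (√r + 1) * S := by
      have : imageFactor r γ₁ c₃ * √(P.α (k + 1)) * ‖P.e₀‖ = imageFactor r γ₁ c₃ * S := by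
        rw [hS]; ring
      linarith
    have f8 := mul_le_mul_of_nonneg_left f7 hθ
    have hS0 : 0 ≤ S := mul_nonneg (P.sqrt_α_pos _).le hE
    have f9 := mul_le_mul_of_nonneg_right h3 hS0
    have f10 : γ₁ * S ≤ P.δ := by rw [hS]; linarith
    have f11 := mul_le_mul_of_nonneg_left f10 (show 0 ≤ τ - 1 by linarith [P.hτ])
    linarith

/-! ### Comparison with the linear residual at the solution -/

/-- `‖r_{α_k}(F'(x†)* F'(x†)) (x₀ - x†)‖`, the error of the linear method with exact data. -/
def linRes (k : ℕ) : ℝ := ‖P.res (P.α k) P.xdag P.e₀‖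

/-- `‖F'(x†) r_{α_k}(F'(x†)* F'(x†)) (x₀ - x†)‖`. -/
def linImageRes (k : ℕ) : ℝ := ‖P.F' P.xdag (P.res (P.α k) P.xdag P.e₀)‖

/-- The weight `W` for which all nonlinear perturbation terms carry a factor at most `W κ`. -/
def weight (γ₁ c₄ c₇ c₈ : ℝ) : ℝ :=
  10 * errFactor c₄ γ₁ + c₇ + 6 * c₈ + 3

variable {P} {ε : ℝ}

theorem weight_bounds (hε : weight γ₁ c₄ c₇ c₈ * P.κ ≤ ε) :
    10 * (errFactor c₄ γ₁ * P.κ) ≤ ε ∧ c₇ * P.κ ≤ ε ∧ (6 * c₈ + 3) * P.κ ≤ ε ∧ c₈ * P.κ ≤ ε ∧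
      0 ≤ errFactor c₄ γ₁ * P.κ ∧ 0 ≤ ε := by
  have h1 := P.κ_nonneg
  have h2 := P.errFactor_two_le
  have h3 : 0 ≤ errFactor c₄ γ₁ * P.κ := mul_nonneg (by linarith) h1
  have h4 := mul_nonneg P.hc₇.le h1
  have h5 := mul_nonneg P.hc₈.le h1
  unfold weight at hε
  refine ⟨?_, ?_, ?_, ?_, h3, ?_⟩ <;> linarith

theorem small_of_weight (hε : weight γ₁ c₄ c₇ c₈ * P.κ ≤ ε) (hε1 : ε ≤ 1) :
    8 * (errFactor c₄ γ₁ * P.κ) ≤ 1 := by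
  obtain ⟨h1, -, -, -, h2, -⟩ := weight_bounds hε
  linarith

/-- The perturbed misfit level `δ + ε ‖F'(x†)(x_k - x†)‖` bounds the correction. -/
theorem norm_correction_le' {k : ℕ} (hk : P.Near (P.iter k)) (hε : weight γ₁ c₄ c₇ c₈ * P.κ ≤ ε)
    (hε1 : ε ≤ 1) :
    √(P.α k) * ‖P.correction k‖ ≤ c₄ * (P.δ + ε * P.imageErr (P.iter k)) := by
  refine (norm_correction_le hk (small_of_weight hε hε1)).trans
    (mul_le_mul_of_nonneg_left ?_ P.hc₄.le)
  obtain ⟨h1, -, -, -, h2, -⟩ := weight_bounds hε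
  have := mul_le_mul_of_nonneg_right (show 4 * (errFactor c₄ γ₁ * P.κ) ≤ ε by linarith)
    (P.imageErr_nonneg (P.iter k))
  linarith

theorem imageErr_succ_le' {k : ℕ} (hk : P.Near (P.iter k)) (hk' : P.Near (P.iter (k + 1)))
    (hε : weight γ₁ c₄ c₇ c₈ * P.κ ≤ ε) (hε1 : ε ≤ 1) :
    P.imageErr (P.iter (k + 1)) ≤ 2 * P.imageRes k + 2 * P.δ + ε * P.imageErr (P.iter k) := by
  refine (imageErr_succ_le hk hk' (small_of_weight hε hε1)).trans ?_
  obtain ⟨h1, -, -, -, h2, -⟩ := weight_bounds hε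
  have := mul_le_mul_of_nonneg_right h1 (P.imageErr_nonneg (P.iter k))
  linarith

theorem imageRes_le' {k : ℕ} (hk : P.Near (P.iter k)) (hk' : P.Near (P.iter (k + 1)))
    (hε : weight γ₁ c₄ c₇ c₈ * P.κ ≤ ε) (hε1 : ε ≤ 1) :
    P.imageRes k ≤ 2 * P.imageErr (P.iter (k + 1)) + P.δ + ε * P.imageErr (P.iter k) := by
  refine (imageRes_le hk hk' (small_of_weight hε hε1)).trans ?_
  obtain ⟨h1, -, -, -, h2, -⟩ := weight_bounds hε
  have := mul_le_mul_of_nonneg_right (show 5 * (errFactor c₄ γ₁ * P.κ) ≤ ε by linarith)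
    (P.imageErr_nonneg (P.iter k))
  linarith

theorem norm_residual_succ_le' {k : ℕ} (hk : P.Near (P.iter k)) (hk' : P.Near (P.iter (k + 1)))
    (hε : weight γ₁ c₄ c₇ c₈ * P.κ ≤ ε) (hε1 : ε ≤ 1) :
    ‖P.F (P.iter (k + 1)) - P.yδ‖ ≤ P.imageRes k + P.δ
      + ε * (P.imageErr (P.iter k) + P.imageErr (P.iter (k + 1))) := by
  refine (norm_residual_succ_le hk hk' (small_of_weight hε hε1)).trans ?_
  obtain ⟨h1, -, -, -, h2, -⟩ := weight_bounds hε
  have := mul_le_mul_of_nonneg_right (show 5 * (errFactor c₄ γ₁ * P.κ) ≤ ε by linarith)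
    (add_nonneg (P.imageErr_nonneg (P.iter k)) (P.imageErr_nonneg (P.iter (k + 1))))
  linarith

theorem Near.norm_deriv_res_le_of_near' {x z : X} (hx : P.Near x) (hz : P.Near z) {a : ℝ}
    (ha : 0 < a) (hε : weight γ₁ c₄ c₇ c₈ * P.κ ≤ ε) (hε1 : ε ≤ 1) :
    ‖P.F' x (P.res a x P.e₀)‖ ≤ 2 * ‖P.F' z (P.res a z P.e₀)‖
      + ε * (√a * ‖x - z‖ + (P.imageErr x + P.imageErr z)) := by
  refine (hx.norm_deriv_res_le_of_near hz ha (small_of_weight hε hε1)).trans ?_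
  obtain ⟨-, -, h1, h2, -⟩ := weight_bounds hε
  have h3 := mul_le_mul_of_nonneg_right h1
    (add_nonneg (P.imageErr_nonneg x) (P.imageErr_nonneg z))
  have h4 := mul_le_mul_of_nonneg_right h2 (mul_nonneg (Real.sqrt_nonneg a) (norm_nonneg (x - z)))
  linarith

theorem Near.norm_res_sub_res_le' {x z : X} (hx : P.Near x) (hz : P.Near z) {a : ℝ} (ha : 0 < a)
    (hε : weight γ₁ c₄ c₇ c₈ * P.κ ≤ ε) : ‖P.res a x P.e₀ - P.res a z P.e₀‖ ≤ ε * ‖x - z‖ :=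
  (hx.norm_res_sub_res_le hz ha).trans
    (mul_le_mul_of_nonneg_right (weight_bounds hε).2.1 (norm_nonneg _))

theorem imageRes_le_linImageRes {k : ℕ} (hk : P.Near (P.iter k))
    (hε : weight γ₁ c₄ c₇ c₈ * P.κ ≤ ε)
    (hε1 : ε ≤ 1) :
    P.imageRes k ≤ 2 * P.linImageRes k
      + ε * (√(P.α k) * ‖P.iter k - P.xdag‖ + P.imageErr (P.iter k)) := by
  have := hk.norm_deriv_res_le_of_near' P.near_xdag (P.sequence.pos k) hε hε1
  rwa [P.imageErr_xdag, add_zero] at this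

variable (P)

theorem linRes_nonneg (k : ℕ) : 0 ≤ P.linRes k := norm_nonneg _

theorem linImageRes_nonneg (k : ℕ) : 0 ≤ P.linImageRes k := norm_nonneg _

/-- The error level `√α_k ‖r(A) e₀‖ + ‖T r(A) e₀‖` of the linear method, with
`T = F'(x†)`, `A = T* T`. -/
def linLevel (k : ℕ) : ℝ := √(P.α k) * P.linRes k + P.linImageRes k

theorem linLevel_nonneg (k : ℕ) : 0 ≤ P.linLevel k :=
  add_nonneg (mul_nonneg (P.sqrt_α_pos k).le (P.linRes_nonneg k)) (P.linImageRes_nonneg k)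

theorem linLevel_le_succ (k : ℕ) : P.linLevel k ≤ √r * c₅ * P.linLevel (k + 1) := by
  obtain ⟨h1, h2⟩ := P.near_xdag.norm_res_succ k P.e₀
  change P.linRes k ≤ c₅ * P.linRes (k + 1) at h1
  change P.linImageRes k ≤ c₅ * P.linImageRes (k + 1) at h2
  have h3 := mul_le_mul (P.sqrt_α_le_succ k) h1 (P.linRes_nonneg k)
    (mul_nonneg (Real.sqrt_nonneg r) (Real.sqrt_nonneg _))
  have h4 := mul_le_mul_of_nonneg_right P.one_le_sqrt_r
    (mul_nonneg (show 0 ≤ c₅ by linarith [P.hc₅]) (P.linImageRes_nonneg (k + 1)))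
  unfold linLevel
  linarith

/-- The constant of `error_le_linLevel`. -/
def errConst (r c₄ c₅ : ℝ) : ℝ :=
  (5 + c₄) * (√r * c₅)

theorem one_le_step (P : NewtonProblem 𝕜 X Y r τ γ₁ c₀ c₁ c₂ c₃ c₄ c₅ c₇ c₈) : 1 ≤ √r * c₅ :=
  one_le_mul_of_one_le_of_one_le P.one_le_sqrt_r P.hc₅.le

theorem four_le_errConst (P : NewtonProblem 𝕜 X Y r τ γ₁ c₀ c₁ c₂ c₃ c₄ c₅ c₇ c₈) :
    4 ≤ errConst r c₄ c₅ := by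
  unfold errConst; nlinarith [P.one_le_step, P.hc₄]

theorem imageErr_zero_le : P.imageErr P.x₀ ≤ 4 / 3 * P.linImageRes 0 :=
  (P.near_xdag.norm_le_res_zero P.e₀).2

/-- The error of the iterates is controlled by that of the linear method at the solution. -/
theorem error_le_linLevel {n : ℕ} (hn : ∀ k ≤ n, P.Near (P.iter k))
    (hε : weight γ₁ c₄ c₇ c₈ * P.κ ≤ ε) (hε1 : ε ≤ 1)
    (hε2 : ε * ((4 + c₄) * errConst r c₄ c₅) ≤ 1) :
    ∀ k ≤ n, √(P.α k) * ‖P.iter k - P.xdag‖ + P.imageErr (P.iter k)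
      ≤ errConst r c₄ c₅ * (P.linLevel k + P.δ) := by
  intro k
  induction k with
  | zero =>
    intro _
    obtain ⟨h1, h2⟩ := P.near_xdag.norm_le_res_zero P.e₀
    change ‖P.x₀ - P.xdag‖ ≤ 4 / 3 * P.linRes 0 at h1
    change P.imageErr P.x₀ ≤ 4 / 3 * P.linImageRes 0 at h2
    have h3 := mul_le_mul_of_nonneg_left h1 (P.sqrt_α_pos 0).le
    have h4 := P.four_le_errConst
    have h5 := P.linLevel_nonneg 0
    have h6 := P.hδ
    rw [iter_zero]
    have h7 : √(P.α 0) * ‖P.x₀ - P.xdag‖ + P.imageErr P.x₀ ≤ 4 / 3 * P.linLevel 0 := by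
      unfold linLevel; linarith
    nlinarith
  | succ k ih =>
    intro hkn
    have hk := hn k (by omega)
    have hk' := hn (k + 1) hkn
    have ih := ih (by omega)
    obtain ⟨-, -, -, -, -, hε0⟩ := weight_bounds hε
    have hs := (P.sqrt_α_pos k).le
    have a1 := norm_correction_le' hk hε hε1
    have a2 := hk.norm_res_sub_res_le' P.near_xdag (P.sequence.pos k) hε
    have a3 : ‖P.iter (k + 1) - P.xdag‖
        ≤ P.linRes k + ε * ‖P.iter k - P.xdag‖ + ‖P.correction k‖ := by
      rw [P.iter_succ_sub k hk]
      have b1 := norm_sub_le (P.res (P.α k) (P.iter k) P.e₀) (P.correction k)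
      have b2 := norm_le_insert' (P.res (P.α k) (P.iter k) P.e₀) (P.res (P.α k) P.xdag P.e₀)
      have b3 : P.linRes k = ‖P.res (P.α k) P.xdag P.e₀‖ := rfl
      linarith
    have a4 := imageErr_succ_le' hk hk' hε hε1
    have a5 := imageRes_le_linImageRes hk hε hε1
    have a6 := mul_le_mul_of_nonneg_left a3 hs
    have a7 := mul_le_mul_of_nonneg_right (P.sqrt_α_antitone k.le_succ)
      (norm_nonneg (P.iter (k + 1) - P.xdag))
    set y := √(P.α k) * ‖P.iter k - P.xdag‖ + P.imageErr (P.iter k) with hy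
    have ht := P.imageErr_nonneg (P.iter k)
    have hy1 : P.imageErr (P.iter k) ≤ y := by
      have := mul_nonneg hs (norm_nonneg (P.iter k - P.xdag)); linarith
    have hy2 : √(P.α k) * ‖P.iter k - P.xdag‖ ≤ y := by linarith
    have e1 := mul_le_mul_of_nonneg_left hy1 hε0
    have e2 := mul_le_mul_of_nonneg_left hy2 hε0
    have e3 := mul_le_mul_of_nonneg_left e1 P.hc₄.le
    have hL := P.linLevel_nonneg k
    have hz : 0 ≤ P.linLevel k + P.δ := by linarith [P.hδ]
    have e4 : ε * y * (4 + c₄) ≤ P.linLevel k + P.δ := by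
      have f1 := mul_le_mul_of_nonneg_left ih (mul_nonneg hε0 (by linarith [P.hc₄] :
        0 ≤ 4 + c₄))
      have f2 := mul_le_mul_of_nonneg_right hε2 hz
      linarith
    have e5 : √(P.α (k + 1)) * ‖P.iter (k + 1) - P.xdag‖ + P.imageErr (P.iter (k + 1))
        ≤ (5 + c₄) * (P.linLevel k + P.δ) := by
      have g1 := mul_nonneg hs (P.linRes_nonneg k)
      have g2 := mul_nonneg P.hc₄.le hL
      have g3 : P.linLevel k = √(P.α k) * P.linRes k + P.linImageRes k := rfl
      simp only at a7
      have g4 := P.hδ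
      have g5 := P.linImageRes_nonneg k
      linarith
    refine e5.trans ?_
    have e6 : P.linLevel k + P.δ ≤ √r * c₅ * (P.linLevel (k + 1) + P.δ) := by
      have := P.linLevel_le_succ k
      have := mul_le_mul_of_nonneg_right P.one_le_step P.hδ.le
      linarith
    have e7 := mul_le_mul_of_nonneg_left e6 (show 0 ≤ 5 + c₄ by linarith [P.hc₄])
    unfold errConst
    linarith

/-- As long as the discrepancy principle has not stopped, the noise level is dominated by the
error level of the linear method. -/
theorem noise_le_linLevel {n : ℕ} (hn : ∀ k ≤ n, P.Near (P.iter k))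
    (hε : weight γ₁ c₄ c₇ c₈ * P.κ ≤ ε) (hε1 : ε ≤ 1)
    (hε2 : ε * ((4 + c₄) * errConst r c₄ c₅) ≤ 1)
    (hε3 : ε * (3 * errConst r c₄ c₅ * (√r * c₅)) ≤ (τ - 1) / 2) {j : ℕ} (hj : j ≤ n)
    (hres : τ * P.δ < ‖P.F (P.iter j) - P.yδ‖) :
    (τ - 1) / 2 * P.δ ≤ ((τ - 1) / 2 + 2 * (√r * c₅)) * P.linLevel j := by
  have hτ := P.hτ
  have hδ := P.hδ
  have hL := P.linLevel_nonneg j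
  have hq := P.one_le_step
  rcases j with _ | k
  · have h1 := P.near_x₀.remainder_xdag_le
    obtain ⟨h2, -, -, -, -, -⟩ := weight_bounds hε
    have h3 := mul_le_mul_of_nonneg_right (show errFactor c₄ γ₁ * P.κ ≤ 1 / 10 by linarith)
      (P.imageErr_nonneg P.x₀)
    have h4 : ‖P.F (P.iter 0) - P.yδ‖ ≤ P.imageErr P.x₀ * (11 / 10) + P.δ := by
      have e1 : P.F (P.iter 0) - P.yδ = (P.F P.x₀ - P.F P.xdag - P.F' P.xdag (P.x₀ - P.xdag))
        + P.F' P.xdag (P.x₀ - P.xdag) - (P.yδ - P.F P.xdag) := by rw [iter_zero]; abel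
      rw [e1]
      refine (norm_sub_le _ _).trans ?_
      have e2 := norm_add_le (P.F P.x₀ - P.F P.xdag - P.F' P.xdag (P.x₀ - P.xdag))
        (P.F' P.xdag (P.x₀ - P.xdag))
      have e3 : P.imageErr P.x₀ = ‖P.F' P.xdag (P.x₀ - P.xdag)‖ := rfl
      linarith [P.noise]
    have h5 := P.imageErr_zero_le
    have h6 : P.linImageRes 0 ≤ P.linLevel 0 :=
      le_add_of_nonneg_left (mul_nonneg (P.sqrt_α_pos 0).le (P.linRes_nonneg 0))
    have h7 := mul_nonneg (show 0 ≤ τ - 1 by linarith) hL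
    have h8 := mul_le_mul_of_nonneg_right hq hL
    linarith
  · have hk := hn k (by omega)
    have hk' := hn (k + 1) hj
    have h1 := norm_residual_succ_le' hk hk' hε hε1
    have h2 := imageRes_le_linImageRes hk hε hε1
    have h3 := P.error_le_linLevel hn hε hε1 hε2 k (by omega)
    have h4 := P.error_le_linLevel hn hε hε1 hε2 (k + 1) hj
    obtain ⟨-, -, -, -, -, hε0⟩ := weight_bounds hε
    have h5 := P.linLevel_le_succ k
    have h6 : P.linImageRes k ≤ P.linLevel k :=
      le_add_of_nonneg_left (mul_nonneg (P.sqrt_α_pos k).le (P.linRes_nonneg k))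
    have h7 := mul_nonneg (P.sqrt_α_pos k).le (norm_nonneg (P.iter k - P.xdag))
    have h8 := mul_nonneg (P.sqrt_α_pos (k + 1)).le (norm_nonneg (P.iter (k + 1) - P.xdag))
    have hC : 0 ≤ errConst r c₄ c₅ := by linarith [P.four_le_errConst]
    have h9 : P.linLevel k + P.δ ≤ √r * c₅ * (P.linLevel (k + 1) + P.δ) := by
      linarith [mul_le_mul_of_nonneg_right hq hδ.le]
    have h10 : P.linLevel (k + 1) + P.δ ≤ √r * c₅ * (P.linLevel (k + 1) + P.δ) :=
      le_mul_of_one_le_left (by linarith) hq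
    have h11 := mul_le_mul_of_nonneg_left h9 hC
    have h12 := mul_le_mul_of_nonneg_left h10 hC
    have h13 : 2 * (√(P.α k) * ‖P.iter k - P.xdag‖ + P.imageErr (P.iter k))
        + P.imageErr (P.iter (k + 1))
        ≤ 3 * errConst r c₄ c₅ * (√r * c₅) * (P.linLevel (k + 1) + P.δ) := by linarith
    have h14 := mul_le_mul_of_nonneg_left h13 hε0
    have h15 := mul_le_mul_of_nonneg_right hε3 (show 0 ≤ P.linLevel (k + 1) + P.δ by linarith)
    have h16 := mul_nonneg hε0 h7
    linarith

/-! ### Stability of the iterates beyond the stopping index -/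

/-- The constant of `step_back`. -/
def backConst (c₂ c₄ c₅ : ℝ) : ℝ :=
  (16 * c₅ + 7) + c₂ * c₅ * (16 * c₅ + 7) + c₄ * (32 * c₅ + 20)

theorem backConst_ge (P : NewtonProblem 𝕜 X Y r τ γ₁ c₀ c₁ c₂ c₃ c₄ c₅ c₇ c₈) :
    16 * c₅ + 7 ≤ backConst c₂ c₄ c₅ := by
  unfold backConst
  have h1 := P.hc₂
  have h2 := P.hc₄
  have h3 := P.hc₅
  have : 0 ≤ c₂ * c₅ * (16 * c₅ + 7) + c₄ * (32 * c₅ + 20) := by positivity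
  linarith

theorem imageErr_zero_le_imageRes (hs : 8 * (errFactor c₄ γ₁ * P.κ) ≤ 1) :
    3 * P.imageErr P.x₀ ≤ 8 * P.imageRes 0 := by
  have h1 := P.near_x₀.imageErr_le hs
  have h2 := (P.near_x₀.norm_le_res_zero P.e₀).2
  have h3 : P.imageRes 0 = ‖P.F' P.x₀ (P.res (P.α 0) P.x₀ P.e₀)‖ := rfl
  have h4 : ‖P.F' P.x₀ (P.x₀ - P.xdag)‖ = ‖P.F' P.x₀ P.e₀‖ := rfl
  linarith

/-- One step back, neither the image error nor the weighted increment can be much larger. -/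
theorem step_back {n : ℕ} (hn : ∀ k ≤ n, P.Near (P.iter k))
    (hε : weight γ₁ c₄ c₇ c₈ * P.κ ≤ ε) (hε1 : ε ≤ 1)
    (hε4 : ε * (40 * (c₅ + 1) * (backConst c₂ c₄ c₅ + 1)) ≤ 1) :
    ∀ k < n, P.imageErr (P.iter k) ≤ backConst c₂ c₄ c₅ * (P.imageErr (P.iter (k + 1)) + P.δ) ∧
      √(P.α k) * ‖P.iter (k + 1) - P.iter k‖
        ≤ backConst c₂ c₄ c₅ * (P.imageErr (P.iter (k + 1)) + P.δ) := by
  have hδ := P.hδ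
  have hc₄ := P.hc₄
  have hc₅ := P.hc₅
  have hc₂₅ : 0 < c₂ * c₅ := mul_pos P.hc₂ (by linarith)
  have hC := P.backConst_ge
  obtain ⟨-, -, -, -, -, hε0⟩ := weight_bounds hε
  have hεC : ε * (40 * (backConst c₂ c₄ c₅ + 1)) ≤ 1 := by
    have : ε * (40 * (backConst c₂ c₄ c₅ + 1))
        ≤ ε * (40 * (c₅ + 1) * (backConst c₂ c₄ c₅ + 1)) := by
      refine mul_le_mul_of_nonneg_left ?_ hε0
      nlinarith
    linarith
  have hε40 : 40 * ε ≤ 1 := by nlinarith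
  intro k
  induction k with
  | zero =>
    intro h0
    have hk : P.Near (P.iter 0) := P.near_x₀
    have hk' := hn 1 h0
    have a1 := P.imageErr_zero_le_imageRes (small_of_weight hε hε1)
    have a2 := imageRes_le' hk hk' hε hε1
    have a3 := norm_correction_le' hk hε hε1
    have a4 := hk.norm_sub_res_le (P.sequence.pos 0) P.e₀
    have a5 : ‖P.iter 1 - P.iter 0‖ ≤ ‖P.e₀ - P.res (P.α 0) (P.iter 0) P.e₀‖
        + ‖P.correction 0‖ := by
      have : P.iter 1 - P.iter 0 = -(P.e₀ - P.res (P.α 0) (P.iter 0) P.e₀)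
          - P.correction 0 := by
        have b1 := P.iter_succ_sub 0 hk
        rw [zero_add] at b1
        rw [show P.iter 1 - P.iter 0 = (P.iter 1 - P.xdag) - P.e₀ by rw [iter_zero, e₀]; abel, b1]
        abel
      rw [this]
      exact (norm_sub_le _ _).trans (by rw [norm_neg])
    have a6 := mul_le_mul_of_nonneg_left a5 (P.sqrt_α_pos 0).le
    have a7 : ‖P.F' (P.iter 0) (P.res (P.α 0) (P.iter 0) P.e₀)‖ = P.imageRes 0 := rfl
    rw [a7] at a4
    rw [iter_zero] at a2 a3 ⊢
    rw [iter_zero] at a6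
    rw [iter_zero] at a4
    have t1 := P.imageErr_nonneg (P.iter 1)
    have t0 := P.imageErr_nonneg P.x₀
    rw [zero_add] at a2 ⊢
    have b1 : ε * P.imageErr P.x₀ ≤ 1 / 20 * P.imageErr P.x₀ :=
      mul_le_mul_of_nonneg_right (by linarith) t0
    have b2 : P.imageErr P.x₀ ≤ 7 * (P.imageErr (P.iter 1) + P.δ) := by linarith
    have b3 : P.imageRes 0 ≤ 3 * (P.imageErr (P.iter 1) + P.δ) := by linarith
    have b4 : P.δ + ε * P.imageErr P.x₀ ≤ 2 * (P.imageErr (P.iter 1) + P.δ) := by linarith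
    have b5 := mul_le_mul_of_nonneg_left b4 hc₄.le
    have b6 := mul_le_mul_of_nonneg_left b3 hc₄.le
    have hB : 0 ≤ P.imageErr (P.iter 1) + P.δ := by linarith
    have b7 : 7 * (P.imageErr (P.iter 1) + P.δ)
        ≤ backConst c₂ c₄ c₅ * (P.imageErr (P.iter 1) + P.δ) :=
      mul_le_mul_of_nonneg_right (by linarith) hB
    have b8 : 8 * c₄ * (P.imageErr (P.iter 1) + P.δ)
        ≤ backConst c₂ c₄ c₅ * (P.imageErr (P.iter 1) + P.δ) := by
      refine mul_le_mul_of_nonneg_right ?_ hB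
      unfold backConst
      have : 0 ≤ c₂ * c₅ * (16 * c₅ + 7) := by positivity
      nlinarith
    constructor <;> linarith
  | succ k ih =>
    intro hkn
    obtain ⟨i1, i2⟩ := ih (by omega)
    have hk := hn k (by omega)
    have hk' := hn (k + 1) (by omega)
    have hk'' := hn (k + 2) (by omega)
    have up := imageErr_succ_le' hk hk' hε hε1
    have lo := imageRes_le' hk' hk'' hε hε1
    have f2 := hk.norm_deriv_res_le_of_near' hk' (P.sequence.pos k) hε hε1
    have f3 := (hk'.norm_res_succ k P.e₀).2
    have f4 : ‖P.F' (P.iter k) (P.res (P.α k) (P.iter k) P.e₀)‖ = P.imageRes k := rfl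
    have f5 : ‖P.F' (P.iter (k + 1)) (P.res (P.α (k + 1)) (P.iter (k + 1)) P.e₀)‖
      = P.imageRes (k + 1) := rfl
    rw [f5] at f3
    rw [f4, norm_sub_rev (P.iter k)] at f2
    -- `x_{k+2} - x_{k+1}` splits into a change of `α`, a change of base point, and corrections
    have g1 : P.iter (k + 2) - P.iter (k + 1)
        = -(P.res (P.α k) (P.iter (k + 1)) P.e₀ - P.res (P.α (k + 1)) (P.iter (k + 1)) P.e₀)
          + (P.res (P.α k) (P.iter (k + 1)) P.e₀ - P.res (P.α k) (P.iter k) P.e₀)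
          + (P.correction k - P.correction (k + 1)) := by
      rw [show P.iter (k + 2) - P.iter (k + 1)
        = (P.iter (k + 2) - P.xdag) - (P.iter (k + 1) - P.xdag) by abel,
        P.iter_succ_sub (k + 1) hk', P.iter_succ_sub k hk]
      abel
    have g2 := hk'.norm_res_sub_le (P.sequence.pos (k + 1)) (P.α_succ_le k) P.e₀
    have g3 := hk'.norm_res_sub_res_le' hk (P.sequence.pos k) hε
    have g4 := norm_correction_le' hk hε hε1
    have g5 := norm_correction_le' hk' hε hε1
    have g6 : ‖P.iter (k + 2) - P.iter (k + 1)‖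
        ≤ ‖P.res (P.α k) (P.iter (k + 1)) P.e₀ - P.res (P.α (k + 1)) (P.iter (k + 1)) P.e₀‖
          + ‖P.res (P.α k) (P.iter (k + 1)) P.e₀ - P.res (P.α k) (P.iter k) P.e₀‖
          + (‖P.correction k‖ + ‖P.correction (k + 1)‖) := by
      rw [g1]
      refine (norm_add₃_le ..).trans ?_
      rw [norm_neg]
      exact add_le_add le_rfl (norm_sub_le _ _)
    have hss := P.sqrt_α_antitone k.le_succ
    simp only [Nat.succ_eq_add_one] at hss
    have g7 := mul_le_mul_of_nonneg_left g6 (P.sqrt_α_pos (k + 1)).le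
    have g8 := mul_le_mul_of_nonneg_right hss (norm_nonneg (P.correction k))
    have g9 := mul_le_mul_of_nonneg_right hss (norm_nonneg (P.iter (k + 1) - P.iter k))
    have g10 := mul_le_mul_of_nonneg_left g3 (P.sqrt_α_pos (k + 1)).le
    have g11 := mul_le_mul_of_nonneg_left f3 P.hc₂.le
    have g12 := mul_le_mul_of_nonneg_left g9 hε0
    generalize ‖P.F' (P.iter (k + 1)) (P.res (P.α k) (P.iter (k + 1)) P.e₀)‖ = A at *
    generalize ‖P.res (P.α k) (P.iter (k + 1)) P.e₀ - P.res (P.α k) (P.iter k) P.e₀‖ = A2 at *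
    generalize ‖P.res (P.α k) (P.iter (k + 1)) P.e₀
      - P.res (P.α (k + 1)) (P.iter (k + 1)) P.e₀‖ = A3 at *
    have t0 := P.imageErr_nonneg (P.iter k)
    have t1 := P.imageErr_nonneg (P.iter (k + 1))
    have t2 := P.imageErr_nonneg (P.iter (k + 2))
    change P.imageRes (k + 1) ≤ 2 * P.imageErr (P.iter (k + 2)) + P.δ
      + ε * P.imageErr (P.iter (k + 1)) at lo
    change P.imageErr (P.iter (k + 1)) ≤ backConst c₂ c₄ c₅ * (P.imageErr (P.iter (k + 2)) + P.δ) ∧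
      √(P.α (k + 1)) * ‖P.iter (k + 2) - P.iter (k + 1)‖
        ≤ backConst c₂ c₄ c₅ * (P.imageErr (P.iter (k + 2)) + P.δ)
    generalize P.imageErr (P.iter k) = u₀ at *
    generalize P.imageErr (P.iter (k + 1)) = u₁ at *
    generalize P.imageErr (P.iter (k + 2)) = u₂ at *
    generalize P.imageRes k = q₀ at *
    generalize P.imageRes (k + 1) = q₁ at *
    generalize ‖P.correction k‖ = w₀ at *
    generalize ‖P.correction (k + 1)‖ = w₁ at *
    generalize √(P.α k) * ‖P.iter (k + 1) - P.iter k‖ = D₀ at *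
    generalize √(P.α (k + 1)) * ‖P.iter (k + 2) - P.iter (k + 1)‖ = D₁ at *
    generalize hCdef : backConst c₂ c₄ c₅ = C at *
    have m1 := mul_le_mul_of_nonneg_left i1 hε0
    have m2 := mul_le_mul_of_nonneg_left i2 hε0
    -- `ε` times the bounds of the previous step
    have m3 : ε * (C * (u₁ + P.δ)) ≤ 1 / 40 * (u₁ + P.δ) := by
      have := mul_le_mul_of_nonneg_right hεC (show 0 ≤ u₁ + P.δ by linarith)
      have := mul_nonneg hε0 (show 0 ≤ u₁ + P.δ by linarith)
      linarith
    have m4 : ε * c₅ * u₁ ≤ 1 / 40 * u₁ := by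
      refine mul_le_mul_of_nonneg_right ?_ t1
      have : ε * (40 * (c₅ + 1)) ≤ ε * (40 * (c₅ + 1) * (C + 1)) := by
        refine mul_le_mul_of_nonneg_left ?_ hε0
        nlinarith
      nlinarith
    have m5 : ε * u₁ ≤ 1 / 40 * u₁ := mul_le_mul_of_nonneg_right (by linarith) t1
    have m6 := mul_le_mul_of_nonneg_left lo (show 0 ≤ c₅ by linarith)
    have hB : 0 ≤ u₂ + P.δ := by linarith
    have hc₅B : 0 ≤ c₅ * (u₂ + P.δ) := mul_nonneg (by linarith) hB
    have hc₅u : 0 ≤ c₅ * u₂ := mul_nonneg (by linarith) t2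
    have hc₅δ : 0 ≤ c₅ * P.δ := mul_nonneg (by linarith) hδ.le
    have k1 : u₁ ≤ (12 * c₅ + 4) * (u₂ + P.δ) := by linarith
    have k2 : u₁ + P.δ ≤ (12 * c₅ + 5) * (u₂ + P.δ) := by linarith
    constructor
    · exact k1.trans (mul_le_mul_of_nonneg_right (by linarith) hB)
    · have n1 : q₁ ≤ (16 * c₅ + 7) * (u₂ + P.δ) := by linarith
      have n2 := mul_le_mul_of_nonneg_left n1 hc₂₅.le
      have n3 : ε * u₀ ≤ 1 / 40 * (u₁ + P.δ) := by linarith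
      have n4 := mul_le_mul_of_nonneg_left n3 hc₄.le
      have n5 := mul_le_mul_of_nonneg_left m5 hc₄.le
      have n6 := mul_le_mul_of_nonneg_left k2 hc₄.le
      have n7 := mul_nonneg hc₄.le hB
      have n8 := mul_nonneg hc₄.le hδ.le
      have n9 := mul_nonneg hc₄.le t2
      have n10 := mul_nonneg (mul_nonneg hc₄.le (show 0 ≤ c₅ by linarith)) hB
      have n11 : D₁ ≤ c₂ * c₅ * ((16 * c₅ + 7) * (u₂ + P.δ)) + (u₁ + P.δ)
          + c₄ * (2 * P.δ + (u₁ + P.δ)) := by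
        have := mul_nonneg hc₄.le t1
        linarith
      have n12 : P.δ ≤ u₂ + P.δ := by linarith
      have n13 := mul_le_mul_of_nonneg_left n12 hc₄.le
      have n14 : (u₁ + P.δ) ≤ (16 * c₅ + 7) * (u₂ + P.δ) := by linarith
      rw [← hCdef]
      unfold backConst
      linarith

/-- The constant of `exists_anchor`. -/
def anchorConst (c₂ c₄ c₅ : ℝ) : ℝ := backConst c₂ c₄ c₅ + 3 * c₂ + 4 * c₄ + 3

/-- The constant of `step_forward`. -/
def forwardConst (c₂ c₄ c₅ : ℝ) : ℝ := 4 * anchorConst c₂ c₄ c₅ + c₄ + 3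

theorem anchorConst_ge (P : NewtonProblem 𝕜 X Y r τ γ₁ c₀ c₁ c₂ c₃ c₄ c₅ c₇ c₈) :
    3 ≤ anchorConst c₂ c₄ c₅ ∧ backConst c₂ c₄ c₅ ≤ anchorConst c₂ c₄ c₅ ∧
      3 * c₂ + 4 * c₄ ≤ anchorConst c₂ c₄ c₅ := by
  have h1 := P.backConst_ge
  have h2 := P.hc₂
  have h3 := P.hc₄
  have h4 := P.hc₅
  unfold anchorConst
  refine ⟨?_, ?_, ?_⟩ <;> linarith

/-- The iterate `x_l` is reproduced, up to the level of its image error and the noise, by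
linear residuals with smaller parameters at a nearby point `z`, which is the preceding iterate,
or `x₀` itself when `l = 0`. -/
theorem exists_anchor {n : ℕ} (hn : ∀ k ≤ n, P.Near (P.iter k))
    (hε : weight γ₁ c₄ c₇ c₈ * P.κ ≤ ε) (hε1 : ε ≤ 1)
    (hε4 : ε * (40 * (c₅ + 1) * (backConst c₂ c₄ c₅ + 1)) ≤ 1) {l : ℕ} (hl : l ≤ n) :
    ∃ z, P.Near z ∧
      (∀ k, l ≤ k → √(P.α k) * ‖P.res (P.α k) z P.e₀ - (P.iter l - P.xdag)‖
        ≤ anchorConst c₂ c₄ c₅ * (P.imageErr (P.iter l) + P.δ)) ∧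
      √(P.α l) * ‖P.iter l - z‖ ≤ anchorConst c₂ c₄ c₅ * (P.imageErr (P.iter l) + P.δ) ∧
      P.imageErr z ≤ anchorConst c₂ c₄ c₅ * (P.imageErr (P.iter l) + P.δ) ∧
      ∀ k, l ≤ k → ‖P.F' z (P.res (P.α k) z P.e₀)‖
        ≤ anchorConst c₂ c₄ c₅ * (P.imageErr (P.iter l) + P.δ) := by
  have hδ := P.hδ
  have hc₂ := P.hc₂
  have hc₄ := P.hc₄
  have hc₅ := P.hc₅
  have hC := P.backConst_ge
  obtain ⟨hA1, hA2, hA3⟩ := P.anchorConst_ge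
  have hB : 0 ≤ P.imageErr (P.iter l) + P.δ := by linarith [P.imageErr_nonneg (P.iter l)]
  have hs := small_of_weight hε hε1
  have hAB := mul_le_mul_of_nonneg_right hA1 hB
  have hAB3 := mul_le_mul_of_nonneg_right hA3 hB
  have hcB := mul_nonneg hc₄.le hB
  have hcB2 := mul_nonneg hc₂.le hB
  rcases l with _ | m
  · rw [iter_zero] at *
    have h1 : ‖P.F' P.x₀ P.e₀‖ ≤ 2 * P.imageErr P.x₀ := P.near_x₀.norm_deriv_err_le hs
    refine ⟨P.x₀, P.near_x₀, fun k _ => ?_, ?_, ?_, fun k _ => ?_⟩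
    · have h2 := P.near_x₀.norm_sub_res_le (P.sequence.pos k) P.e₀
      have h3 := P.near_x₀.norm_deriv_res_le_deriv (P.sequence.pos 0) P.e₀
      have h4 := mul_le_mul_of_nonneg_left (h3.trans h1) hc₄.le
      have h5 := mul_nonneg hc₄.le hδ.le
      rw [norm_sub_rev, show P.x₀ - P.xdag = P.e₀ from rfl]
      linarith
    · rw [sub_self, norm_zero, mul_zero]; linarith
    · linarith
    · have h3 := P.near_x₀.norm_deriv_res_le_deriv (P.sequence.pos k) P.e₀
      linarith
  · have hm := hn m (by omega)
    have hm' := hn (m + 1) hl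
    obtain ⟨i1, i2⟩ := P.step_back hn hε hε1 hε4 m (by omega)
    have lo := imageRes_le' hm hm' hε hε1
    have hcor := norm_correction_le' hm hε hε1
    obtain ⟨-, -, -, -, -, hε0⟩ := weight_bounds hε
    have hBB := mul_le_mul_of_nonneg_right hA2 hB
    have e1 : ε * P.imageErr (P.iter m) ≤ P.imageErr (P.iter (m + 1)) + P.δ := by
      have f1 := mul_le_mul_of_nonneg_left i1 hε0
      have f2 : ε * backConst c₂ c₄ c₅ ≤ 1 := by
        refine le_trans (mul_le_mul_of_nonneg_left ?_ hε0) hε4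
        have : 0 ≤ c₅ * backConst c₂ c₄ c₅ := mul_nonneg (by linarith) (by linarith)
        linarith
      have f3 := mul_le_mul_of_nonneg_right f2 hB
      linarith
    have e2 : P.imageRes m ≤ 3 * (P.imageErr (P.iter (m + 1)) + P.δ) := by linarith
    have e3 : ∀ k, m + 1 ≤ k → √(P.α k) * ‖P.correction m‖
        ≤ 2 * c₄ * (P.imageErr (P.iter (m + 1)) + P.δ) := by
      intro k hk
      have f1 := mul_le_mul_of_nonneg_right (P.sqrt_α_antitone (by omega : m ≤ k))
        (norm_nonneg (P.correction m))
      simp only at f1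
      have f2 := mul_le_mul_of_nonneg_left e1 hc₄.le
      have f3 := mul_nonneg hc₄.le (P.imageErr_nonneg (P.iter (m + 1)))
      linarith
    refine ⟨P.iter m, hm, fun k hk => ?_, ?_, ?_, fun k hk => ?_⟩
    · rw [P.iter_succ_sub m hm, show P.res (P.α k) (P.iter m) P.e₀
        - (P.res (P.α m) (P.iter m) P.e₀ - P.correction m)
        = P.correction m
          - (P.res (P.α m) (P.iter m) P.e₀ - P.res (P.α k) (P.iter m) P.e₀) by abel]
      have f1 := norm_sub_le (P.correction m)
        (P.res (P.α m) (P.iter m) P.e₀ - P.res (P.α k) (P.iter m) P.e₀)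
      have f2 := hm.norm_res_sub_le (P.sequence.pos k) (P.α_antitone (by omega : m ≤ k)) P.e₀
      have f3 : ‖P.F' (P.iter m) (P.res (P.α m) (P.iter m) P.e₀)‖ = P.imageRes m := rfl
      rw [f3] at f2
      have f4 := mul_le_mul_of_nonneg_left e2 hc₂.le
      have f5 := mul_le_mul_of_nonneg_left f1 (P.sqrt_α_pos k).le
      have f6 := e3 k hk
      linarith
    · have f1 := mul_le_mul_of_nonneg_right (P.sqrt_α_antitone m.le_succ)
        (norm_nonneg (P.iter (m + 1) - P.iter m))
      simp only [Nat.succ_eq_add_one] at f1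
      linarith
    · linarith
    · have f2 := hm.norm_res_mono (P.sequence.pos k) (P.α_antitone (by omega : m ≤ k)) P.e₀
      have f3 : ‖P.F' (P.iter m) (P.res (P.α m) (P.iter m) P.e₀)‖ = P.imageRes m := rfl
      linarith

/-- Later iterates stay close to `x_l`, relative to the image error of `x_l` and the noise. -/
theorem step_forward {n : ℕ} (hn : ∀ k ≤ n, P.Near (P.iter k))
    (hε : weight γ₁ c₄ c₇ c₈ * P.κ ≤ ε) (hε1 : ε ≤ 1)
    (hε4 : ε * (40 * (c₅ + 1) * (backConst c₂ c₄ c₅ + 1)) ≤ 1)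
    (hε5 : ε * (10 * (1 + c₄) * forwardConst c₂ c₄ c₅) ≤ 1) {l : ℕ} :
    ∀ k, l ≤ k → k ≤ n →
      √(P.α k) * ‖P.iter k - P.iter l‖
          ≤ forwardConst c₂ c₄ c₅ * (P.imageErr (P.iter l) + P.δ) ∧
        P.imageErr (P.iter k) ≤ forwardConst c₂ c₄ c₅ * (P.imageErr (P.iter l) + P.δ) := by
  intro k hlk
  have hδ := P.hδ
  have hc₄ := P.hc₄
  obtain ⟨hA1, -, -⟩ := P.anchorConst_ge
  have hF : forwardConst c₂ c₄ c₅ = 4 * anchorConst c₂ c₄ c₅ + c₄ + 3 := rfl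
  have hB : 0 ≤ P.imageErr (P.iter l) + P.δ := by linarith [P.imageErr_nonneg (P.iter l)]
  obtain ⟨-, -, -, -, -, hε0⟩ := weight_bounds hε
  induction k, hlk using Nat.le_induction with
  | base =>
    intro _
    rw [sub_self, norm_zero, mul_zero]
    refine ⟨mul_nonneg (by linarith) hB, ?_⟩
    have := mul_le_mul_of_nonneg_right (show 1 ≤ forwardConst c₂ c₄ c₅ by linarith) hB
    linarith
  | succ k hlk ih =>
    intro hkn
    obtain ⟨i1, i2⟩ := ih (by omega)
    have hk := hn k (by omega)
    have hk' := hn (k + 1) hkn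
    obtain ⟨z, hz, a1, a2, a3, a4⟩ := P.exists_anchor hn hε hε1 hε4 (l := l) (by omega)
    have a1 := a1 k hlk
    have a4 := a4 k hlk
    have hs := (P.sqrt_α_pos k).le
    have up := imageErr_succ_le' hk hk' hε hε1
    have f2 := hk.norm_deriv_res_le_of_near' hz (P.sequence.pos k) hε hε1
    have f4 : ‖P.F' (P.iter k) (P.res (P.α k) (P.iter k) P.e₀)‖ = P.imageRes k := rfl
    rw [f4] at f2
    have g3 := hk.norm_res_sub_res_le' hz (P.sequence.pos k) hε
    have g4 := norm_correction_le' hk hε hε1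
    have g6 : ‖P.iter (k + 1) - P.iter l‖
        ≤ ‖P.res (P.α k) (P.iter k) P.e₀ - P.res (P.α k) z P.e₀‖
          + ‖P.res (P.α k) z P.e₀ - (P.iter l - P.xdag)‖ + ‖P.correction k‖ := by
      rw [show P.iter (k + 1) - P.iter l
        = (P.res (P.α k) (P.iter k) P.e₀ - P.res (P.α k) z P.e₀)
          + (P.res (P.α k) z P.e₀ - (P.iter l - P.xdag)) - P.correction k by
        rw [show P.iter (k + 1) - P.iter l
          = (P.iter (k + 1) - P.xdag) - (P.iter l - P.xdag) by abel, P.iter_succ_sub k hk]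
        abel]
      exact (norm_sub_le _ _).trans (add_le_add (norm_add_le _ _) le_rfl)
    have g7 : √(P.α k) * ‖P.iter k - z‖
        ≤ √(P.α k) * ‖P.iter k - P.iter l‖ + √(P.α l) * ‖P.iter l - z‖ := by
      have e1 := mul_le_mul_of_nonneg_left (norm_sub_le_norm_sub_add_norm_sub (P.iter k)
        (P.iter l) z) hs
      have e2 := mul_le_mul_of_nonneg_right (P.sqrt_α_antitone hlk) (norm_nonneg (P.iter l - z))
      simp only at e2
      linarith
    have g8 := mul_le_mul_of_nonneg_left g6 hs
    have g9 := mul_le_mul_of_nonneg_left g3 hs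
    have g10 := mul_le_mul_of_nonneg_right (P.sqrt_α_antitone k.le_succ)
      (norm_nonneg (P.iter (k + 1) - P.iter l))
    simp only [Nat.succ_eq_add_one] at g10
    set b := P.imageErr (P.iter l) + P.δ with hb
    have hδb : P.δ ≤ b := by linarith [P.imageErr_nonneg (P.iter l)]
    generalize forwardConst c₂ c₄ c₅ = C at *
    generalize anchorConst c₂ c₄ c₅ = C₁ at *
    have hC₁ : C₁ * b ≤ C * b := mul_le_mul_of_nonneg_right (by linarith) hB
    -- all perturbation terms are bounded by multiples of `ε C b`, which is small
    have m1 : √(P.α k) * ‖P.iter k - z‖ ≤ 2 * (C * b) := by linarith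
    have m2 := mul_le_mul_of_nonneg_left m1 hε0
    have m3 := mul_le_mul_of_nonneg_left i2 hε0
    have m4 := mul_le_mul_of_nonneg_left (a3.trans hC₁) hε0
    have m5 : 10 * (ε * (C * b)) + 10 * (c₄ * (ε * (C * b))) ≤ b := by
      have := mul_le_mul_of_nonneg_right hε5 hB
      linarith
    have hCb : 0 ≤ ε * (C * b) := mul_nonneg hε0 (mul_nonneg (by linarith) hB)
    have m6 := mul_nonneg hc₄.le hCb
    have m7 := mul_le_mul_of_nonneg_left m3 hc₄.le
    have m8 := mul_le_mul_of_nonneg_left hδb hc₄.le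
    have m9 : 0 ≤ C₁ * b := mul_nonneg (by linarith) hB
    have m10 := mul_nonneg hc₄.le hB
    rw [hF] at *
    constructor <;> linarith

/-! ### The error at the stopping index -/

/-- The constant of `error_at_stopping`. -/
def stopConst (r τ γ₁ c₂ c₃ c₄ c₅ : ℝ) : ℝ :=
  4 / 3 + errConst r c₄ c₅
      * (1 + 2 / (τ - 1) * ((τ - 1) / 2 + 2 * (√r * c₅)) * (√r * c₅))
    + errConst r c₄ c₅ * (1 + (1 + c₃) / γ₁) + forwardConst c₂ c₄ c₅ * (2 * τ + 3)

theorem imageErr_stopping_le {l : ℕ} (hl : P.Near (P.iter l))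
    (hε : weight γ₁ c₄ c₇ c₈ * P.κ ≤ ε) (hε1 : ε ≤ 1)
    (hres : ‖P.F (P.iter l) - P.yδ‖ ≤ τ * P.δ) :
    P.imageErr (P.iter l) + P.δ ≤ (2 * τ + 3) * P.δ := by
  have h1 := hl.remainder_xdag_le
  obtain ⟨h2, -, -, -, -, -⟩ := weight_bounds hε
  have h3 := mul_le_mul_of_nonneg_right (show errFactor c₄ γ₁ * P.κ ≤ 1 / 10 by linarith)
    (P.imageErr_nonneg (P.iter l))
  have h4 : P.imageErr (P.iter l) ≤ ‖P.F (P.iter l) - P.F P.xdag‖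
      + ‖P.F (P.iter l) - P.F P.xdag - P.F' P.xdag (P.iter l - P.xdag)‖ :=
    norm_le_insert _ _
  have h5 : ‖P.F (P.iter l) - P.F P.xdag‖ ≤ ‖P.F (P.iter l) - P.yδ‖ + ‖P.yδ - P.F P.xdag‖ :=
    norm_sub_le_norm_sub_add_norm_sub _ _ _
  have h6 := P.noise
  have h7 := mul_pos (show 0 < τ by linarith [P.hτ]) P.hδ
  linarith [P.hδ]

/-- The error at the stopping index is bounded by the level of the linear method there, and, up
to the propagated noise, at every later index. -/
theorem error_at_stopping {n : ℕ} (hn : ∀ k ≤ n, P.Near (P.iter k))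
    (hn' : γ₁ * ‖P.e₀‖ * √(P.α n) ≤ P.δ)
    (hε : weight γ₁ c₄ c₇ c₈ * P.κ ≤ ε) (hε1 : ε ≤ 1)
    (hε2 : ε * ((4 + c₄) * errConst r c₄ c₅) ≤ 1)
    (hε3 : ε * (3 * errConst r c₄ c₅ * (√r * c₅)) ≤ (τ - 1) / 2)
    (hε4 : ε * (40 * (c₅ + 1) * (backConst c₂ c₄ c₅ + 1)) ≤ 1)
    (hε5 : ε * (10 * (1 + c₄) * forwardConst c₂ c₄ c₅) ≤ 1) {l : ℕ} (hl : l ≤ n)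
    (hdisc : IsDiscrepancyIndex P.F P.iter P.yδ τ P.δ l) :
    √(P.α l) * ‖P.iter l - P.xdag‖ ≤ stopConst r τ γ₁ c₂ c₃ c₄ c₅ * P.linLevel l ∧
    ∀ k, l ≤ k → √(P.α k) * ‖P.iter l - P.xdag‖
      ≤ stopConst r τ γ₁ c₂ c₃ c₄ c₅ * (P.linLevel k + P.δ) := by
  have hδ := P.hδ
  have hc₃ := P.hc₃
  have hc₄ := P.hc₄
  have hγ := P.γ₁_pos
  have hτ := P.hτ
  have hq := P.one_le_step
  have hE4 := P.four_le_errConst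
  obtain ⟨hA1, -, -⟩ := P.anchorConst_ge
  have hF : 0 ≤ forwardConst c₂ c₄ c₅ := by unfold forwardConst; linarith
  have hτ' : 0 < τ - 1 := by linarith
  set a := 2 / (τ - 1) * ((τ - 1) / 2 + 2 * (√r * c₅)) * (√r * c₅) with ha
  have ha0 : 0 ≤ a := by positivity
  have hg0 : 0 ≤ (1 + c₃) / γ₁ := by positivity
  have p1 : 0 ≤ errConst r c₄ c₅ * (1 + a) := mul_nonneg (by linarith) (by linarith)
  have p2 : 0 ≤ errConst r c₄ c₅ * (1 + (1 + c₃) / γ₁) := mul_nonneg (by linarith) (by linarith)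
  have p3 : 0 ≤ forwardConst c₂ c₄ c₅ * (2 * τ + 3) := mul_nonneg hF (by linarith)
  have hC : stopConst r τ γ₁ c₂ c₃ c₄ c₅ = 4 / 3 + errConst r c₄ c₅ * (1 + a)
    + errConst r c₄ c₅ * (1 + (1 + c₃) / γ₁) + forwardConst c₂ c₄ c₅ * (2 * τ + 3) := rfl
  have hll := P.linLevel_nonneg l
  have herr := P.error_le_linLevel hn hε hε1 hε2
  constructor
  · rcases l with _ | m
    · have h1 : ‖P.x₀ - P.xdag‖ ≤ 4 / 3 * P.linRes 0 := (P.near_xdag.norm_le_res_zero P.e₀).1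
      have h2 := mul_le_mul_of_nonneg_left h1 (P.sqrt_α_pos 0).le
      have h3 : √(P.α 0) * P.linRes 0 ≤ P.linLevel 0 :=
        le_add_of_nonneg_right (P.linImageRes_nonneg 0)
      have h4 : 4 / 3 * P.linLevel 0 ≤ stopConst r τ γ₁ c₂ c₃ c₄ c₅ * P.linLevel 0 :=
        mul_le_mul_of_nonneg_right (by linarith) hll
      rw [iter_zero]
      linarith
    · have h1 := P.noise_le_linLevel hn hε hε1 hε2 hε3 (show m ≤ n by omega)
        (hdisc.2 m m.lt_succ_self)
      have h2 := P.linLevel_le_succ m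
      have h3 := herr (m + 1) hl
      have h4 : P.δ ≤ a * P.linLevel (m + 1) := by
        have h5 := mul_le_mul_of_nonneg_left h2
          (show 0 ≤ (τ - 1) / 2 + 2 * (√r * c₅) by linarith)
        have h6 := mul_le_mul_of_nonneg_left (h1.trans h5)
          (show 0 ≤ 2 / (τ - 1) by positivity)
        rw [show 2 / (τ - 1) * ((τ - 1) / 2 * P.δ) = P.δ by field_simp] at h6
        rw [ha]; linarith
      have h7 := mul_le_mul_of_nonneg_left h4 (show 0 ≤ errConst r c₄ c₅ by linarith)
      have h8 : errConst r c₄ c₅ * (1 + a) * P.linLevel (m + 1)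
          ≤ stopConst r τ γ₁ c₂ c₃ c₄ c₅ * P.linLevel (m + 1) :=
        mul_le_mul_of_nonneg_right (by linarith) hll
      have h9 := P.imageErr_nonneg (P.iter (m + 1))
      linarith
  · have hB := P.imageErr_stopping_le (hn l hl) hε hε1 hdisc.1
    have key : ∀ k, l ≤ k → k ≤ n → √(P.α k) * ‖P.iter l - P.xdag‖
        ≤ errConst r c₄ c₅ * (P.linLevel k + P.δ)
          + forwardConst c₂ c₄ c₅ * (2 * τ + 3) * P.δ := by
      intro k hlk hkn
      have h1 := herr k hkn
      have h2 := (P.step_forward hn hε hε1 hε4 hε5 k hlk hkn).1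
      have h3 := mul_le_mul_of_nonneg_left hB hF
      have h4 := mul_le_mul_of_nonneg_left
        (norm_sub_le_norm_sub_add_norm_sub (P.iter l) (P.iter k) P.xdag) (P.sqrt_α_pos k).le
      rw [norm_sub_rev (P.iter l) (P.iter k)] at h4
      have h5 := P.imageErr_nonneg (P.iter k)
      linarith
    intro k hlk
    have hlk0 := P.linLevel_nonneg k
    rcases le_total k n with hkn | hnk
    · have h1 := key k hlk hkn
      have h2 : (errConst r c₄ c₅ + forwardConst c₂ c₄ c₅ * (2 * τ + 3))
          * (P.linLevel k + P.δ)
          ≤ stopConst r τ γ₁ c₂ c₃ c₄ c₅ * (P.linLevel k + P.δ) := by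
        refine mul_le_mul_of_nonneg_right ?_ (by linarith)
        have := mul_nonneg (show 0 ≤ errConst r c₄ c₅ by linarith) ha0
        linarith
      have h3 := mul_nonneg p3 hlk0
      linarith
    · have h1 := key n hl le_rfl
      have h2 := mul_le_mul_of_nonneg_right (P.sqrt_α_antitone hnk)
        (norm_nonneg (P.iter l - P.xdag))
      simp only at h2
      have h3 : P.linLevel n ≤ (1 + c₃) / γ₁ * P.δ := by
        have e1 : P.linRes n ≤ ‖P.e₀‖ := P.near_xdag.norm_res_le (P.sequence.pos n) P.e₀
        have e2 : P.linImageRes n ≤ c₃ * √(P.α n) * ‖P.e₀‖ :=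
          P.near_xdag.norm_deriv_res_le (P.sequence.pos n) P.e₀
        have e3 := mul_le_mul_of_nonneg_left e1 (P.sqrt_α_pos n).le
        rw [div_mul_eq_mul_div, le_div_iff₀ hγ]
        have e4 : P.linLevel n ≤ (1 + c₃) * (√(P.α n) * ‖P.e₀‖) := by unfold linLevel; linarith
        have e5 := mul_le_mul_of_nonneg_right e4 hγ.le
        have e6 := mul_le_mul_of_nonneg_left hn' (show 0 ≤ 1 + c₃ by linarith)
        linarith
      have h4 := mul_le_mul_of_nonneg_left h3 (show 0 ≤ errConst r c₄ c₅ by linarith)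
      have h5 : (errConst r c₄ c₅ * (1 + (1 + c₃) / γ₁) + forwardConst c₂ c₄ c₅ * (2 * τ + 3))
          * P.δ ≤ stopConst r τ γ₁ c₂ c₃ c₄ c₅ * P.δ :=
        mul_le_mul_of_nonneg_right (by linarith) hδ.le
      have h6 : 0 ≤ stopConst r τ γ₁ c₂ c₃ c₄ c₅ * P.linLevel k :=
        mul_nonneg (by linarith) hlk0
      linarith

/-- The bound that yields all rates: if the linear method at parameter `a` has level at most
`√a Φ(a)` for a monotone `Φ`, the error at the stopping index is at most a multiple of
`Φ(s) + √r δ / √s` for every `s > 0`. -/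
theorem error_le_of_monotone {l : ℕ} {C : ℝ} (hC : 0 ≤ C)
    (h1 : √(P.α l) * ‖P.iter l - P.xdag‖ ≤ C * P.linLevel l)
    (h2 : ∀ k, l ≤ k → √(P.α k) * ‖P.iter l - P.xdag‖ ≤ C * (P.linLevel k + P.δ))
    {Φ : ℝ → ℝ} (hmono : ∀ a b, 0 < a → a ≤ b → Φ a ≤ Φ b)
    (hΦ : ∀ k, P.linLevel k ≤ √(P.α k) * Φ (P.α k)) {s : ℝ} (hs : 0 < s) :
    ‖P.iter l - P.xdag‖ ≤ C * (Φ s + √r * (P.δ / √s)) := by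
  have hδ := P.hδ
  have hss : 0 < √s := Real.sqrt_pos.2 hs
  rcases le_or_gt (P.α l) s with hl | hl
  · have e1 := hmono _ _ (P.sequence.pos l) hl
    have e2 : ‖P.iter l - P.xdag‖ ≤ C * Φ (P.α l) := by
      refine le_of_mul_le_mul_left ?_ (P.sqrt_α_pos l)
      have := mul_le_mul_of_nonneg_left (hΦ l) hC
      linarith
    refine e2.trans (mul_le_mul_of_nonneg_left ?_ hC)
    have : 0 ≤ √r * (P.δ / √s) := by positivity
    linarith
  · classical
    have hex : ∃ k, P.α k ≤ s :=
      ((P.sequence.tendsto_zero.eventually (gt_mem_nhds hs)).exists).imp fun _ h => h.le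
    have hk := Nat.find_spec hex
    have hmin := fun j (hj : j < Nat.find hex) => not_le.1 (Nat.find_min hex hj)
    have hlk : l < Nat.find hex := by
      by_contra hcon
      exact absurd ((P.α_antitone (not_lt.1 hcon)).trans hk) (not_le.2 hl)
    obtain ⟨m, hm⟩ : ∃ m, Nat.find hex = m + 1 := ⟨Nat.find hex - 1, by omega⟩
    rw [hm] at hk hlk
    have hαm := hmin m (by omega)
    have e1 := hmono _ _ (P.sequence.pos (m + 1)) hk
    have hsp := P.sqrt_α_pos (m + 1)
    have e2 : √s ≤ √r * √(P.α (m + 1)) :=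
      (Real.sqrt_le_sqrt hαm.le).trans (P.sqrt_α_le_succ m)
    refine le_of_mul_le_mul_left ?_ hsp
    have e3 := h2 (m + 1) (by omega)
    have e4 := hΦ (m + 1)
    have e5 := mul_le_mul_of_nonneg_left e1 hsp.le
    have e6 : P.δ ≤ √(P.α (m + 1)) * (√r * (P.δ / √s)) := by
      rw [show √(P.α (m + 1)) * (√r * (P.δ / √s)) = √r * √(P.α (m + 1)) * P.δ / √s by ring,
        le_div_iff₀ hss]
      have := mul_le_mul_of_nonneg_right e2 hδ.le
      linarith
    have e7 := mul_le_mul_of_nonneg_left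
      (show P.linLevel (m + 1) + P.δ
        ≤ √(P.α (m + 1)) * (Φ s + √r * (P.δ / √s)) by linarith) hC
    linarith

end NewtonProblem

open NewtonProblem in
/-- Existence of the stopping index, and control of the error there, under a smallness condition
that depends only on the constants. -/
theorem exists_threshold {r τ γ₁ c₂ c₃ c₄ c₅ c₇ c₈ : ℝ} (hτ : 1 < τ)
    (hc₃ : 0 < c₃) (hc₄ : 0 < c₄) (hc₇ : 0 < c₇) (hc₈ : 0 < c₈)
    (hγ₁ : c₃ * √r / (τ - 1) < γ₁) :
    ∃ η : ℝ, 0 < η ∧ ∃ C : ℝ, 0 ≤ C ∧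
      ∀ (𝕜 : Type*) (X : Type*) (Y : Type*) [RCLike 𝕜]
        [NormedAddCommGroup X] [InnerProductSpace 𝕜 X] [CompleteSpace X]
        [NormedAddCommGroup Y] [InnerProductSpace 𝕜 Y] [CompleteSpace Y] (c₀ c₁ : ℝ)
        (P : NewtonProblem 𝕜 X Y r τ γ₁ c₀ c₁ c₂ c₃ c₄ c₅ c₇ c₈), P.κ ≤ η →
        ∃ l, IsDiscrepancyIndex P.F P.iter P.yδ τ P.δ l ∧
          (∀ k ≤ l, P.iter k ∈ Metric.ball P.xdag P.ρ) ∧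
          √(P.α l) * ‖P.iter l - P.xdag‖ ≤ C * P.linLevel l ∧
          ∀ k, l ≤ k → √(P.α k) * ‖P.iter l - P.xdag‖ ≤ C * (P.linLevel k + P.δ) := by
  have hev : ∀ A b : ℝ, 0 < b → ∀ᶠ e in 𝓝[>] (0 : ℝ), e * A ≤ b := by
    intro A b hb
    have : Tendsto (fun e : ℝ => e * A) (𝓝[>] 0) (𝓝 0) := by
      have h : Tendsto (fun e : ℝ => e * A) (𝓝 0) (𝓝 (0 * A)) :=
        (continuous_id.mul continuous_const).tendsto 0
      rw [zero_mul] at h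
      exact h.mono_left nhdsWithin_le_nhds
    exact (this.eventually (gt_mem_nhds hb)).mono fun _ h => h.le
  have hτ' : 0 < (τ - 1) / 2 := by linarith
  have hpos : ∀ᶠ e in 𝓝[>] (0 : ℝ), 0 < e := eventually_mem_nhdsWithin
  obtain ⟨ε, hε0, hε1, hε2, hε3, hε4, hε5⟩ := (hpos.and ((hev 1 1 one_pos).and
    ((hev ((4 + c₄) * errConst r c₄ c₅) 1 one_pos).and
    ((hev (3 * errConst r c₄ c₅ * (√r * c₅)) _ hτ').and
    ((hev (40 * (c₅ + 1) * (backConst c₂ c₄ c₅ + 1)) 1 one_pos).and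
    (hev (10 * (1 + c₄) * forwardConst c₂ c₄ c₅) 1 one_pos)))))).exists
  have hγ' : 0 < (τ - 1) * γ₁ - c₃ * √r := by
    rw [div_lt_iff₀ (by linarith)] at hγ₁; linarith
  have hγ : 0 < γ₁ := (div_nonneg (mul_nonneg hc₃.le (Real.sqrt_nonneg _))
    (by linarith)).trans_lt hγ₁
  have hw : 0 ≤ weight γ₁ c₄ c₇ c₈ := by unfold weight errFactor; positivity
  have hΓ : 0 ≤ errFactor c₄ γ₁ := by unfold errFactor; positivity
  have hΛ : 0 ≤ imageFactor r γ₁ c₃ := by unfold imageFactor; positivity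
  obtain ⟨η, hη0, hη1, hη2, hη3, hη4⟩ := (hpos.and ((hev (weight γ₁ c₄ c₇ c₈) _ hε0).and
    ((hev (10 * imageFactor r γ₁ c₃ * errFactor c₄ γ₁) 1 one_pos).and
    ((hev (4 * c₄ * imageFactor r γ₁ c₃ * errFactor c₄ γ₁) 1 one_pos).and
    (hev (5 * imageFactor r γ₁ c₃ * (√r + 1) * errFactor c₄ γ₁) _ hγ'))))).exists
  rw [mul_one] at hε1
  refine ⟨η, hη0, |stopConst r τ γ₁ c₂ c₃ c₄ c₅|, abs_nonneg _, ?_⟩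
  intro 𝕜 X Y _ _ _ _ _ _ _ c₀ c₁ P hκ
  have scale : ∀ {A b : ℝ}, 0 ≤ A → η * A ≤ b → A * P.κ ≤ b := fun hA hb => by
    have := mul_le_mul_of_nonneg_left hκ hA
    linarith
  have hε := scale hw hη1
  have hs := small_of_weight hε hε1
  have k2 := scale (by positivity) hη2
  have k3 := scale (by positivity) hη3
  have k4 := scale (by positivity) hη4
  obtain ⟨n, hn, hres, hn'⟩ := P.exists_stopping hs (by linarith) (by linarith) (by linarith)
  classical
  have hex : ∃ l, ‖P.F (P.iter l) - P.yδ‖ ≤ τ * P.δ := ⟨n, hres⟩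
  have hln : Nat.find hex ≤ n := Nat.find_min' hex hres
  have hdisc : IsDiscrepancyIndex P.F P.iter P.yδ τ P.δ (Nat.find hex) :=
    ⟨Nat.find_spec hex, fun j hj => not_le.1 (Nat.find_min hex hj)⟩
  obtain ⟨r1, r2⟩ := P.error_at_stopping hn hn' hε hε1 hε2 hε3 hε4 hε5 hln hdisc
  refine ⟨Nat.find hex, hdisc, fun k hk => (hn k (hk.trans hln)).mem_ball,
    r1.trans (mul_le_mul_of_nonneg_right (le_abs_self _) (P.linLevel_nonneg _)),
    fun k hk => (r2 k hk).trans (mul_le_mul_of_nonneg_right (le_abs_self _) ?_)⟩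
  linarith [P.linLevel_nonneg k, P.hδ]

/-! ### Source conditions -/

namespace NewtonProblem

variable {𝕜 X Y : Type*} [RCLike 𝕜] [NormedAddCommGroup X] [InnerProductSpace 𝕜 X]
  [CompleteSpace X] [NormedAddCommGroup Y] [InnerProductSpace 𝕜 Y] [CompleteSpace Y]
  {r τ γ₁ c₀ c₁ c₂ c₃ c₄ c₅ c₇ c₈ : ℝ}
  (P : NewtonProblem 𝕜 X Y r τ γ₁ c₀ c₁ c₂ c₃ c₄ c₅ c₇ c₈)

/-- A source condition `x₀ - x† = φ(A) ω` turns pointwise bounds for `r_a φ` into bounds for the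
level of the linear method. -/
theorem linLevel_le_of_source {φ : ℝ → ℝ} (hφ : ContinuousOn φ (Icc 0 (1 / 2)))
    (hφ0 : ∀ t ∈ Icc (0 : ℝ) (1 / 2), 0 ≤ φ t) {ω : X}
    (hω : P.x₀ - P.xdag = opFun φ (normalOp (P.F' P.xdag)) ω) {ψ : ℝ → ℝ}
    (h1 : ∀ a, 0 < a → ∀ t ∈ Icc (0 : ℝ) (1 / 2), residualFn P.g a t * φ t ≤ ψ a)
    (h2 : ∀ a, 0 < a → ∀ t ∈ Icc (0 : ℝ) (1 / 2),
      residualFn P.g a t * (√t * φ t) ≤ √a * ψ a) (k : ℕ) :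
    P.linLevel k ≤ √(P.α k) * (2 * ψ (P.α k) * ‖ω‖) := by
  have hx := P.near_xdag
  have ha := P.sequence.pos k
  have cr := hx.continuousOn_residual ha
  have cφ := hφ.mono hx.icc_subset
  have e1 : P.res (P.α k) P.xdag P.e₀ = opFun (fun t => residualFn P.g (P.α k) t * φ t)
      (normalOp (P.F' P.xdag)) ω := by
    rw [opFun_mul _ cr cφ, ← hω]; rfl
  have e2 : P.linRes k ≤ ψ (P.α k) * ‖ω‖ := by
    rw [linRes, e1]
    refine norm_opFun_le_const _ (cr.mul cφ) (fun t ht => ?_) ω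
    have ht' := hx.icc_subset ht
    simp only [Pi.mul_apply]
    rw [abs_of_nonneg (mul_nonneg (P.filter.residual_pos _ ha t ht').le (hφ0 t ht'))]
    exact h1 _ ha t ht'
  have e3 : P.linImageRes k ≤ √(P.α k) * ψ (P.α k) * ‖ω‖ := by
    rw [linImageRes, e1, norm_apply_opFun (P.F' P.xdag)
      (f := fun t => residualFn P.g (P.α k) t * φ t) (cr.mul cφ)]
    refine norm_opFun_le_const _ (cr.mul cφ).sqrt_mul_self (fun t ht => ?_) ω
    have ht' := hx.icc_subset ht
    have := h2 _ ha t ht'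
    simp only [Pi.mul_apply]
    rw [abs_of_nonneg (mul_nonneg (Real.sqrt_nonneg t)
      (mul_nonneg (P.filter.residual_pos _ ha t ht').le (hφ0 t ht')))]
    linarith
  have e4 := mul_le_mul_of_nonneg_left e2 (Real.sqrt_nonneg (P.α k))
  unfold linLevel
  linarith

theorem residual_mul_rpow_le {ν d : ℝ} (hν : 0 < ν)
    (hd : QualificationBound P.g (ν + 1 / 2) d) {a : ℝ} (ha : 0 < a) {t : ℝ}
    (ht : t ∈ Icc (0 : ℝ) (1 / 2)) :
    residualFn P.g a t * t ^ ν ≤ |d| ^ (ν / (ν + 1 / 2)) * a ^ ν := by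
  have hp : 0 < ν + 1 / 2 := by linarith
  set θ := ν / (ν + 1 / 2) with hθ
  have hθ0 : 0 ≤ θ := by positivity
  have hθ1 : θ ≤ 1 := by rw [hθ, div_le_one hp]; linarith
  have hpθ : (ν + 1 / 2) * θ = ν := by rw [hθ]; field_simp
  have h0 := P.filter.residual_pos a ha t ht
  have h1 := P.filter.residual_le_one a ha t ht
  have h2 : residualFn P.g a t * t ^ (ν + 1 / 2) ≤ |d| * a ^ (ν + 1 / 2) :=
    (hd a ha t ht).trans (mul_le_mul_of_nonneg_right (le_abs_self d)
      (Real.rpow_nonneg ha.le _))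
  have h3 := Real.rpow_le_rpow (mul_nonneg h0.le (Real.rpow_nonneg ht.1 _)) h2 hθ0
  rw [Real.mul_rpow h0.le (Real.rpow_nonneg ht.1 _),
    Real.mul_rpow (abs_nonneg d) (Real.rpow_nonneg ha.le _), ← Real.rpow_mul ht.1,
    ← Real.rpow_mul ha.le, hpθ] at h3
  refine le_trans (mul_le_mul_of_nonneg_right ?_ (Real.rpow_nonneg ht.1 _)) h3
  calc residualFn P.g a t = residualFn P.g a t ^ (1 : ℝ) := (Real.rpow_one _).symm
    _ ≤ _ := Real.rpow_le_rpow_of_exponent_ge h0 h1 hθ1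

theorem linLevel_le_of_holder {ν d : ℝ} (hν : 0 < ν)
    (hd : QualificationBound P.g (ν + 1 / 2) d) {ω : X}
    (hω : P.x₀ - P.xdag = opFun (fun t : ℝ => t ^ ν) (normalOp (P.F' P.xdag)) ω) (k : ℕ) :
    P.linLevel k ≤ √(P.α k)
      * (2 * ((|d| ^ (ν / (ν + 1 / 2)) + |d|) * P.α k ^ ν) * ‖ω‖) := by
  refine P.linLevel_le_of_source
    (ψ := fun a => (|d| ^ (ν / (ν + 1 / 2)) + |d|) * a ^ ν)
    (Real.continuous_rpow_const hν.le).continuousOn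
    (fun t ht => Real.rpow_nonneg ht.1 _) hω (fun a ha t ht => ?_) (fun a ha t ht => ?_) k
  · have h1 := P.residual_mul_rpow_le hν hd ha ht
    have h2 := mul_nonneg (abs_nonneg d) (Real.rpow_nonneg ha.le ν)
    linarith
  · have h1 := hd a ha t ht
    rw [Real.rpow_add_of_nonneg ht.1 hν.le (by norm_num), ← Real.sqrt_eq_rpow,
      Real.rpow_add ha, ← Real.sqrt_eq_rpow] at h1
    have h3 := mul_nonneg (Real.rpow_nonneg ha.le ν) (Real.sqrt_nonneg a)
    have h2 := mul_le_mul_of_nonneg_right (le_abs_self d) h3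
    have h4 := mul_nonneg (Real.rpow_nonneg (abs_nonneg d) (ν / (ν + 1 / 2))) h3
    linarith

end NewtonProblem

/-! ### The logarithmic modulus -/

/-- The modulus `(1 + max 0 (-log a)) ^ (-μ)`, constant for `a ≥ 1`. -/
def logModulus (μ a : ℝ) : ℝ := (1 + max 0 (-Real.log a)) ^ (-μ)

theorem logModulus_base_pos (a : ℝ) : 0 < 1 + max 0 (-Real.log a) := by
  have := le_max_left 0 (-Real.log a); linarith

theorem logModulus_pos (μ a : ℝ) : 0 < logModulus μ a :=
  Real.rpow_pos_of_pos (logModulus_base_pos a) _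

theorem logModulus_mono {μ : ℝ} (hμ : 0 < μ) {a b : ℝ} (ha : 0 < a) (hab : a ≤ b) :
    logModulus μ a ≤ logModulus μ b := by
  refine Real.rpow_le_rpow_of_nonpos (logModulus_base_pos b) ?_ (by linarith)
  have := max_le_max_left 0 (neg_le_neg (Real.log_le_log ha hab))
  linarith

theorem logModulus_one (μ : ℝ) : logModulus μ 1 = 1 := by simp [logModulus]

/-- The modulus decays more slowly than the square root. -/
theorem logModulus_le_sqrt {μ : ℝ} (hμ : 0 < μ) {a t : ℝ} (ha : 0 < a) (hat : a ≤ t)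
    (ht : t ≤ 1) : logModulus μ t * √a ≤ (1 + 2 * μ) ^ μ * √t * logModulus μ a := by
  have ht0 : 0 < t := ha.trans_le hat
  have hlt : 0 ≤ -Real.log t := by linarith [Real.log_nonpos ht0.le ht]
  have hla : 0 ≤ -Real.log a := by linarith [Real.log_nonpos ha.le (hat.trans ht)]
  set x := t / a with hx
  have hx1 : 1 ≤ x := (one_le_div ha).2 hat
  have hx0 : 0 < x := by linarith
  have hlx : Real.log x = Real.log t - Real.log a := Real.log_div ht0.ne' ha.ne'
  have hlx0 : 0 ≤ Real.log x := Real.log_nonneg hx1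
  -- `1 + log x ≤ (1 + 2 μ) x ^ (1 / (2 μ))`
  have h1 : 1 + Real.log x ≤ (1 + 2 * μ) * x ^ (1 / (2 * μ)) := by
    have e1 := Real.log_le_rpow_div hx0.le (show 0 < 1 / (2 * μ) by positivity)
    have e2 := Real.one_le_rpow hx1 (show 0 ≤ 1 / (2 * μ) by positivity)
    rw [div_div_eq_mul_div, div_one] at e1
    linarith
  have h2 : (1 + Real.log x) ^ μ ≤ (1 + 2 * μ) ^ μ * √x := by
    have e1 := Real.rpow_le_rpow (by linarith) h1 hμ.le
    rw [Real.mul_rpow (by linarith) (Real.rpow_nonneg hx0.le _), ← Real.rpow_mul hx0.le,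
      show 1 / (2 * μ) * μ = 1 / 2 by field_simp, ← Real.sqrt_eq_rpow] at e1
    exact e1
  have h3 : 1 - Real.log a ≤ (1 - Real.log t) * (1 + Real.log x) := by nlinarith
  have h4 : logModulus μ t ≤ (1 + Real.log x) ^ μ * logModulus μ a := by
    unfold logModulus
    rw [max_eq_right hlt, max_eq_right hla, Real.rpow_neg (by linarith),
      Real.rpow_neg (by linarith), ← div_eq_mul_inv,
      le_div_iff₀ (Real.rpow_pos_of_pos (by linarith) _), inv_mul_eq_div,
      div_le_iff₀ (Real.rpow_pos_of_pos (by linarith) _), mul_comm,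
      ← Real.mul_rpow (by linarith) (by linarith)]
    exact Real.rpow_le_rpow (by linarith) (by linarith) hμ.le
  have h5 : √x * √a = √t := by
    rw [← Real.sqrt_mul hx0.le, hx, div_mul_cancel₀ _ ha.ne']
  have hsa : 0 < √a := Real.sqrt_pos.2 ha
  calc logModulus μ t * √a ≤ (1 + 2 * μ) ^ μ * √x * logModulus μ a * √a :=
        mul_le_mul_of_nonneg_right
          (h4.trans (mul_le_mul_of_nonneg_right h2 (logModulus_pos μ a).le)) hsa.le
    _ = (1 + 2 * μ) ^ μ * (√x * √a) * logModulus μ a := by ring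
    _ = _ := by rw [h5]

theorem neg_log_rpow_nonneg {μ t : ℝ} (ht : t ∈ Icc (0 : ℝ) (1 / 2)) :
    0 ≤ (-Real.log t) ^ (-μ) :=
  Real.rpow_nonneg (by linarith [Real.log_nonpos ht.1 (by linarith [ht.2])]) _

theorem half_le_neg_log {t : ℝ} (h0 : 0 < t) (ht : t ≤ 1 / 2) : 1 / 2 ≤ -Real.log t := by
  have h1 := Real.log_le_log h0 ht
  rw [Real.log_div one_ne_zero two_ne_zero, Real.log_one] at h1
  linarith [Real.log_two_gt_d9]

theorem neg_log_rpow_le {μ : ℝ} (hμ : 0 < μ) {t : ℝ} (h0 : 0 < t) (ht : t ≤ 1 / 2) :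
    (-Real.log t) ^ (-μ) ≤ 3 ^ μ * logModulus μ t := by
  have h1 := half_le_neg_log h0 ht
  unfold logModulus
  rw [max_eq_right (by linarith), Real.rpow_neg (by linarith), Real.rpow_neg (by linarith),
    ← div_eq_mul_inv, le_div_iff₀ (Real.rpow_pos_of_pos (by linarith) _), inv_mul_eq_div,
    div_le_iff₀ (Real.rpow_pos_of_pos (by linarith) _),
    ← Real.mul_rpow (by norm_num) (by linarith)]
  exact Real.rpow_le_rpow (by linarith) (by linarith) hμ.le

theorem neg_log_rpow_zero {μ : ℝ} (hμ : 0 < μ) : (-Real.log 0) ^ (-μ) = 0 := by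
  rw [Real.log_zero, neg_zero, Real.zero_rpow (by linarith)]

theorem continuousOn_neg_log_rpow {μ : ℝ} (hμ : 0 < μ) :
    ContinuousOn (fun t : ℝ => (-Real.log t) ^ (-μ)) (Icc 0 (1 / 2)) := by
  intro t ht
  rcases ht.1.eq_or_lt with rfl | h0
  · -- at `0` the value is `0`, which is also the limit
    refine ContinuousWithinAt.mono (continuousWithinAt_Ioi_iff_Ici.1 ?_) Icc_subset_Ici_self
    have h := (tendsto_rpow_neg_atTop hμ).comp
      (tendsto_neg_atBot_atTop.comp Real.tendsto_log_nhdsGT_zero)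
    simp only [ContinuousWithinAt, neg_log_rpow_zero hμ]
    exact h
  · have h1 := half_le_neg_log h0 ht.2
    exact (((Real.continuousAt_log h0.ne').neg).rpow_const
      (Or.inl (by simp only [Pi.neg_apply]; linarith))).continuousWithinAt

namespace NewtonProblem

variable {𝕜 X Y : Type*} [RCLike 𝕜] [NormedAddCommGroup X] [InnerProductSpace 𝕜 X]
  [CompleteSpace X] [NormedAddCommGroup Y] [InnerProductSpace 𝕜 Y] [CompleteSpace Y]
  {r τ γ₁ c₀ c₁ c₂ c₃ c₄ c₅ c₇ c₈ : ℝ}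
  (P : NewtonProblem 𝕜 X Y r τ γ₁ c₀ c₁ c₂ c₃ c₄ c₅ c₇ c₈)

theorem linLevel_le_of_log {μ : ℝ} (hμ : 0 < μ) {ω : X}
    (hω : P.x₀ - P.xdag
      = opFun (fun t : ℝ => (-Real.log t) ^ (-μ)) (normalOp (P.F' P.xdag)) ω) (k : ℕ) :
    P.linLevel k ≤ √(P.α k)
      * (2 * (3 ^ μ * (1 + (1 + 2 * μ) ^ μ * (c₀ + c₃)) * logModulus μ (P.α k)) * ‖ω‖) := by
  have hc₀ := P.hc₀
  have hc₃ := P.hc₃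
  have h3 : (0 : ℝ) < 3 ^ μ := by positivity
  have hM : 0 < (1 + 2 * μ) ^ μ := Real.rpow_pos_of_pos (by linarith) _
  refine P.linLevel_le_of_source
    (ψ := fun a => 3 ^ μ * (1 + (1 + 2 * μ) ^ μ * (c₀ + c₃)) * logModulus μ a)
    (continuousOn_neg_log_rpow hμ) (fun t ht => neg_log_rpow_nonneg ht) hω
    (fun a ha t ht => ?_) (fun a ha t ht => ?_) k
  all_goals
    have hψ := logModulus_pos μ a
    have hψt := logModulus_pos μ t
    have hsa : 0 < √a := Real.sqrt_pos.2 ha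
    have hr0 := P.filter.residual_pos a ha t ht
    have hr1 := P.filter.residual_le_one a ha t ht
    rcases ht.1.eq_or_lt with rfl | h0
    · simp only [neg_log_rpow_zero hμ, mul_zero]
      positivity
    have e1 := neg_log_rpow_le hμ h0 ht.2
    have hst : 0 < √t := Real.sqrt_pos.2 h0
  · -- the bound by `logModulus μ a`, without the power of `3`
    have key : residualFn P.g a t * logModulus μ t
        ≤ (1 + (1 + 2 * μ) ^ μ * (c₀ + c₃)) * logModulus μ a := by
      rcases le_total t a with hta | hat
      · have f1 := logModulus_mono hμ h0 hta
        have f2 : residualFn P.g a t * logModulus μ t ≤ logModulus μ a :=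
          (mul_le_of_le_one_left hψt.le hr1).trans f1
        have f3 : 0 ≤ (1 + 2 * μ) ^ μ * (c₀ + c₃) * logModulus μ a := by positivity
        linarith
      · have f1 := logModulus_le_sqrt hμ ha hat (by linarith [ht.2])
        have f2 := P.filter.residual_mul_sqrt_le a ha t ht
        refine le_of_mul_le_mul_right ?_ hsa
        have f3 := mul_le_mul_of_nonneg_left f1 hr0.le
        have f4 := mul_le_mul_of_nonneg_left f2 (mul_pos hM hψ).le
        have f5 : 0 ≤ (1 + (1 + 2 * μ) ^ μ * c₀) * logModulus μ a * √a := by positivity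
        linarith
    have f1 := mul_le_mul_of_nonneg_left e1 hr0.le
    have f2 := mul_le_mul_of_nonneg_left key h3.le
    linarith
  · have key : residualFn P.g a t * (√t * logModulus μ t)
        ≤ √a * ((1 + (1 + 2 * μ) ^ μ * (c₀ + c₃)) * logModulus μ a) := by
      rcases le_total t a with hta | hat
      · have f1 := mul_le_mul (Real.sqrt_le_sqrt hta) (logModulus_mono hμ h0 hta) hψt.le hsa.le
        have f2 : residualFn P.g a t * (√t * logModulus μ t) ≤ √a * logModulus μ a :=
          (mul_le_of_le_one_left (by positivity) hr1).trans f1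
        have f3 : 0 ≤ √a * ((1 + 2 * μ) ^ μ * (c₀ + c₃) * logModulus μ a) := by positivity
        linarith
      · have f1 := logModulus_le_sqrt hμ ha hat (by linarith [ht.2])
        have f2 := P.filter.residual_mul_le a ha t ht
        refine le_of_mul_le_mul_right ?_ hsa
        have f3 := mul_le_mul_of_nonneg_left f1 (mul_pos hr0 hst).le
        have f4 := mul_le_mul_of_nonneg_left f2 (mul_pos hM hψ).le
        have f5 : 0 ≤ √a * ((1 + (1 + 2 * μ) ^ μ * c₃) * logModulus μ a) * √a := by positivity
        have f6 : residualFn P.g a t * √t * ((1 + 2 * μ) ^ μ * √t * logModulus μ a)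
            = (1 + 2 * μ) ^ μ * logModulus μ a * (residualFn P.g a t * t) := by
          rw [show residualFn P.g a t * √t * ((1 + 2 * μ) ^ μ * √t * logModulus μ a)
            = (1 + 2 * μ) ^ μ * logModulus μ a * (residualFn P.g a t * (√t * √t)) by ring,
            Real.mul_self_sqrt h0.le]
        have f7 : (1 + 2 * μ) ^ μ * logModulus μ a * (c₀ * a)
            = √a * ((1 + 2 * μ) ^ μ * c₀ * logModulus μ a) * √a := by
          rw [show √a * ((1 + 2 * μ) ^ μ * c₀ * logModulus μ a) * √a
            = (1 + 2 * μ) ^ μ * logModulus μ a * (c₀ * (√a * √a)) by ring,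
            Real.mul_self_sqrt ha.le]
        linarith
    have f1 := mul_le_mul_of_nonneg_left e1 (mul_pos hr0 hst).le
    have f2 := mul_le_mul_of_nonneg_left key h3.le
    linarith

end NewtonProblem

/-- On bounded intervals the modulus and the square root are dominated by
`(1 + |log q|) ^ (-μ)`. -/
theorem logModulus_le_abs {μ M q : ℝ} (hμ : 0 < μ) (hq : 0 < q) (hM : q ≤ M) :
    logModulus μ q ≤ (1 + |Real.log M|) ^ μ * (1 + |Real.log q|) ^ (-μ) ∧
    √q ≤ ((1 + 2 * μ) ^ μ + √M) * (1 + |Real.log M|) ^ μ * (1 + |Real.log q|) ^ (-μ) := by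
  have hMl : 0 ≤ |Real.log M| := abs_nonneg _
  have hql : 0 ≤ |Real.log q| := abs_nonneg _
  set A := (1 + |Real.log M|) ^ μ with hA
  set b := (1 + |Real.log q|) ^ (-μ) with hb
  have hA1 : 1 ≤ A := Real.one_le_rpow (by linarith) hμ.le
  have hb0 : 0 < b := Real.rpow_pos_of_pos (by linarith) _
  have hK : 0 < (1 + 2 * μ) ^ μ := Real.rpow_pos_of_pos (by linarith) _
  have hsM := Real.sqrt_nonneg M
  rcases le_or_gt q 1 with h1 | h1
  · have hl := Real.log_nonpos hq.le h1
    have e1 : logModulus μ q = b := by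
      rw [logModulus, hb, max_eq_right (by linarith), abs_of_nonpos hl]
    have e2 := logModulus_le_sqrt hμ hq h1 le_rfl
    rw [logModulus_one, Real.sqrt_one, mul_one, one_mul, e1] at e2
    rw [e1]
    have e3 : b ≤ A * b := le_mul_of_one_le_left hb0.le hA1
    refine ⟨e3, e2.trans ?_⟩
    have e4 := mul_le_mul_of_nonneg_left e3 hK.le
    have e5 : 0 ≤ √M * (A * b) := by positivity
    linarith
  · have hl := Real.log_pos h1
    have hlM : Real.log q ≤ Real.log M := Real.log_le_log hq hM
    have e1 : logModulus μ q = 1 := by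
      rw [logModulus, max_eq_left (by linarith), add_zero, Real.one_rpow]
    have e2 : 1 ≤ A * b := by
      rw [hA, hb, Real.rpow_neg (by linarith), ← div_eq_mul_inv,
        one_le_div (Real.rpow_pos_of_pos (by linarith) _)]
      refine Real.rpow_le_rpow (by linarith) ?_ hμ.le
      rw [abs_of_pos hl, abs_of_pos (by linarith)]
      linarith
    refine ⟨e1.le.trans e2, (Real.sqrt_le_sqrt hM).trans ?_⟩
    have e3 := mul_le_mul_of_nonneg_left e2 hsM
    have e5 : 0 ≤ (1 + 2 * μ) ^ μ * (A * b) := by positivity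
    linarith

open NewtonProblem in
theorem theorem2p2
    (r τ γ₁ c₀ c₁ c₂ c₃ c₄ c₅ c₇ c₈ : ℝ)
    (hr : 1 < r) (hτ : 1 < τ) (hc₀ : 0 < c₀) (hc₁ : 0 < c₁) (hc₂ : 0 < c₂) (hc₃ : 0 < c₃)
    (hc₄ : 0 < c₄) (hc₅ : 1 < c₅) (hc₇ : 0 < c₇) (hc₈ : 0 < c₈)
    (hγ₁ : c₃ * √r / (τ - 1) < γ₁) :
    -- the constants: `Cν ν d` for the Hölder rate, `Cμ μ M` for the logarithmic rate
    ∃ η₁ : ℝ, 0 < η₁ ∧ ∃ Cν Cμ : ℝ → ℝ → ℝ,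
      ∀ (𝕜 : Type*) (X : Type*) (Y : Type*) [RCLike 𝕜]
        [NormedAddCommGroup X] [InnerProductSpace 𝕜 X] [CompleteSpace X]
        [NormedAddCommGroup Y] [InnerProductSpace 𝕜 Y] [CompleteSpace Y]
        (g : ℝ → ℝ → ℝ) (α : ℕ → ℝ)
        (D : Set X) (F : X → Y) (F' : X → X →L[𝕜] Y)
        (xdag x₀ : X) (ρ K₀ K₁ K₂ δ : ℝ) (yδ : Y),
        FilterConditions g c₀ c₁ c₂ c₃ c₄ →
        SequenceConditions g α r c₅ →
        OperatorConditions D F F' xdag ρ g c₃ (α 0) →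
        2 * (1 + c₄ * γ₁) * ‖x₀ - xdag‖ < ρ →
        0 < ρ → 0 < K₀ → 0 < K₁ → 0 < K₂ →
        RangeInvariance F' xdag ρ K₀ →
        TwoTermCondition F' xdag ρ K₁ K₂ →
        CommutatorEstimates F' xdag ρ g K₀ K₁ K₂ c₇ c₈ →
        (K₀ + K₁ + K₂) * ‖x₀ - xdag‖ ≤ η₁ →
        0 < δ → ‖yδ - F xdag‖ ≤ δ →
        ∃ kδ : ℕ,
          IsDiscrepancyIndex F (newtonIter F F' g α x₀ yδ) yδ τ δ kδ ∧
          (∀ k ≤ kδ, newtonIter F F' g α x₀ yδ k ∈ Metric.ball xdag ρ) ∧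
          -- (i) Hölder source condition
          (∀ νbar : EReal, IsQualification g νbar →
            ∀ (ν d : ℝ) (ω : X), 0 < ν → ((ν + 1 / 2 : ℝ) : EReal) ≤ νbar →
            QualificationBound g (ν + 1 / 2) d →
            x₀ - xdag = opFun (fun t : ℝ => t ^ ν) (normalOp (F' xdag)) ω →
            ‖newtonIter F F' g α x₀ yδ kδ - xdag‖
              ≤ Cν ν d * ‖ω‖ ^ (1 / (1 + 2 * ν)) * δ ^ (2 * ν / (1 + 2 * ν))) ∧
          -- (ii) logarithmic source condition
          (∀ (μ M : ℝ) (ω : X), 0 < μ → δ ≤ M * ‖ω‖ →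
            x₀ - xdag = opFun (fun t : ℝ => (-Real.log t) ^ (-μ)) (normalOp (F' xdag)) ω →
            ‖newtonIter F F' g α x₀ yδ kδ - xdag‖
              ≤ Cμ μ M * ‖ω‖ * (1 + |Real.log (δ / ‖ω‖)|) ^ (-μ)) := by
  obtain ⟨η, hη, C, hC, H⟩ := exists_threshold (c₂ := c₂) (c₅ := c₅) hτ hc₃ hc₄ hc₇ hc₈ hγ₁
  refine ⟨η, hη,
    fun ν d => C * (2 * (|d| ^ (ν / (ν + 1 / 2)) + |d|) + √r),
    fun μ M => C * (2 * (3 ^ μ * (1 + (1 + 2 * μ) ^ μ * (c₀ + c₃)))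
      + √r * ((1 + 2 * μ) ^ μ + √M)) * (1 + |Real.log M|) ^ μ, ?_⟩
  intro 𝕜 X Y _ _ _ _ _ _ _ g α D F F' xdag x₀ ρ K₀ K₁ K₂ δ yδ hfil hseq hop hrad hρ hK₀ hK₁ hK₂
    _ htwo hcom hκ hδ hnoise
  let P : NewtonProblem 𝕜 X Y r τ γ₁ c₀ c₁ c₂ c₃ c₄ c₅ c₇ c₈ :=
    { g := g, α := α, D := D, F := F, F' := F', xdag := xdag, x₀ := x₀, ρ := ρ, K₀ := K₀,
      K₁ := K₁, K₂ := K₂, δ := δ, yδ := yδ, hr := hr, hτ := hτ, hc₀ := hc₀, hc₂ := hc₂,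
      hc₃ := hc₃, hc₄ := hc₄, hc₅ := hc₅, hc₇ := hc₇, hc₈ := hc₈, hγ₁ := hγ₁, filter := hfil,
      sequence := hseq, operator := hop, radius := hrad, hK₀ := hK₀, hK₁ := hK₁, hK₂ := hK₂,
      twoTerm := htwo, commutator := hcom, hδ := hδ, noise := hnoise }
  obtain ⟨l, hdisc, hball, h1, h2⟩ := H 𝕜 X Y c₀ c₁ P hκ
  refine ⟨l, hdisc, hball, ?_, ?_⟩
  · intro _ _ ν d ω hν _ hd hω
    have hp : 0 < 1 + 2 * ν := by linarith
    set D' := |d| ^ (ν / (ν + 1 / 2)) + |d| with hD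
    have hD0 : 0 ≤ D' := add_nonneg (Real.rpow_nonneg (abs_nonneg _) _) (abs_nonneg _)
    have hlev := P.linLevel_le_of_holder hν hd hω
    rcases (norm_nonneg ω).eq_or_lt with hω0 | hω0
    · -- `ω = 0` forces `x₀ = x†`, and the error at the stopping index vanishes
      have e1 := hlev l
      rw [← hω0, mul_zero, mul_zero] at e1
      have e2 : √(P.α l) * ‖P.iter l - P.xdag‖ ≤ 0 :=
        h1.trans (mul_nonpos_of_nonneg_of_nonpos hC e1)
      have e3 : ‖P.iter l - P.xdag‖ ≤ 0 := by
        by_contra hcon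
        exact absurd (mul_pos (P.sqrt_α_pos l) (not_le.1 hcon)) (not_lt.2 e2)
      exact e3.trans (by positivity)
    · set W := ‖ω‖ with hW
      have hq : 0 < δ / W := div_pos hδ hω0
      -- the parameter that balances `s ^ ν ‖ω‖` and `δ / √s`
      set s := (δ / W) ^ (2 / (1 + 2 * ν)) with hs
      have hs0 : 0 < s := Real.rpow_pos_of_pos hq _
      have key := P.error_le_of_monotone hC h1 h2 (Φ := fun a => 2 * (D' * a ^ ν) * W)
        (fun a b ha hab => by
          have := Real.rpow_le_rpow ha.le hab hν.le
          gcongr) hlev hs0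
      have e1 : s ^ ν * W = W ^ (1 / (1 + 2 * ν)) * δ ^ (2 * ν / (1 + 2 * ν)) := by
        rw [hs, ← Real.rpow_mul hq.le, Real.div_rpow hδ.le hω0.le,
          show 2 / (1 + 2 * ν) * ν = 2 * ν / (1 + 2 * ν) by ring,
          show (1 : ℝ) / (1 + 2 * ν) = 1 - 2 * ν / (1 + 2 * ν) by field_simp; ring,
          Real.rpow_sub hω0, Real.rpow_one]
        ring
      have e2 : δ / √s = W ^ (1 / (1 + 2 * ν)) * δ ^ (2 * ν / (1 + 2 * ν)) := by
        rw [hs, Real.sqrt_eq_rpow, ← Real.rpow_mul hq.le,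
          show 2 / (1 + 2 * ν) * (1 / 2) = 1 / (1 + 2 * ν) by ring,
          Real.div_rpow hδ.le hω0.le,
          show 2 * ν / (1 + 2 * ν) = 1 - 1 / (1 + 2 * ν) by field_simp; ring,
          Real.rpow_sub hδ, Real.rpow_one]
        have := (Real.rpow_pos_of_pos hδ (1 / (1 + 2 * ν))).ne'
        have := (Real.rpow_pos_of_pos hω0 (1 / (1 + 2 * ν))).ne'
        field_simp
      change ‖P.iter l - P.xdag‖ ≤ _
      refine key.trans (le_of_eq ?_)
      change C * (2 * (D' * s ^ ν) * W + √r * (δ / √s)) = _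
      rw [e2, show 2 * (D' * s ^ ν) * W = 2 * D' * (s ^ ν * W) by ring, e1]
      ring
  · intro μ M ω hμ hM hω
    have hω0 : 0 < ‖ω‖ := by
      rcases (norm_nonneg ω).eq_or_lt with h | h
      · rw [← h, mul_zero] at hM; linarith
      · exact h
    set W := ‖ω‖ with hW
    have hq : 0 < δ / W := div_pos hδ hω0
    have hqM : δ / W ≤ M := (div_le_iff₀ hω0).2 hM
    set D' := 3 ^ μ * (1 + (1 + 2 * μ) ^ μ * (c₀ + c₃)) with hD
    have hD0 : 0 ≤ D' := by
      have := Real.rpow_nonneg (show 0 ≤ 1 + 2 * μ by linarith) μ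
      positivity
    have key := P.error_le_of_monotone hC h1 h2 (Φ := fun a => 2 * (D' * logModulus μ a) * W)
      (fun a b ha hab => by
        have := logModulus_mono hμ ha hab
        gcongr) (P.linLevel_le_of_log hμ hω) hq
    obtain ⟨e1, e2⟩ := logModulus_le_abs hμ hq hqM
    have e3 : δ / √(δ / W) = W * √(δ / W) := by
      rw [div_eq_iff (Real.sqrt_pos.2 hq).ne', mul_assoc, Real.mul_self_sqrt hq.le]
      field_simp
    change ‖P.iter l - P.xdag‖ ≤ _
    refine key.trans ?_
    change C * (2 * (D' * logModulus μ (δ / W)) * W + √r * (δ / √(δ / W))) ≤ _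
    rw [e3]
    have f1 := mul_le_mul_of_nonneg_left e1 (show 0 ≤ 2 * D' * W by positivity)
    have f2 := mul_le_mul_of_nonneg_left e2 (show 0 ≤ √r * W by positivity)
    have f3 : 2 * (D' * logModulus μ (δ / W)) * W + √r * (W * √(δ / W))
        ≤ 2 * D' * W * ((1 + |Real.log M|) ^ μ * (1 + |Real.log (δ / W)|) ^ (-μ))
          + √r * W * (((1 + 2 * μ) ^ μ + √M) * (1 + |Real.log M|) ^ μ
            * (1 + |Real.log (δ / W)|) ^ (-μ)) := by linarith
    refine (mul_le_mul_of_nonneg_left f3 hC).trans (le_of_eq ?_)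
    ring

end
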